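/- **Theorem 4.1.** Let $(M^{2m+s},\phi,\xi_\alpha,\eta_\alpha,g)$, $\alpha\in\{1,\dots,s\}$, $s\ge 1$, be an $\mathcal S$-space form of constant $\phi$-sectional curvature $c$. That is, $(M,g)$ is a smooth Riemannian manifold of dimension $2m+s$ with Levi-Civita connection $\nabla$, $\phi$ is a smooth $(1,1)$-tensor field of rank $2m$, the $\xi_\alpha$ are smooth vector fields and the $\eta_\alpha$ are 1-forms, such that $$\phi^2=-\mathrm{Id}+\sum_\alpha\eta_\alpha\otimes\xi_\alpha,\quad \eta_\alpha\circ\phi=0,\quad \eta_\alpha(\xi_\beta)=\delta_{\alpha\beta},\quad \phi(\xi_\alpha)=0,$$ $$g(X,Y)=g(\phi X,\phi Y)+\sum_\alpha\eta_\alpha(X)\eta_\alpha(Y),\quad \eta_\alpha(X)=g(X,\xi_\alpha),\quad d\eta_\alpha(X,Y)=g(X,\phi Y)$$ (where $d\eta(X,Y)=\tfrac12\{X\eta(Y)-Y\eta(X)-\eta([X,Y])\}$), the Nijenhuis tensor of $\phi$, $N_\phi(X,Y)=\phi^2[X,Y]+[\phi X,\phi Y]-\phi[\phi X,Y]-\phi[X,\phi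 Y]$, equals $-2\sum_\alpha d\eta_\alpha\otimes\xi_\alpha$, and for every nonzero tangent vector $X$ orthogonal to all $\xi_\alpha$ the plane spanned by $X$ and $\phi X$ has sectional curvature $c$. Write $R(X,Y)Z=\nabla_X\nabla_YZ-\nabla_Y\nabla_XZ-\nabla_{[X,Y]}Z$. Let $J\subseteq\mathbb R$ be an open interval and let $\gamma:J\to M$ be a smooth unit-speed Frenet curve of osculating order $r\ge 2$, with $T=\gamma'$. This means that there are smooth $g$-orthonormal vector fields $V_1=T,V_2,\dots,V_r$ along $\gamma$ and smooth positive functions $k_1,\dots,k_{r-1}$ on $J$ with $\nabla_TV_j=-k_{j-1}V_{j-1}+k_jV_{j+1}$ for $1\le j\le r$, where by convention $k_0=0$, $V_0=0$, $k_j=0$ for $j\ge r$ and $V_j=0$ for $j>r$. Assume that $\gamma$ is $\theta_\alpha$-slant: there are constants $\theta_\alpha$ with $\eta_\alpha(T)=\cos\theta_\alpha$ for all $\alpha$. Put $a=\sum_\alpha\cos^2\theta_\alpha$ and $b=\sum_\alpha\cos\theta_\alpha$. Let $f:J\to(0,\infty)$ be a smooth non-constant function. The curve $\gamma$ is called $f$-biharmonic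 if it is a critical point, with respect to smooth variations with compact support in $J$, of the $f$-bienergy $E_{2,f}(\gamma)=\frac12\int f\,|\nabla_{\gamma'}\gamma'|^2\,dt$; it is called biharmonic if this holds with $f$ replaced by the constant $1$, and proper $f$-biharmonic if it is $f$-biharmonic but not biharmonic. Put $$\tau_3=\nabla_T\nabla_T\nabla_TT-R(T,\nabla_TT)T+2\frac{f'}{f}\nabla_T\nabla_TT+\frac{f''}{f}\nabla_TT .$$ Then $\gamma$ is proper $f$-biharmonic if and only if the following five conditions hold everywhere on $J$: $$3\frac{k_1'}{k_1}+2\frac{f'}{f}=0,\tag{1}$$ $$k_1^2+k_2^2=\frac{k_1''}{k_1}+\frac{f''}{f}+2\frac{f'}{f}\frac{k_1'}{k_1}+b^2+\frac{c+3s}{4}(1-a)+3\,\frac{c-s}{4}\,g(\phi T,V_2)^2,\tag{2}$$ $$k_2'+2k_2\frac{k_1'}{k_1}+2k_2\frac{f'}{f}+3\,\frac{c-s}{4}\,g(\phi T,V_2)\,g(\phi T,V_3)=0,\tag{3}$$ $$k_2k_3+3\,\frac{c-s}{4}\,g(\phi T,V_2)\,g(\phi T,V_4)=0,\tag{4}$$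 $$g(\tau_3,\phi T)=0.\tag{5}$$ -/

import Mathlib

open Bundle Manifold Set
open scoped ContDiff Topology

noncomputable section

namespace SGeom

section Connection

variable {E : Type*} [NormedAddCommGroup E] [NormedSpace ℝ E] [FiniteDimensional ℝ E]
  {M : Type*} [TopologicalSpace M] [ChartedSpace E M] [IsManifold 𝓘(ℝ, E) ∞ M]

/-- Affine connections on `M`, i.e. covariant derivatives on the tangent bundle.
`cov Y x v` is `∇_v Y` at the point `x`. -/
abbrev AffineConnection (E : Type*) [NormedAddCommGroup E] [NormedSpace ℝ E]
    (M : Type*) [TopologicalSpace M] [ChartedSpace E M] [IsManifold 𝓘(ℝ, E) ∞ M] : Type _ :=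
  CovariantDerivative 𝓘(ℝ, E) E (fun x : M ↦ TangentSpace 𝓘(ℝ, E) x)

/-- The local vector field near `x` with value `v` at `x` whose components are constant in the
coordinate frame of the preferred chart at `x`. -/
def constField {x : M} (v : TangentSpace 𝓘(ℝ, E) x) (y : M) : TangentSpace 𝓘(ℝ, E) y :=
  (trivializationAt E (fun z : M ↦ TangentSpace 𝓘(ℝ, E) z) x).symm y
    (trivializationAt E (fun z : M ↦ TangentSpace 𝓘(ℝ, E) z) x ⟨x, v⟩).2

/-- The curvature tensor `R(u, v)w = ∇_u ∇_v w - ∇_v ∇_u w - ∇_{[u, v]} w` at the point `x`; the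
three tangent vectors are extended to local vector fields (the value does not depend on how). -/
def curvature (cov : AffineConnection E M) (x : M) (u v w : TangentSpace 𝓘(ℝ, E) x) :
    TangentSpace 𝓘(ℝ, E) x :=
  cov (fun y ↦ cov (constField w) y (constField v y)) x u
    - cov (fun y ↦ cov (constField w) y (constField u y)) x v
    - cov (constField w) x (VectorField.mlieBracket 𝓘(ℝ, E) (constField u) (constField v) x)

/-- The velocity `γ'(t)` of a curve. -/
def velocity (γ : ℝ → M) (t : ℝ) : TangentSpace 𝓘(ℝ, E) (γ t) :=
  mfderiv 𝓘(ℝ, ℝ) 𝓘(ℝ, E) γ t (1 : ℝ)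

/-- A vector field along `γ : J → M` is smooth. -/
def SmoothAlong (γ : ℝ → M) (J : Set ℝ) (V : (t : ℝ) → TangentSpace 𝓘(ℝ, E) (γ t)) : Prop :=
  ContMDiffOn 𝓘(ℝ, ℝ) (𝓘(ℝ, E).tangent) ∞
    (fun t ↦ (⟨γ t, V t⟩ : TangentBundle 𝓘(ℝ, E) M)) J

/-- The covariant derivative `∇_{γ'} V` at time `t` of a vector field `V` along the curve `γ`.
In the coordinate frame `(e_i)` of the chart at `γ t`, write `V = ∑ V^i e_i`; then
`∇_{γ'} V = ∑ (V^i)' e_i + ∑ V^i ∇_{γ'} e_i`. The second sum is the covariant derivative of the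
vector field whose components are constant, equal to those of `V t`. -/
def covAlong (cov : AffineConnection E M) (γ : ℝ → M)
    (V : (t : ℝ) → TangentSpace 𝓘(ℝ, E) (γ t)) (t : ℝ) : TangentSpace 𝓘(ℝ, E) (γ t) :=
  (trivializationAt E (fun z : M ↦ TangentSpace 𝓘(ℝ, E) z) (γ t)).symm (γ t)
      (deriv (fun τ ↦
        (trivializationAt E (fun z : M ↦ TangentSpace 𝓘(ℝ, E) z) (γ t) ⟨γ τ, V τ⟩).2) t)
    + cov (constField (V t)) (γ t) (velocity γ t)

/-- The tension field `∇_{γ'} γ'` of a curve, regarded as a map from an interval of the real line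
with its standard metric. -/
def tension (cov : AffineConnection E M) (γ : ℝ → M) (t : ℝ) : TangentSpace 𝓘(ℝ, E) (γ t) :=
  covAlong cov γ (velocity γ) t

/-- `τ₃ = ∇_T ∇_T ∇_T T - R(T, ∇_T T)T + 2 (f'/f) ∇_T ∇_T T + (f''/f) ∇_T T`, with `T = γ'`. -/
def tau3 (cov : AffineConnection E M) (f : ℝ → ℝ) (γ : ℝ → M) (t : ℝ) :
    TangentSpace 𝓘(ℝ, E) (γ t) :=
  covAlong cov γ (covAlong cov γ (tension cov γ)) t
    - curvature cov (γ t) (velocity γ t) (tension cov γ t) (velocity γ t)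
    + (2 * (deriv f t / f t)) • covAlong cov γ (tension cov γ) t
    + (deriv (deriv f) t / f t) • tension cov γ t

end Connection

section Riemannian

variable {E : Type*} [NormedAddCommGroup E] [NormedSpace ℝ E] [FiniteDimensional ℝ E]
  {M : Type*} [TopologicalSpace M] [ChartedSpace E M] [IsManifold 𝓘(ℝ, E) ∞ M]
  [RiemannianBundle (fun x : M ↦ TangentSpace 𝓘(ℝ, E) x)]
  [IsContMDiffRiemannianBundle 𝓘(ℝ, E) ∞ E (fun x : M ↦ TangentSpace 𝓘(ℝ, E) x)]

/-- The connection is the Levi-Civita connection of the metric: it maps smooth fields to smooth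
fields, is torsion-free, and satisfies `X g(Y, Z) = g(∇_X Y, Z) + g(Y, ∇_X Z)`. -/
structure IsLeviCivita (cov : AffineConnection E M) : Prop where
  smooth : CovariantDerivative.ContMDiffCovariantDerivative cov ∞
  torsion_free : cov.torsion = 0
  metric : ∀ (x : M) (Y Z : (y : M) → TangentSpace 𝓘(ℝ, E) y) (v : TangentSpace 𝓘(ℝ, E) x),
    MDifferentiableAt 𝓘(ℝ, E) (𝓘(ℝ, E).tangent)
      (fun y ↦ (⟨y, Y y⟩ : TangentBundle 𝓘(ℝ, E) M)) x →
    MDifferentiableAt 𝓘(ℝ, E) (𝓘(ℝ, E).tangent)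
      (fun y ↦ (⟨y, Z y⟩ : TangentBundle 𝓘(ℝ, E) M)) x →
    mvfderiv 𝓘(ℝ, E) (fun y ↦ (inner ℝ (Y y) (Z y) : ℝ)) x v
      = inner ℝ (cov Y x v) (Z x) + inner ℝ (Y x) (cov Z x v)

/-- The sectional curvature of the plane spanned by `u` and `v`. -/
def sectionalCurvature (cov : AffineConnection E M) (x : M) (u v : TangentSpace 𝓘(ℝ, E) x) : ℝ :=
  inner ℝ (curvature cov x u v v) u / (inner ℝ u u * inner ℝ v v - inner ℝ u v ^ 2)

/-- `γ` is `f`-biharmonic on the open interval `J`: it is a critical point of the `f`-bienergy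
`E_{2,f}(γ) = (1/2) ∫ f |τ(γ)|² dt` with respect to all smooth variations `Γ s` of `γ = Γ 0` with
compact support (contained in `[p, q] ⊆ J`); `τ` is the tension field. -/
def IsFBiharmonic (cov : AffineConnection E M) (f : ℝ → ℝ) (γ : ℝ → M) (J : Set ℝ) : Prop :=
  ∀ (p q ε : ℝ) (Γ : ℝ → ℝ → M), p ≤ q → Icc p q ⊆ J → 0 < ε →
    ContMDiffOn 𝓘(ℝ, ℝ × ℝ) 𝓘(ℝ, E) ∞ (fun z : ℝ × ℝ ↦ Γ z.1 z.2) (Ioo (-ε) ε ×ˢ J) →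
    (∀ t ∈ J, Γ 0 t = γ t) →
    (∀ s ∈ Ioo (-ε) ε, ∀ t ∈ J \ Icc p q, Γ s t = γ t) →
    HasDerivAt (fun s ↦ (1 / 2 : ℝ) *
      ∫ t in p..q, f t * inner ℝ (tension cov (Γ s) t) (tension cov (Γ s) t)) 0 0

/-- Biharmonic curves are the critical points of the bienergy `(1/2) ∫ |τ(γ)|² dt`. -/
def IsBiharmonic (cov : AffineConnection E M) (γ : ℝ → M) (J : Set ℝ) : Prop :=
  IsFBiharmonic cov (fun _ ↦ 1) γ J

/-- Proper `f`-biharmonic: `f`-biharmonic but not biharmonic. -/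
def IsProperFBiharmonic (cov : AffineConnection E M) (f : ℝ → ℝ) (γ : ℝ → M) (J : Set ℝ) : Prop :=
  IsFBiharmonic cov f γ J ∧ ¬ IsBiharmonic cov γ J

/-- `γ : J → M` is a unit-speed Frenet curve of osculating order `r`, with Frenet frame
`V 1 = γ', …, V r` and positive curvatures `k 1, …, k (r - 1)`. By convention `k 0 = 0` and
`V 0 = 0`, and `k j = 0` for `j ≥ r` and `V j = 0` for `j > r`, so that all Frenet equations take
the form `∇_T V_j = - k_{j-1} V_{j-1} + k_j V_{j+1}`, `1 ≤ j ≤ r`. -/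
structure IsFrenetCurve (cov : AffineConnection E M) (γ : ℝ → M) (J : Set ℝ) (r : ℕ)
    (V : ℕ → (t : ℝ) → TangentSpace 𝓘(ℝ, E) (γ t)) (k : ℕ → ℝ → ℝ) : Prop where
  one_le : 1 ≤ r
  smooth : ContMDiffOn 𝓘(ℝ, ℝ) 𝓘(ℝ, E) ∞ γ J
  smooth_frame : ∀ j, 1 ≤ j → j ≤ r → SmoothAlong γ J (V j)
  smooth_curvature : ∀ j, 1 ≤ j → j < r → ContDiffOn ℝ ∞ (k j) J
  orthonormal : ∀ i j, 1 ≤ i → i ≤ r → 1 ≤ j → j ≤ r → ∀ t ∈ J,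
    inner ℝ (V i t) (V j t) = if i = j then (1 : ℝ) else 0
  curvature_pos : ∀ j, 1 ≤ j → j < r → ∀ t ∈ J, 0 < k j t
  tangent : ∀ t ∈ J, V 1 t = velocity γ t
  frenet : ∀ j, 1 ≤ j → j ≤ r → ∀ t ∈ J,
    covAlong cov γ (V j) t = -(k (j - 1) t • V (j - 1) t) + k j t • V (j + 1) t
  curvature_zero : ∀ t ∈ J, k 0 t = 0
  frame_zero : ∀ t ∈ J, V 0 t = 0
  curvature_of_le : ∀ j, r ≤ j → ∀ t ∈ J, k j t = 0
  frame_of_lt : ∀ j, r < j → ∀ t ∈ J, V j t = 0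

/-- The exterior derivative of a 1-form on two vector fields, with the convention
`dη(X, Y) = (1/2) (X η(Y) - Y η(X) - η([X, Y]))`. -/
def extDerivForm (η : (x : M) → TangentSpace 𝓘(ℝ, E) x →L[ℝ] ℝ)
    (X Y : (x : M) → TangentSpace 𝓘(ℝ, E) x) (x : M) : ℝ :=
  (1 / 2 : ℝ) * (mvfderiv 𝓘(ℝ, E) (fun y ↦ η y (Y y)) x (X x)
    - mvfderiv 𝓘(ℝ, E) (fun y ↦ η y (X y)) x (Y x)
    - η x (VectorField.mlieBracket 𝓘(ℝ, E) X Y x))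

/-- The Nijenhuis tensor `φ²[X, Y] + [φX, φY] - φ[φX, Y] - φ[X, φY]`. -/
def nijenhuis (φ : (x : M) → TangentSpace 𝓘(ℝ, E) x →L[ℝ] TangentSpace 𝓘(ℝ, E) x)
    (X Y : (x : M) → TangentSpace 𝓘(ℝ, E) x) (x : M) : TangentSpace 𝓘(ℝ, E) x :=
  φ x (φ x (VectorField.mlieBracket 𝓘(ℝ, E) X Y x))
    + VectorField.mlieBracket 𝓘(ℝ, E) (fun y ↦ φ y (X y)) (fun y ↦ φ y (Y y)) x
    - φ x (VectorField.mlieBracket 𝓘(ℝ, E) (fun y ↦ φ y (X y)) Y x)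
    - φ x (VectorField.mlieBracket 𝓘(ℝ, E) X (fun y ↦ φ y (Y y)) x)

variable (E M) in
/-- An `S`-structure `(φ, ξ_α, η_α, g)`, `α = 1, …, s`, on a Riemannian manifold `(M, g)` of
dimension `2m + s`: a framed metric structure whose Nijenhuis tensor is
`- 2 ∑_α dη_α ⊗ ξ_α`. -/
structure SStructure (m s : ℕ) where
  φ : (x : M) → TangentSpace 𝓘(ℝ, E) x →L[ℝ] TangentSpace 𝓘(ℝ, E) x
  ξ : Fin s → (x : M) → TangentSpace 𝓘(ℝ, E) x
  η : Fin s → (x : M) → TangentSpace 𝓘(ℝ, E) x →L[ℝ] ℝ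
  dim_eq : Module.finrank ℝ E = 2 * m + s
  smooth_φ : ContMDiff 𝓘(ℝ, E) (𝓘(ℝ, E).prod 𝓘(ℝ, E →L[ℝ] E)) ∞
    (fun x ↦ TotalSpace.mk' (E →L[ℝ] E)
      (E := fun y : M ↦ TangentSpace 𝓘(ℝ, E) y →L[ℝ] TangentSpace 𝓘(ℝ, E) y) x (φ x))
  smooth_ξ : ∀ α, ContMDiff 𝓘(ℝ, E) (𝓘(ℝ, E).tangent) ∞
    (fun x ↦ (⟨x, ξ α x⟩ : TangentBundle 𝓘(ℝ, E) M))
  rank_φ : ∀ x, Module.finrank ℝ (LinearMap.range (φ x : TangentSpace 𝓘(ℝ, E) x →ₗ[ℝ]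
    TangentSpace 𝓘(ℝ, E) x)) = 2 * m
  φ_sq : ∀ x (v : TangentSpace 𝓘(ℝ, E) x), φ x (φ x v) = -v + ∑ α, η α x v • ξ α x
  η_φ : ∀ α x (v : TangentSpace 𝓘(ℝ, E) x), η α x (φ x v) = 0
  η_ξ : ∀ α β x, η α x (ξ β x) = if α = β then (1 : ℝ) else 0
  φ_ξ : ∀ α x, φ x (ξ α x) = 0
  metric_eq : ∀ x (v w : TangentSpace 𝓘(ℝ, E) x),
    inner ℝ v w = inner ℝ (φ x v) (φ x w) + ∑ α, η α x v * η α x w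
  η_eq : ∀ α x (v : TangentSpace 𝓘(ℝ, E) x), η α x v = inner ℝ v (ξ α x)
  d_η : ∀ α x (X Y : (y : M) → TangentSpace 𝓘(ℝ, E) y),
    ContMDiffAt 𝓘(ℝ, E) (𝓘(ℝ, E).tangent) ∞
      (fun y ↦ (⟨y, X y⟩ : TangentBundle 𝓘(ℝ, E) M)) x →
    ContMDiffAt 𝓘(ℝ, E) (𝓘(ℝ, E).tangent) ∞
      (fun y ↦ (⟨y, Y y⟩ : TangentBundle 𝓘(ℝ, E) M)) x →
    extDerivForm (η α) X Y x = inner ℝ (X x) (φ x (Y x))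
  normal : ∀ x (X Y : (y : M) → TangentSpace 𝓘(ℝ, E) y),
    ContMDiffAt 𝓘(ℝ, E) (𝓘(ℝ, E).tangent) ∞
      (fun y ↦ (⟨y, X y⟩ : TangentBundle 𝓘(ℝ, E) M)) x →
    ContMDiffAt 𝓘(ℝ, E) (𝓘(ℝ, E).tangent) ∞
      (fun y ↦ (⟨y, Y y⟩ : TangentBundle 𝓘(ℝ, E) M)) x →
    nijenhuis φ X Y x = -((2 : ℝ) • ∑ α, extDerivForm (η α) X Y x • ξ α x)

/-- The `S`-manifold is an `S`-space form `M(c)`: every `φ`-section, i.e. every plane spanned by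
`v` and `φ v` with `v ≠ 0` orthogonal to all `ξ_α`, has sectional curvature `c`. -/
def SStructure.IsSpaceForm {m s : ℕ} (S : SStructure E M m s) (cov : AffineConnection E M)
    (c : ℝ) : Prop :=
  ∀ (x : M) (v : TangentSpace 𝓘(ℝ, E) x), v ≠ 0 → (∀ α, inner ℝ v (S.ξ α x) = (0 : ℝ)) →
    sectionalCurvature cov x v (S.φ x v) = c

/-- `γ` is a `θ_α`-slant curve with contact angles `θ α`: `η_α(γ') = cos θ_α` for all `α`. -/
def SStructure.IsSlant {m s : ℕ} (S : SStructure E M m s) (γ : ℝ → M) (J : Set ℝ)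
    (θ : Fin s → ℝ) : Prop :=
  ∀ α, ∀ t ∈ J, S.η α (γ t) (velocity γ t) = Real.cos (θ α)

end Riemannian

end SGeom

end

noncomputable section

set_option synthInstance.maxHeartbeats 400000
set_option linter.unusedSectionVars false

/-! Variational part. For a variation with field `W`, the derivative of the `f`-bienergy is, after
two integrations by parts, `∫ ⟨W, f τ₃⟩` (`hasDerivAt_bienergy`). This rests on the commutation of
covariant derivatives along a two-parameter map, which produces the curvature term, and on the
identity `f τ₃ = ∇∇(f τ) - R(T, f τ)T` with `τ = ∇_T T` (`smul_tau3`). Hence `τ₃ = 0` is sufficient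
for `f`-biharmonicity, and a variation supported where `τ₃` does not vanish shows that it is
necessary (`isFBiharmonic_iff`).

Curvature part. The Frenet equations express `τ₃` through `V₁, …, V₄`, except for the term `k₁ R(T,
V₂)T`. The conditions on `dη_α` and on the Nijenhuis tensor force `∇ξ_α = -φ` and determine `∇φ`
(`connection_ξ`, `connection_φ`). One more derivative gives `R(u, v)ξ_α` and the failure of `R(u,
v)` to commute with `φ` on horizontal vectors, i.e. those orthogonal to all `ξ_α`. A model tensor
with the same failure and the same `φ`-sectional curvature is subtracted. What remains behaves on
horizontal vectors like a Kähler curvature tensor with zero holomorphic sectional curvature, so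
polarisation kills the components that are needed (`kaehler_tensor_eq_zero`,
`curvature_horizontal`).

Slant curves. Differentiating `η_α(T) = cos θ_α` and using `∇ξ_α = -φ` and `g(T, φT) = 0` gives `k₁
η_α(V₂) = 0`, so `V₂` is horizontal. Then `R(T, V₂)T` is a combination of `V₂` and `φT`, and `τ₃`
lies in the span of `V₁, …, V₄, φT`. It vanishes if and only if it is orthogonal to these five
vectors; after division by `k₁` or `-k₁²` where needed, these are the five conditions
(`IsFrenetCurve.tau3_eq_zero_iff`).

Properness is automatic. If the curve were also biharmonic, the tangential equation with constant
weight would give `k₁' = 0`, and then the one with weight `f` would give `f' = 0` on the interval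
`J`, although `f` is not constant.

All differential computations are done in charts with `covD`, the covariant derivative along a map.
Its parameter space is `E` for vector fields, `ℝ` for curves and `ℝ × ℝ` for variations. -/

namespace SGeom

/-! ### Covariant derivatives along maps and curvature identities in a coordinate domain. -/

section LocalCalculus

variable {E : Type*} [NormedAddCommGroup E] [NormedSpace ℝ E]
  {F : Type*} [NormedAddCommGroup F] [NormedSpace ℝ F]
  {F' : Type*} [NormedAddCommGroup F'] [NormedSpace ℝ F']

/-- The covariant derivative in the direction `d` of a vector field `X` along a map `x` into a
coordinate domain with Christoffel symbols `Γ`; here `Γ z w v` is `∇_v w` for constant `w`. -/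
def covD (Γ : E → E →L[ℝ] E →L[ℝ] E) (x X : F → E) (d q : F) : E :=
  fderiv ℝ X q d + Γ (x q) (X q) (fderiv ℝ x q d)

/-- The curvature `R(u, v)w` in terms of Christoffel symbols. -/
def curv (Γ : E → E →L[ℝ] E →L[ℝ] E) (z u v w : E) : E :=
  fderiv ℝ Γ z u w v - fderiv ℝ Γ z v w u + Γ z (Γ z w v) u - Γ z (Γ z w u) v

/-- Metric coefficients `g` and Christoffel symbols `Γ` of a Levi-Civita connection on an open
subset `Ω` of a vector space. -/
structure IsLocalLeviCivita (Ω : Set E) (g : E → E →L[ℝ] E →L[ℝ] ℝ)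
    (Γ : E → E →L[ℝ] E →L[ℝ] E) : Prop where
  isOpen : IsOpen Ω
  smooth_g : ∀ z ∈ Ω, ContDiffAt ℝ ∞ g z
  smooth_Γ : ∀ z ∈ Ω, ContDiffAt ℝ ∞ Γ z
  g_symm : ∀ z ∈ Ω, ∀ a b, g z a b = g z b a
  Γ_symm : ∀ z ∈ Ω, ∀ a b, Γ z a b = Γ z b a
  compat : ∀ z ∈ Ω, ∀ v a b, fderiv ℝ g z v a b = g z (Γ z a v) b + g z a (Γ z b v)

variable {Ω : Set E} {g : E → E →L[ℝ] E →L[ℝ] ℝ} {Γ : E → E →L[ℝ] E →L[ℝ] E}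
  {x X Y : F → E} {q : F}

theorem ContDiffAt.fderiv_apply_const (hX : ContDiffAt ℝ ∞ X q) (d : F) :
    ContDiffAt ℝ ∞ (fun q ↦ fderiv ℝ X q d) q :=
  (hX.fderiv_right (m := ∞) (by simp)).clm_apply contDiffAt_const

theorem ContDiffAt.covD (hΓ : ContDiffAt ℝ ∞ Γ (x q)) (hx : ContDiffAt ℝ ∞ x q)
    (hX : ContDiffAt ℝ ∞ X q) (d : F) : ContDiffAt ℝ ∞ (covD Γ x X d) q :=
  (ContDiffAt.fderiv_apply_const hX d).add
    (((hΓ.comp q hx).clm_apply hX).clm_apply (ContDiffAt.fderiv_apply_const hx d))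

theorem covD_add (hX : DifferentiableAt ℝ X q) (hY : DifferentiableAt ℝ Y q) (d : F) :
    covD Γ x (fun q ↦ X q + Y q) d q = covD Γ x X d q + covD Γ x Y d q := by
  simp only [covD, fderiv_fun_add hX hY, add_apply, map_add]
  abel

theorem covD_smul {f : F → ℝ} (hf : DifferentiableAt ℝ f q) (hX : DifferentiableAt ℝ X q)
    (d : F) :
    covD Γ x (fun q ↦ f q • X q) d q = fderiv ℝ f q d • X q + f q • covD Γ x X d q := by
  simp only [covD, fderiv_fun_smul hf hX, add_apply, map_smul,
    smul_apply, ContinuousLinearMap.smulRight_apply, smul_add]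
  abel

theorem covD_congr {x' X' : F → E} (hx : x =ᶠ[𝓝 q] x') (hX : X =ᶠ[𝓝 q] X') (d : F) :
    covD Γ x X d q = covD Γ x' X' d q := by
  simp only [covD, hx.fderiv_eq, hX.fderiv_eq, hx.self_of_nhds, hX.self_of_nhds]

theorem covD_comp {ι : F' → F} {q' : F'} (hι : DifferentiableAt ℝ ι q')
    (hx : DifferentiableAt ℝ x (ι q')) (hX : DifferentiableAt ℝ X (ι q')) (d : F') :
    covD Γ (x ∘ ι) (X ∘ ι) d q' = covD Γ x X (fderiv ℝ ι q' d) (ι q') := by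
  simp only [covD, fderiv_comp _ hx hι, fderiv_comp _ hX hι, ContinuousLinearMap.comp_apply,
    Function.comp]

theorem fderiv_fderiv_symm (hX : ContDiffAt ℝ ∞ X q) (d d' : F) :
    fderiv ℝ (fun q ↦ fderiv ℝ X q d') q d = fderiv ℝ (fun q ↦ fderiv ℝ X q d) q d' := by
  have h : DifferentiableAt ℝ (fderiv ℝ X) q :=
    (hX.fderiv_right (m := ∞) (by simp)).differentiableAt (by simp)
  rw [fderiv_clm_apply h (differentiableAt_const _), fderiv_clm_apply h (differentiableAt_const _)]
  simpa using (hX.isSymmSndFDerivAt (by simpa using WithTop.coe_le_coe.2 (le_top : (2 : ℕ∞) ≤ ⊤))).eq d d'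

/-- Torsion-freeness along a map: this is what exchanges the variation and time derivatives, `∇_s
∂_t = ∇_t ∂_s`. -/
theorem covD_fderiv_symm (hx : ContDiffAt ℝ ∞ x q)
    (hΓ : ∀ a b, Γ (x q) a b = Γ (x q) b a) (d d' : F) :
    covD Γ x (fun q ↦ fderiv ℝ x q d') d q = covD Γ x (fun q ↦ fderiv ℝ x q d) d' q := by
  rw [covD, covD, fderiv_fderiv_symm hx, hΓ]

/-- Ricci identity along a map: the second derivatives of `X` and of `x` are symmetric and cancel
under antisymmetrisation. With `x` the identity it yields the curvature identities below; with a
two-parameter `x` it yields the curvature term of the first variation. -/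
theorem covD_covD_sub (hΓ : ContDiffAt ℝ ∞ Γ (x q)) (hx : ContDiffAt ℝ ∞ x q)
    (hX : ContDiffAt ℝ ∞ X q) (d d' : F) :
    covD Γ x (covD Γ x X d') d q - covD Γ x (covD Γ x X d) d' q =
      curv Γ (x q) (fderiv ℝ x q d) (fderiv ℝ x q d') (X q) := by
  have key : ∀ d d' : F, fderiv ℝ (covD Γ x X d') q d
      = fderiv ℝ (fun q ↦ fderiv ℝ X q d') q d
        + (fderiv ℝ Γ (x q) (fderiv ℝ x q d) (X q) (fderiv ℝ x q d')
          + Γ (x q) (fderiv ℝ X q d) (fderiv ℝ x q d')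
          + Γ (x q) (X q) (fderiv ℝ (fun q ↦ fderiv ℝ x q d') q d)) := by
    intro d d'
    have h1 := (ContDiffAt.fderiv_apply_const hX d').differentiableAt (by simp)
    have h2 := (ContDiffAt.fderiv_apply_const hx d').differentiableAt (by simp)
    have h3 := (hΓ.comp q hx).differentiableAt (by simp)
    have h4 := hX.differentiableAt (by simp)
    have h5 := hx.differentiableAt (by simp)
    have h6 := hΓ.differentiableAt (by simp)
    have e1 : HasFDerivAt (fun q ↦ Γ (x q)) ((fderiv ℝ Γ (x q)).comp (fderiv ℝ x q)) q :=
      h6.hasFDerivAt.comp q h5.hasFDerivAt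
    have e2 := (e1.clm_apply h4.hasFDerivAt).clm_apply h2.hasFDerivAt
    have e3 := (h1.hasFDerivAt.add e2).fderiv
    change fderiv ℝ (fun q ↦ fderiv ℝ X q d' + Γ (x q) (X q) (fderiv ℝ x q d')) q d = _
    erw [e3]
    simp
    abel
  have hd : ∀ d d' : F, covD Γ x (covD Γ x X d') d q = fderiv ℝ (covD Γ x X d') q d
      + Γ (x q) (fderiv ℝ X q d' + Γ (x q) (X q) (fderiv ℝ x q d')) (fderiv ℝ x q d) :=
    fun d d' ↦ rfl
  rw [hd, hd, key, key, fderiv_fderiv_symm hX d d', fderiv_fderiv_symm hx d d', curv]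
  simp only [map_add, add_apply]
  abel

namespace IsLocalLeviCivita

theorem fderiv_g (h : IsLocalLeviCivita Ω g Γ) (hq : x q ∈ Ω) (hx : DifferentiableAt ℝ x q)
    (hX : DifferentiableAt ℝ X q) (hY : DifferentiableAt ℝ Y q) (d : F) :
    fderiv ℝ (fun q ↦ g (x q) (X q) (Y q)) q d =
      g (x q) (covD Γ x X d q) (Y q) + g (x q) (X q) (covD Γ x Y d q) := by
  have hg := (h.smooth_g _ hq).differentiableAt (by simp)
  have e1 : HasFDerivAt (fun q ↦ g (x q)) ((fderiv ℝ g (x q)).comp (fderiv ℝ x q)) q :=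
    hg.hasFDerivAt.comp q hx.hasFDerivAt
  have e2 := ((e1.clm_apply hX.hasFDerivAt).clm_apply hY.hasFDerivAt).fderiv
  erw [e2]
  simp [covD, h.compat _ hq]
  ring

theorem differentiableAt_g (h : IsLocalLeviCivita Ω g Γ) (hq : x q ∈ Ω)
    (hx : DifferentiableAt ℝ x q) (hX : DifferentiableAt ℝ X q) (hY : DifferentiableAt ℝ Y q) :
    DifferentiableAt ℝ (fun q ↦ g (x q) (X q) (Y q)) q :=
  ((((h.smooth_g _ hq).differentiableAt (by simp)).comp q hx).clm_apply hX).clm_apply hY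

theorem contDiffAt_g (h : IsLocalLeviCivita Ω g Γ) (hq : x q ∈ Ω)
    (hx : ContDiffAt ℝ ∞ x q) (hX : ContDiffAt ℝ ∞ X q) (hY : ContDiffAt ℝ ∞ Y q) :
    ContDiffAt ℝ ∞ (fun q ↦ g (x q) (X q) (Y q)) q :=
  (((h.smooth_g _ hq).comp q hx).clm_apply hX).clm_apply hY

theorem curv_swap (z u v w : E) : curv Γ z u v w = - curv Γ z v u w := by
  simp only [curv]; abel

/-- The symmetry of `Γ` holds on an open set, hence passes to its derivative; all terms then cancel
in pairs. -/
theorem curv_cyclic (h : IsLocalLeviCivita Ω g Γ) {z : E} (hz : z ∈ Ω) (u v w : E) :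
    curv Γ z u v w + curv Γ z v w u + curv Γ z w u v = 0 := by
  have hs : ∀ d a b : E, fderiv ℝ Γ z d a b = fderiv ℝ Γ z d b a := by
    intro d a b
    have hΓ := (h.smooth_Γ z hz).differentiableAt (by simp)
    have e : ∀ a b : E, fderiv ℝ (fun y ↦ Γ y a b) z d = fderiv ℝ Γ z d a b := by
      intro a b
      have := ((hΓ.hasFDerivAt.clm_apply (hasFDerivAt_const a z)).clm_apply
        (hasFDerivAt_const b z)).fderiv
      rw [this]; simp
    rw [← e, ← e]
    have : (fun y ↦ Γ y a b) =ᶠ[𝓝 z] fun y ↦ Γ y b a := by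
      filter_upwards [h.isOpen.mem_nhds hz] with y hy using h.Γ_symm y hy a b
    rw [this.fderiv_eq]
  simp only [curv]
  rw [hs u w v, hs v w u, hs v u w, hs w u v, hs w v u, hs u v w,
    h.Γ_symm z hz w v, h.Γ_symm z hz w u, h.Γ_symm z hz u v]
  abel

/-- For constant `a`, `b`, the second derivative of `g(a, b)` is symmetric in its two directions.
Computed by metric compatibility, its mixed terms are symmetric as well, so what is left is the
curvature acting on either argument. -/
theorem curv_skew (h : IsLocalLeviCivita Ω g Γ) {z : E} (hz : z ∈ Ω) (u v a b : E) :
    g z (curv Γ z u v a) b + g z a (curv Γ z u v b) = 0 := by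
  have hid : ∀ y : E, ContDiffAt ℝ ∞ (fun y : E ↦ y) y := fun y ↦ contDiffAt_id
  have hc : ∀ (a y : E), ContDiffAt ℝ ∞ (fun _ : E ↦ a) y := fun a y ↦ contDiffAt_const
  have hcov : ∀ (a d : E), ∀ y ∈ Ω, ContDiffAt ℝ ∞ (covD Γ (fun y : E ↦ y) (fun _ ↦ a) d) y :=
    fun a d y hy ↦ ContDiffAt.covD (h.smooth_Γ y hy) (hid y) (hc a y) d
  have key : ∀ d d' : E, fderiv ℝ (fun y ↦ fderiv ℝ (fun y ↦ g y a b) y d') z d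
      = g z (covD Γ (fun y : E ↦ y) (covD Γ (fun y : E ↦ y) (fun _ ↦ a) d') d z) b
        + g z (covD Γ (fun y : E ↦ y) (fun _ ↦ a) d' z) (covD Γ (fun y : E ↦ y) (fun _ ↦ b) d z)
        + (g z (covD Γ (fun y : E ↦ y) (fun _ ↦ a) d z) (covD Γ (fun y : E ↦ y) (fun _ ↦ b) d' z)
        + g z a (covD Γ (fun y : E ↦ y) (covD Γ (fun y : E ↦ y) (fun _ ↦ b) d') d z)) := by
    intro d d'
    have e : (fun y ↦ fderiv ℝ (fun y ↦ g y a b) y d') =ᶠ[𝓝 z] fun y ↦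
        g y (covD Γ (fun y : E ↦ y) (fun _ ↦ a) d' y) b
          + g y a (covD Γ (fun y : E ↦ y) (fun _ ↦ b) d' y) := by
      filter_upwards [h.isOpen.mem_nhds hz] with y hy
      exact h.fderiv_g (x := fun y : E ↦ y) hy differentiableAt_id
        (differentiableAt_const a) (differentiableAt_const b) d'
    have d1 := (hcov a d' z hz).differentiableAt (by simp)
    have d2 := (hcov b d' z hz).differentiableAt (by simp)
    rw [e.fderiv_eq, fderiv_fun_add
      (h.differentiableAt_g (x := fun y : E ↦ y) hz differentiableAt_id d1
        (differentiableAt_const b))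
      (h.differentiableAt_g (x := fun y : E ↦ y) hz differentiableAt_id
        (differentiableAt_const a) d2), add_apply,
      h.fderiv_g (x := fun y : E ↦ y) hz differentiableAt_id d1 (differentiableAt_const b),
      h.fderiv_g (x := fun y : E ↦ y) hz differentiableAt_id (differentiableAt_const a) d2]
  have hg : ContDiffAt ℝ ∞ (fun y ↦ g y a b) z :=
    h.contDiffAt_g (x := fun y : E ↦ y) hz (hid z) (hc a z) (hc b z)
  have hs := fderiv_fderiv_symm hg u v
  rw [key, key] at hs
  have ca := covD_covD_sub (x := fun y : E ↦ y) (h.smooth_Γ z hz) (hid z) (hc a z) u v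
  have cb := covD_covD_sub (x := fun y : E ↦ y) (h.smooth_Γ z hz) (hid z) (hc b z) u v
  simp only [fderiv_fun_id, ContinuousLinearMap.id_apply] at ca cb
  rw [← ca, ← cb, map_sub, map_sub, sub_apply]
  linarith

theorem curv_pair_symm (h : IsLocalLeviCivita Ω g Γ) {z : E} (hz : z ∈ Ω) (u v a b : E) :
    g z (curv Γ z u v a) b = g z (curv Γ z a b u) v := by
  have sw : ∀ u v a b : E, g z (curv Γ z u v a) b = - g z (curv Γ z v u a) b := by
    intro u v a b; rw [curv_swap]; simp
  have sk : ∀ u v a b : E, g z (curv Γ z u v a) b = - g z (curv Γ z u v b) a := by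
    intro u v a b
    have := h.curv_skew hz u v a b
    rw [h.g_symm z hz a] at this; linarith
  have cy : ∀ u v a b : E, g z (curv Γ z u v a) b + g z (curv Γ z v a u) b
      + g z (curv Γ z a u v) b = 0 := by
    intro u v a b
    have := congrArg (fun e ↦ g z e b) (h.curv_cyclic hz u v a)
    simpa using this
  -- The classical combination of the four cyclic identities; the other instances only identify
  -- terms that agree up to the two skew symmetries.
  linarith [cy u v a b, cy v a b u, cy a b u v, cy b u v a, sk v a u b, sk a u v b, sk u v a b,
    sk a b v u, sk v b a u, sk b u a v, sk u a b v, sk b u v a, sw u v a b, sw v a u b, sw a u v b,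
    sw a b u v, sw b v a u, sw u b v a, sk v b u a, sk u v b a, sk a b u v, sk u b v a, sw v b u a,
    sk b v a u, sk u a v b, sw b v u a, sw u a v b, sw a u b v, sw v a b u, sk v a b u, sk a u b v,
    sw b u v a, sw b u a v, sw u b a v, sk u b a v]

end IsLocalLeviCivita

end LocalCalculus

/-! ### Pointwise algebra: the connection of an `S`-structure and Kähler polarisation. -/

section Algebra

variable {E : Type*} [NormedAddCommGroup E] [NormedSpace ℝ E] {s : ℕ}

/-- A framed metric structure on a vector space: `B` is the metric. -/
structure IsFramedMetric (B : E →L[ℝ] E →L[ℝ] ℝ) (φ : E →L[ℝ] E) (ξ : Fin s → E) : Prop where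
  symm : ∀ a b, B a b = B b a
  pos : ∀ a, a ≠ 0 → 0 < B a a
  φ_sq : ∀ v, φ (φ v) = -v + ∑ α, B v (ξ α) • ξ α
  η_φ : ∀ α v, B (φ v) (ξ α) = 0
  φ_ξ : ∀ α, φ (ξ α) = 0
  η_ξ : ∀ α β, B (ξ β) (ξ α) = if α = β then (1 : ℝ) else 0
  metric : ∀ v w, B v w = B (φ v) (φ w) + ∑ α, B v (ξ α) * B w (ξ α)

namespace IsFramedMetric

variable {B : E →L[ℝ] E →L[ℝ] ℝ} {φ : E →L[ℝ] E} {ξ : Fin s → E}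

theorem eq_of_forall (h : IsFramedMetric B φ ξ) {a a' : E} (H : ∀ b, B a b = B a' b) : a = a' := by
  by_contra hne
  have := h.pos (a - a') (sub_ne_zero.2 hne)
  have e : B (a - a') (a - a') = 0 := by
    rw [map_sub B, sub_apply, H, sub_self]
  exact (e ▸ this).false

theorem skew (h : IsFramedMetric B φ ξ) (v w : E) : B (φ v) w = - B v (φ w) := by
  rw [h.metric (φ v) w, h.φ_sq]
  simp [h.η_φ, h.symm (ξ _) (φ w)]

theorem φ_φ_φ (h : IsFramedMetric B φ ξ) (v : E) : φ (φ (φ v)) = - φ v := by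
  rw [h.φ_sq]; simp [h.η_φ]

theorem self_φ (h : IsFramedMetric B φ ξ) (v : E) : B v (φ v) = 0 := by
  have := h.skew v v
  rw [h.symm] at this; linarith

theorem φ_sq_right (h : IsFramedMetric B φ ξ) (v w : E) : B w (φ (φ v)) = - B (φ w) (φ v) := by
  have := h.skew w (φ v); linarith

variable {A : Fin s → E →L[ℝ] E} {P : E →ₗ[ℝ] E →ₗ[ℝ] E}

/-- Here `A α u` stands for `∇_u ξ_α` and `P u v` for `(∇_u φ)v`. The hypotheses express `dη_α =
g(·, φ·)`, normality, and the derivatives of `φ ξ_α = 0` and of `g(ξ_α, ξ_β) = δ_αβ`. The vector `A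
α (ξ β)` is shown to have neither a characteristic nor a horizontal component. -/
theorem connection_ξ_ξ (h : IsFramedMetric B φ ξ)
    (hη : ∀ α u v, B v (A α u) - B u (A α v) = 2 * B u (φ v))
    (hN : ∀ u v, P (φ u) v - P (φ v) u + φ (P v u) - φ (P u v)
      = -((2 : ℝ) • ∑ α, B u (φ v) • ξ α))
    (hφξ : ∀ α u, P u (ξ α) + φ (A α u) = 0)
    (hδ : ∀ α β u, B (A α u) (ξ β) + B (ξ α) (A β u) = 0) (α β : Fin s) :
    A α (ξ β) = 0 := by
  have h1 : ∀ α β u, B (ξ β) (A α u) = B u (A α (ξ β)) := by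
    intro α β u
    have := hη α u (ξ β)
    rw [h.φ_ξ] at this; simp at this; linarith
  have h2 : ∀ α β, A α (ξ β) = - A β (ξ α) := by
    intro α β
    refine h.eq_of_forall fun u ↦ ?_
    rw [h.symm, ← h1, h.symm, map_neg, neg_apply, h.symm (A β (ξ α)), ← h1]
    linarith [hδ α β u]
  -- An array antisymmetric in its first two indices and symmetric in its last two vanishes.
  have h3 : ∀ α β γ, B (A α (ξ β)) (ξ γ) = 0 := by
    have anti : ∀ α β γ, B (A α (ξ β)) (ξ γ) = - B (A β (ξ α)) (ξ γ) := by
      intro α β γ; rw [h2 α β]; simp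
    have sy : ∀ α β γ, B (A α (ξ β)) (ξ γ) = B (A α (ξ γ)) (ξ β) := by
      intro α β γ; rw [h.symm, h1, h.symm]
    intro α β γ
    linarith [anti α β γ, anti β γ α, anti γ α β, sy α β γ, sy β γ α, sy γ α β]
  -- By `h2`, normality evaluated on `ξ_α`, `ξ_β` reads `-2 φ²(A α (ξ β)) = 0`.
  have h4 : φ (φ (A α (ξ β))) = 0 := by
    have := congrArg (fun e ↦ e) (hN (ξ α) (ξ β))
    simp only [h.φ_ξ, map_zero, LinearMap.zero_apply, zero_smul, Finset.sum_const_zero, smul_zero,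
      neg_zero, sub_zero, zero_add] at this
    have e1 : P (ξ β) (ξ α) = - φ (A α (ξ β)) := eq_neg_of_add_eq_zero_left (hφξ α (ξ β))
    have e2 : P (ξ α) (ξ β) = - φ (A β (ξ α)) := eq_neg_of_add_eq_zero_left (hφξ β (ξ α))
    rw [e1, e2, h2 β α] at this
    simp only [map_neg, neg_neg] at this
    have h5 : (2 : ℝ) • φ (φ (A α (ξ β))) = 0 := by
      rw [two_smul, ← neg_eq_zero, ← this]; abel
    simpa using h5
  rw [h.φ_sq] at h4
  simpa [h3] using h4

/-- `hcyc` is the closedness of the fundamental 2-form `g(·, φ·)`. With `ξ_α` as one argument it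
expresses `∇_{ξ_α} φ` through `A α`; normality on a pair `(x, ξ_α)` then determines `A α` on the
image of `φ`. The remaining directions `ξ_β` are settled by `connection_ξ_ξ`. -/
theorem connection_ξ (h : IsFramedMetric B φ ξ)
    (hη : ∀ α u v, B v (A α u) - B u (A α v) = 2 * B u (φ v))
    (hN : ∀ u v, P (φ u) v - P (φ v) u + φ (P v u) - φ (P u v)
      = -((2 : ℝ) • ∑ α, B u (φ v) • ξ α))
    (hcyc : ∀ u v w, B v (P u w) + B w (P v u) + B u (P w v) = 0)
    (hφξ : ∀ α u, P u (ξ α) + φ (A α u) = 0)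
    (hskew : ∀ u v w, B (P u v) w = - B v (P u w))
    (hδ : ∀ α β u, B (A α u) (ξ β) + B (ξ α) (A β u) = 0) (α : Fin s) (u : E) :
    A α u = - φ u := by
  have hξξ := h.connection_ξ_ξ hη hN hφξ hδ
  have hAξ : ∀ β u, B (A α u) (ξ β) = 0 := by
    intro β u
    have := hη α u (ξ β)
    rw [h.φ_ξ, hξξ] at this; simp at this; rw [h.symm, this]
  have hφφA : ∀ u, φ (φ (A α u)) = - A α u := by
    intro u; rw [h.φ_sq]; simp [hAξ]
  have hPξ : ∀ u, P u (ξ α) = - φ (A α u) := fun u ↦ eq_neg_of_add_eq_zero_left (hφξ α u)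
  have hξP : ∀ z, P (ξ α) z = - A α (φ z) - (2 : ℝ) • φ (φ z) - φ (A α z) := by
    intro z
    refine h.eq_of_forall fun y ↦ ?_
    have e1 := hcyc (ξ α) y z
    have e2 := hskew z (ξ α) y
    have e3 := h.skew z (A α y)
    have e4 := hη α y (φ z)
    have e5 : B z (P y (ξ α)) = - B z (φ (A α y)) := by rw [hPξ]; simp
    have e6 : B (P z (ξ α)) y = - B (φ (A α z)) y := by rw [hPξ]; simp
    simp only [map_sub, map_neg, map_smul, sub_apply, neg_apply, smul_apply, smul_eq_mul]
    rw [h.symm (P (ξ α) z) y, h.symm (A α (φ z)) y, h.symm (φ (φ z)) y]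
    linarith
  have hφ : ∀ x, A α (φ x) = - φ (φ x) := by
    intro x
    have e1 := hN x (ξ α)
    simp only [h.φ_ξ, map_zero, LinearMap.zero_apply, zero_smul, Finset.sum_const_zero, smul_zero,
      neg_zero, sub_zero, hPξ, hξP, map_sub, map_neg, map_smul, h.φ_φ_φ, hφφA] at e1
    have e2 : φ (A α (φ x)) = φ x := by
      have : (2 : ℝ) • (φ (A α (φ x)) - φ x) = 0 := by
        rw [← neg_eq_zero, ← e1]; module
      simpa [sub_eq_zero] using this
    rw [← neg_neg (A α (φ x)), ← hφφA, e2]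
  have e := h.φ_sq u
  have e' : u = -φ (φ u) + ∑ α, B u (ξ α) • ξ α := by rw [e]; abel
  conv_lhs => rw [e']
  simp [hφ, hξξ, h.φ_φ_φ]

/-- The analogue of the Sasakian formula for `∇φ`. Twice `g((∇_u φ)v, w)` is a combination of the
closedness identity at `(u, v, w)` and at `(u, φv, φw)` and of the normality identity at `(v, w)`
paired with `φu`. The auxiliary rules `hpφ` and `hpφφ` move `φ` across `P` at the cost of
characteristic terms. -/
theorem connection_φ (h : IsFramedMetric B φ ξ)
    (hA : ∀ α u, A α u = - φ u)
    (hN : ∀ u v, P (φ u) v - P (φ v) u + φ (P v u) - φ (P u v)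
      = -((2 : ℝ) • ∑ α, B u (φ v) • ξ α))
    (hcyc : ∀ u v w, B v (P u w) + B w (P v u) + B u (P w v) = 0)
    (hφφ : ∀ u v, P u (φ v) + φ (P u v)
      = ∑ α, (B v (A α u) • ξ α + B v (ξ α) • A α u))
    (hφξ : ∀ α u, P u (ξ α) + φ (A α u) = 0)
    (hskew : ∀ u v w, B (P u v) w = - B v (P u w)) (u v : E) :
    P u v = B (φ u) (φ v) • ∑ α, ξ α + (∑ α, B v (ξ α)) • φ (φ u) := by
  set e : E → ℝ := fun w ↦ ∑ α, B w (ξ α) with he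
  have hPξ : ∀ α u, P u (ξ α) = φ (φ u) := by
    intro α u
    rw [eq_neg_of_add_eq_zero_left (hφξ α u), hA]; simp
  have hpξ : ∀ α y z, B (P y z) (ξ α) = B (φ z) (φ y) := by
    intro α y z
    rw [hskew, hPξ, h.φ_sq_right, neg_neg]
  have hpφφ : ∀ x y z, B (P x y) (φ (φ z)) = - B (P x y) z + e z * B (φ y) (φ x) := by
    intro x y z
    rw [h.φ_sq]
    simp [hpξ, he, Finset.sum_mul]
  have hpφ : ∀ x y z, B (P x (φ y)) z - B (P x y) (φ z)
      = - B y (φ x) * e z - e y * B (φ x) z := by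
    intro x y z
    have e1 := congrArg (fun a ↦ B a z) (hφφ x y)
    have e2 := h.skew (P x y) z
    simp only [hA, map_add, add_apply, map_sum, sum_apply,
      map_smul, smul_apply, smul_eq_mul, map_neg, neg_apply, Finset.sum_add_distrib,
      ← Finset.mul_sum, mul_neg, neg_mul, Finset.sum_neg_distrib, ← Finset.sum_mul] at e1
    have e3 : ∑ α, B (ξ α) z = e z := by simp [he, h.symm z]
    rw [e3] at e1
    change _ + _ = _ + -(e y * _) at e1
    linarith
  have hN' : ∀ y z x, B (P (φ y) z) (φ x) - B (P (φ z) y) (φ x) - B (P z y) (φ (φ x))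
      + B (P y z) (φ (φ x)) = 0 := by
    intro y z x
    have e1 := congrArg (fun a ↦ B a (φ x)) (hN y z)
    have e2 := h.skew (P z y) (φ x)
    have e3 := h.skew (P y z) (φ x)
    simp only [map_add, map_sub, add_apply, sub_apply, map_neg, map_smul, neg_apply, smul_apply,
      map_sum, sum_apply, h.symm (ξ _) (φ x), h.η_φ, smul_zero, Finset.sum_const_zero, neg_zero]
      at e1
    linarith
  refine h.eq_of_forall fun w ↦ ?_
  have sk : ∀ a b c, B (P a b) c = - B (P a c) b := by
    intro a b c; rw [hskew, h.symm]
  have cy : ∀ a b c, B (P a c) b + B (P b a) c + B (P c b) a = 0 := by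
    intro a b c
    rw [h.symm _ b, h.symm _ c, h.symm _ a]; exact hcyc a b c
  have eφ : ∀ w, e (φ w) = 0 := by intro w; simp [he, h.η_φ]
  have r5 := h.skew (φ u) w
  have goal1 : 2 * B (P u v) w = 2 * (e w * B (φ u) (φ v)) - 2 * (e v * B (φ u) (φ w)) := by
    have c1 := cy u v w
    have c2 := cy u (φ v) (φ w)
    have n := hN' v w u
    rw [hpφφ, hpφφ] at n
    have p1 := hpφ (φ v) w u
    have p2 := hpφ (φ w) v u
    have p3 := hpφ u v (φ w)
    rw [eφ, hpφφ, h.symm (φ v) (φ u)] at p3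
    rw [h.φ_sq_right, h.skew (φ v) u, h.symm (φ v) (φ u), h.symm (φ w) (φ v)] at p1
    rw [h.φ_sq_right, h.skew (φ w) u, h.symm (φ w) (φ u)] at p2
    rw [h.symm (φ w) (φ v)] at n
    rw [sk u w v, sk v u w] at c1
    rw [sk u (φ w) (φ v), sk (φ v) u (φ w)] at c2
    linarith
  simp only [map_add, add_apply, map_smul, smul_apply, smul_eq_mul, map_sum, sum_apply, r5]
  have e3 : ∑ α, B (ξ α) w = e w := by simp [he, h.symm w]
  rw [e3]
  change _ = _ + e v * _
  linarith

end IsFramedMetric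

/-- The polarisation argument behind Schur's lemma for Kähler curvature tensors: a tensor with
the symmetries of a Kähler curvature tensor on the `J`-invariant subgroup `H` vanishes as soon as
its holomorphic sectional curvatures vanish. -/
theorem kaehler_tensor_eq_zero {D : E → E → E → E → ℝ} {J : E →L[ℝ] E} {H : AddSubgroup E}
    (add1 : ∀ x x' y z w, D (x + x') y z w = D x y z w + D x' y z w)
    (sk12 : ∀ x y z w, D x y z w = - D y x z w)
    (sk34 : ∀ x y z w, D x y z w = - D x y w z)
    (bianchi : ∀ x y z w, D x y z w + D y z x w + D z x y w = 0)
    (kaehler : ∀ x ∈ H, ∀ y ∈ H, ∀ z ∈ H, ∀ w ∈ H, D x y (J z) (J w) = D x y z w)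
    (hJ : ∀ x ∈ H, J x ∈ H) (hJJ : ∀ x ∈ H, J (J x) = -x)
    (hol : ∀ x ∈ H, D x (J x) x (J x) = 0) {x y z : E} (hx : x ∈ H) (hy : y ∈ H) (hz : z ∈ H) :
    D x y x z = 0 := by
  have pair : ∀ x y z w, D x y z w = D z w x y := by
    intro u v a b
    linarith [bianchi u v a b, bianchi v a b u, bianchi a b u v, bianchi b u v a, sk34 v a u b,
      sk34 a u v b, sk34 u v a b, sk34 a b v u, sk34 v b a u, sk34 b u a v, sk34 u a b v,
      sk34 b u v a, sk12 u v a b, sk12 v a u b, sk12 a u v b, sk12 a b u v, sk12 b v a u,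
      sk12 u b v a, sk34 v b u a, sk34 u v b a, sk34 a b u v, sk34 u b v a, sk12 v b u a,
      sk34 b v a u, sk34 u a v b, sk12 b v u a, sk12 u a v b, sk12 a u b v, sk12 v a b u,
      sk34 v a b u, sk34 a u b v, sk12 b u v a, sk12 b u a v, sk12 u b a v, sk34 u b a v]
  have add2 : ∀ x y y' z w, D x (y + y') z w = D x y z w + D x y' z w := by
    intro x y y' z w
    rw [sk12, add1, sk12 x y, sk12 x y']; ring
  have add3 : ∀ x y z z' w, D x y (z + z') w = D x y z w + D x y z' w := by
    intro x y z z' w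
    rw [pair, add1, pair z, pair z']
  have add4 : ∀ x y z w w', D x y z (w + w') = D x y z w + D x y z w' := by
    intro x y z z' w
    rw [sk34, add3, sk34 x y z, sk34 x y z]; ring
  have neg1 : ∀ x y z w, D (-x) y z w = - D x y z w := by
    intro x y z w
    have h0 : D 0 y z w = 0 := by have := add1 0 0 y z w; simp at this; exact this
    have := add1 x (-x) y z w
    rw [add_neg_cancel, h0] at this; linarith
  have neg2 : ∀ x y z w, D x (-y) z w = - D x y z w := by
    intro x y z w; rw [sk12, neg1, sk12 x]
  have neg3 : ∀ x y z w, D x y (-z) w = - D x y z w := by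
    intro x y z w; rw [pair, neg1, pair z]
  have neg4 : ∀ x y z w, D x y z (-w) = - D x y z w := by
    intro x y z w; rw [sk34, neg3, sk34 x y z]
  have kaehler' : ∀ x ∈ H, ∀ y ∈ H, ∀ z ∈ H, ∀ w ∈ H, D (J x) (J y) z w = D x y z w := by
    intro x hx y hy z hz w hw
    rw [pair, kaehler z hz w hw x hx y hy, pair]
  -- Adding the expansions at `x + y` and `x - y` removes the terms odd in `y`. The symmetries and
  -- the Bianchi identity reduce every mixed term to `D x (J y) x (J y)` and `D x y x y`.
  have polar : ∀ x ∈ H, ∀ y ∈ H, 3 * D x (J y) x (J y) + D x y x y = 0 := by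
    intro x hx y hy
    have q1 := hol (x + y) (H.add_mem hx hy)
    have q2 := hol (x + -y) (H.add_mem hx (H.neg_mem hy))
    simp only [map_add, map_neg, add1, add2, add3, add4, neg1, neg2, neg3, neg4] at q1 q2
    have q3 := hol x hx
    have q4 := hol y hy
    have a1 : D y (J x) x (J y) = D x (J y) x (J y) := by
      have := kaehler' y hy (J x) (hJ x hx) x hx (J y) (hJ y hy)
      rw [hJJ x hx, neg2, sk12 (J y)] at this; linarith
    have a2 : D y (J x) y (J x) = D x (J y) x (J y) := by
      have := kaehler' y hy (J x) (hJ x hx) y hy (J x) (hJ x hx)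
      rw [hJJ x hx, neg2, sk12 (J y), pair x (J y), a1] at this; linarith
    have a3 : D x (J y) y (J x) = D x (J y) x (J y) := by rw [pair, a1]
    have a4 : D y (J y) x (J x) = D x (J x) y (J y) := pair _ _ _ _
    have b1 := bianchi x (J x) y (J y)
    have b2 : D (J x) y x (J y) = - D x (J y) x (J y) := by rw [sk12, a1]
    have b3 : D y x (J x) (J y) = - D x y x y := by
      rw [kaehler y hy x hx x hx y hy, sk12]
    have b4 : D (J x) y x (J y) = - D y (J x) x (J y) := sk12 _ _ _ _
    linarith
  -- Replacing `y` by `J y` exchanges the two quantities in `polar`; the equations `3a + b = 0` and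
  -- `3b + a = 0` make both zero.
  have zero : ∀ x ∈ H, ∀ y ∈ H, D x y x y = 0 := by
    intro x hx y hy
    have h1 := polar x hx y hy
    have h2 := polar x hx (J y) (hJ y hy)
    rw [hJJ y hy, neg2, neg4] at h2
    linarith
  have h1 := zero x hx (y + z) (H.add_mem hy hz)
  simp only [add2, add4] at h1
  linarith [zero x hx y hy, zero x hx z hz, pair x y x z]

end Algebra

/-! ### Pointwise algebra: the curvature operator of an `S`-space form. -/

section Algebra

variable {E : Type*} [NormedAddCommGroup E] [NormedSpace ℝ E] {s : ℕ}

namespace IsFramedMetric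

variable {B : E →L[ℝ] E →L[ℝ] ℝ} {φ : E →L[ℝ] E} {ξ : Fin s → E}

/-- The vectors orthogonal to all characteristic vectors. -/
def horizontal (B : E →L[ℝ] E →L[ℝ] ℝ) (ξ : Fin s → E) : AddSubgroup E where
  carrier := {v | ∀ α, B v (ξ α) = 0}
  zero_mem' := by simp
  add_mem' := by intro a b ha hb α; simp [ha α, hb α]
  neg_mem' := by intro a ha α; simp [ha α]

theorem φ_mem_horizontal (h : IsFramedMetric B φ ξ) (v : E) : φ v ∈ horizontal B ξ :=
  fun α ↦ h.η_φ α v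

theorem φ_φ_of_mem (h : IsFramedMetric B φ ξ) {v : E} (hv : v ∈ horizontal B ξ) :
    φ (φ v) = -v := by
  rw [h.φ_sq]; simp [show ∀ α, B v (ξ α) = 0 from hv]

/-- The curvature operator of an `S`-space form on horizontal vectors. -/
def spaceFormCurvature (B : E →L[ℝ] E →L[ℝ] ℝ) (φ : E →L[ℝ] E) (p q : ℝ) (x y z : E) : E :=
  p • (B y z • x - B x z • y)
    + q • (B x (φ z) • φ y - B y (φ z) • φ x + (2 * B x (φ y)) • φ z)

variable {R : E →ₗ[ℝ] E →ₗ[ℝ] E →ₗ[ℝ] E} {c : ℝ}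

/-- The two coefficients of the model are forced. On horizontal vectors its commutator with `φ` is
`p - q` times the bracket in `hRφ`, and its `φ`-sectional curvature is `p + 3q`. Solving `p - q = s`
and `p + 3q = c` gives `(c + 3s)/4` and `(c - s)/4`, and the difference from `R` then satisfies the
hypotheses of `kaehler_tensor_eq_zero`. -/
theorem curvature_horizontal (h : IsFramedMetric B φ ξ)
    (sk12 : ∀ u v w, R u v w = - R v u w)
    (sk34 : ∀ u v w x, B (R u v w) x = - B (R u v x) w)
    (bianchi : ∀ u v w, R u v w + R v w u + R w u v = 0)
    (hRφ : ∀ u ∈ horizontal B ξ, ∀ v ∈ horizontal B ξ, ∀ w ∈ horizontal B ξ,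
      R u v (φ w) - φ (R u v w)
        = (s : ℝ) • (B (φ u) w • v - B v w • φ u - B (φ v) w • u + B u w • φ v))
    (hsec : ∀ v ∈ horizontal B ξ, B (R v (φ v) (φ v)) v = c * B v v ^ 2)
    {x y z : E} (hx : x ∈ horizontal B ξ) (hy : y ∈ horizontal B ξ) (hz : z ∈ horizontal B ξ) :
    B (R x y x) z
      = B (spaceFormCurvature B φ ((c + 3 * s) / 4) ((c - s) / 4) x y x) z := by
  rw [← sub_eq_zero]
  have hsφ : ∀ a b, B a (φ b) = - B b (φ a) := by
    intro a b; rw [← h.skew b a, h.symm]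
  refine kaehler_tensor_eq_zero (H := horizontal B ξ) (J := φ)
    (D := fun x y z w ↦ B (R x y z) w
      - B (spaceFormCurvature B φ ((c + 3 * s) / 4) ((c - s) / 4) x y z) w)
    ?_ ?_ ?_ ?_ ?_ (fun v _ ↦ h.φ_mem_horizontal v) (fun v hv ↦ h.φ_φ_of_mem hv) ?_ hx hy hz
  · intro x x' y z w
    simp only [spaceFormCurvature, map_add, map_sub, map_smul, add_apply, sub_apply, smul_apply,
      LinearMap.add_apply, smul_eq_mul]
    ring
  · intro x y z w
    rw [sk12]
    simp only [spaceFormCurvature, map_add, map_sub, map_smul, add_apply, sub_apply, smul_apply,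
      map_neg, neg_apply, smul_eq_mul]
    rw [hsφ x y]
    ring
  · intro x y z w
    rw [sk34]
    simp only [spaceFormCurvature, map_add, map_sub, map_smul, add_apply, sub_apply, smul_apply,
      smul_eq_mul]
    rw [h.symm (φ y) w, h.symm (φ x) w, h.symm (φ y) z, h.symm (φ x) z, h.symm (φ z) w,
      h.symm (φ w) z, hsφ w z, hsφ w x, hsφ w y, hsφ z x, hsφ z y]
    ring
  · intro x y z w
    have := congrArg (fun e ↦ B e w) (bianchi x y z)
    simp only [map_add, add_apply, map_zero, zero_apply] at this
    simp only [spaceFormCurvature, map_add, map_sub, map_smul, add_apply, sub_apply, smul_apply,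
      smul_eq_mul]
    rw [h.symm z x, h.symm y x, h.symm z y, hsφ z x, hsφ y x, hsφ z y]
    linarith
  · intro x hx y hy z hz w hw
    have e1 := congrArg (fun e ↦ B e (φ w)) (hRφ x hx y hy z hz)
    have e2 : B (φ (R x y z)) (φ w) = B (R x y z) w := by
      rw [h.metric (R x y z) w]; simp [show ∀ α, B w (ξ α) = 0 from hw]
    simp only [map_sub, map_add, map_smul, sub_apply, add_apply, smul_apply, smul_eq_mul, e2]
      at e1
    have e3 : ∀ a b, b ∈ horizontal B ξ → B (φ a) (φ b) = B a b := by
      intro a b hb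
      rw [h.metric a b]; simp [show ∀ α, B b (ξ α) = 0 from hb]
    simp only [spaceFormCurvature, map_add, map_sub, map_smul, add_apply, sub_apply, smul_apply,
      smul_eq_mul, h.φ_φ_of_mem hz, e3 _ w hw, map_neg, neg_apply]
    rw [h.skew x z, h.skew y z, e3 x w hw, e3 y w hw] at e1
    rw [h.symm (φ y) w, h.symm (φ x) w, h.symm (φ z) w, hsφ w x, hsφ w y, hsφ w z]
    linarith
  · intro x hx
    have e0 : B (R x (φ x) x) (φ x) = - c * B x x ^ 2 := by
      rw [sk34, hsec x hx]; ring
    rw [e0]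
    have e1 : B (φ x) (φ x) = B x x := by
      rw [h.metric x x]; simp [show ∀ α, B x (ξ α) = 0 from hx]
    simp only [spaceFormCurvature, map_add, map_sub, map_smul, add_apply, sub_apply, smul_apply,
      smul_eq_mul, h.φ_φ_of_mem hx, h.self_φ, map_neg, neg_apply, e1, h.skew x x]
    ring

/-- In an `S`-space form, `R(T, N)T` for `N` orthogonal to `T` and to the characteristic
vectors. -/
theorem curvature_eq (h : IsFramedMetric B φ ξ)
    (sk12 : ∀ u v w, R u v w = - R v u w)
    (sk34 : ∀ u v w x, B (R u v w) x = - B (R u v x) w)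
    (bianchi : ∀ u v w, R u v w + R v w u + R w u v = 0)
    (pair : ∀ u v w x, B (R u v w) x = B (R w x u) v)
    (hRξ : ∀ u v α, R u v (ξ α)
      = (∑ β, B u (ξ β)) • φ (φ v) - (∑ β, B v (ξ β)) • φ (φ u))
    (hRφ : ∀ u ∈ horizontal B ξ, ∀ v ∈ horizontal B ξ, ∀ w ∈ horizontal B ξ,
      R u v (φ w) - φ (R u v w)
        = (s : ℝ) • (B (φ u) w • v - B v w • φ u - B (φ v) w • u + B u w • φ v))
    (hsec : ∀ v ∈ horizontal B ξ, B (R v (φ v) (φ v)) v = c * B v v ^ 2)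
    {T N : E} (hN : ∀ α, B N (ξ α) = 0) (hTN : B T N = 0) :
    R T N T = -((((∑ α, B T (ξ α)) ^ 2
        + (c + 3 * s) / 4 * (B T T - ∑ α, B T (ξ α) ^ 2)) • N)
        + (3 * ((c - s) / 4) * B (φ T) N) • φ T) := by
  set X : E := - φ (φ T) with hXdef
  set b : ℝ := ∑ α, B T (ξ α) with hb
  -- `X` is the horizontal part of `T`. In the expansion of `R(T, N)T` only the purely horizontal
  -- and the purely characteristic terms survive.
  have hT : T = X + ∑ α, B T (ξ α) • ξ α := by rw [hXdef, h.φ_sq]; abel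
  have hX : X ∈ horizontal B ξ := (horizontal B ξ).neg_mem (h.φ_mem_horizontal _)
  have hX' : ∀ α, B X (ξ α) = 0 := hX
  have hNm : N ∈ horizontal B ξ := hN
  have hφX : φ X = φ T := by rw [hXdef, map_neg, h.φ_φ_φ, neg_neg]
  have hXN : B X N = 0 := by
    have := hTN
    rw [hT] at this
    simpa [map_sum, h.symm (ξ _) N, hN] using this
  have hξN : ∀ α, R X N (ξ α) = 0 := by
    intro α; rw [hRξ]; simp [hN, hX']
  have hXX : B X X = B T T - ∑ α, B T (ξ α) ^ 2 := by
    have e1 := h.metric T T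
    have e2 := h.metric X X
    rw [hφX] at e2
    simp only [hX', mul_zero, Finset.sum_const_zero, add_zero] at e2
    simp only [← sq] at e1
    linarith
  -- `curvature_horizontal` tests only against horizontal vectors; the characteristic components of
  -- both sides vanish (`e1`, `e2`).
  have h1 : R X N X = spaceFormCurvature B φ ((c + 3 * s) / 4) ((c - s) / 4) X N X := by
    refine h.eq_of_forall fun w ↦ ?_
    have hw : w = - φ (φ w) + ∑ α, B w (ξ α) • ξ α := by rw [h.φ_sq w]; abel
    have hwm : - φ (φ w) ∈ horizontal B ξ :=
      (horizontal B ξ).neg_mem (h.φ_mem_horizontal _)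
    have e := h.curvature_horizontal sk12 sk34 bianchi hRφ hsec hX hNm hwm
    have e1 : ∀ α, B (R X N X) (ξ α) = 0 := by
      intro α; rw [sk34, hξN]; simp
    have e2 : ∀ α, B (spaceFormCurvature B φ ((c + 3 * s) / 4) ((c - s) / 4) X N X) (ξ α) = 0 := by
      intro α
      simp [spaceFormCurvature, hN, hX', h.η_φ]
    rw [hw, map_add, map_add, e]
    simp [map_sum, e1, e2]
  have hξ : ∀ α, R (ξ α) N X = 0 := by
    intro α
    refine h.eq_of_forall fun w ↦ ?_
    rw [pair, hRξ]
    simp [hX', h.φ_φ_of_mem hX, hXN]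
  -- The value is the same for all pairs, equal or not, so the double sum produces `(∑ η_α(T))²` and
  -- not `∑ η_α(T)²`.
  have hξξ : ∀ α β, R (ξ α) N (ξ β) = - N := by
    intro α β
    rw [hRξ, h.φ_φ_of_mem hNm]
    simp [hN, h.η_ξ]
  have hR : R T N T = R X N X - b ^ 2 • N := by
    conv_lhs => rw [hT]
    simp only [map_add, map_sum, map_smul, LinearMap.add_apply, LinearMap.sum_apply,
      LinearMap.smul_apply, hξN, hξ, hξξ, smul_zero, Finset.sum_const_zero, add_zero, zero_add,
      smul_neg, Finset.sum_neg_distrib, ← Finset.sum_smul]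
    rw [smul_smul, ← sq, sub_eq_add_neg]
  have e1 : B X (φ N) = - B (φ T) N := by rw [← hφX, h.skew, neg_neg]
  rw [hR, h1, spaceFormCurvature, h.symm N X, hXN, h.self_φ, hXX, e1, hφX, h.symm N (φ T)]
  module

end IsFramedMetric

end Algebra

/-! ### `S`-structures in a coordinate domain: structure equations and curvature. -/

section LocalSStructure

variable {E : Type*} [NormedAddCommGroup E] [NormedSpace ℝ E]
  {F : Type*} [NormedAddCommGroup F] [NormedSpace ℝ F]

theorem curv_add_right (Γ : E → E →L[ℝ] E →L[ℝ] E) (z u v w w' : E) :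
    curv Γ z u v (w + w') = curv Γ z u v w + curv Γ z u v w' := by
  simp only [curv, map_add, add_apply]; abel

theorem curv_smul_right (Γ : E → E →L[ℝ] E →L[ℝ] E) (a : ℝ) (z u v w : E) :
    curv Γ z u v (a • w) = a • curv Γ z u v w := by
  simp only [curv, map_smul, smul_apply, smul_sub, smul_add]

theorem curv_add_left (Γ : E → E →L[ℝ] E →L[ℝ] E) (z u u' v w : E) :
    curv Γ z (u + u') v w = curv Γ z u v w + curv Γ z u' v w := by
  simp only [curv, map_add, add_apply]; abel

theorem curv_smul_left (Γ : E → E →L[ℝ] E →L[ℝ] E) (a : ℝ) (z u v w : E) :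
    curv Γ z (a • u) v w = a • curv Γ z u v w := by
  simp only [curv, map_smul, smul_apply, smul_sub, smul_add]

theorem curv_add_middle (Γ : E → E →L[ℝ] E →L[ℝ] E) (z u v v' w : E) :
    curv Γ z u (v + v') w = curv Γ z u v w + curv Γ z u v' w := by
  simp only [curv, map_add, add_apply]; abel

theorem curv_smul_middle (Γ : E → E →L[ℝ] E →L[ℝ] E) (a : ℝ) (z u v w : E) :
    curv Γ z u (a • v) w = a • curv Γ z u v w := by
  simp only [curv, map_smul, smul_apply, smul_sub, smul_add]

/-- The curvature in terms of Christoffel symbols, as a trilinear map. -/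
def curvLin (Γ : E → E →L[ℝ] E →L[ℝ] E) (z : E) : E →ₗ[ℝ] E →ₗ[ℝ] E →ₗ[ℝ] E :=
  LinearMap.mk₂ ℝ (fun u v ↦
    { toFun := fun w ↦ curv Γ z u v w
      map_add' := curv_add_right Γ z u v
      map_smul' := fun a w ↦ curv_smul_right Γ a z u v w })
    (fun u u' v ↦ LinearMap.ext fun w ↦ curv_add_left Γ z u u' v w)
    (fun a u v ↦ LinearMap.ext fun w ↦ curv_smul_left Γ a z u v w)
    (fun u v v' ↦ LinearMap.ext fun w ↦ curv_add_middle Γ z u v v' w)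
    (fun a u v ↦ LinearMap.ext fun w ↦ curv_smul_middle Γ a z u v w)

theorem curvLin_apply (Γ : E → E →L[ℝ] E →L[ℝ] E) (z u v w : E) :
    curvLin Γ z u v w = curv Γ z u v w := rfl

/-- The covariant derivative `(∇_u φ) v` of a field of endomorphisms. -/
def nablaEnd (Γ : E → E →L[ℝ] E →L[ℝ] E) (φ : E → E →L[ℝ] E) (z : E) : E →ₗ[ℝ] E →ₗ[ℝ] E :=
  LinearMap.mk₂ ℝ (fun u v ↦ fderiv ℝ φ z u v + Γ z (φ z v) u - φ z (Γ z v u))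
    (by intro u u' v; simp only [map_add, add_apply]; abel)
    (by intro a u v; simp only [map_smul, smul_apply, smul_sub, smul_add])
    (by intro u v v'; simp only [map_add, add_apply]; abel)
    (by intro a u v; simp only [map_smul, smul_apply, smul_sub, smul_add])

theorem nablaEnd_apply (Γ : E → E →L[ℝ] E →L[ℝ] E) (φ : E → E →L[ℝ] E) (z u v : E) :
    nablaEnd Γ φ z u v = fderiv ℝ φ z u v + Γ z (φ z v) u - φ z (Γ z v u) := rfl

/-- The covariant derivative `u ↦ ∇_u ξ` of a vector field on a coordinate domain. -/
def nablaVec (Γ : E → E →L[ℝ] E →L[ℝ] E) (ξ : E → E) (z : E) : E →L[ℝ] E :=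
  fderiv ℝ ξ z + Γ z (ξ z)

theorem nablaVec_apply (Γ : E → E →L[ℝ] E →L[ℝ] E) (ξ : E → E) (z u : E) :
    nablaVec Γ ξ z u = fderiv ℝ ξ z u + Γ z (ξ z) u := rfl

variable {Γ : E → E →L[ℝ] E →L[ℝ] E} {x X : F → E} {q : F}

theorem covD_neg (d : F) : covD Γ x (fun q ↦ - X q) d q = - covD Γ x X d q := by
  simp only [covD, fderiv_fun_neg, map_neg, neg_apply]
  abel

theorem covD_sum {ι : Type*} (S : Finset ι) {Y : ι → F → E}
    (hY : ∀ i, DifferentiableAt ℝ (Y i) q) (d : F) :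
    covD Γ x (fun q ↦ ∑ i ∈ S, Y i q) d q = ∑ i ∈ S, covD Γ x (Y i) d q := by
  simp only [covD, fderiv_fun_sum (fun i _ ↦ hY i), sum_apply, map_sum, Finset.sum_add_distrib]

theorem covD_end_apply {φ : E → E →L[ℝ] E} (hφ : DifferentiableAt ℝ φ (x q))
    (hx : DifferentiableAt ℝ x q) (hX : DifferentiableAt ℝ X q) (d : F) :
    covD Γ x (fun q ↦ φ (x q) (X q)) d q =
      nablaEnd Γ φ (x q) (fderiv ℝ x q d) (X q) + φ (x q) (covD Γ x X d q) := by
  have e1 : HasFDerivAt (fun q ↦ φ (x q)) ((fderiv ℝ φ (x q)).comp (fderiv ℝ x q)) q :=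
    hφ.hasFDerivAt.comp q hx.hasFDerivAt
  have e2 := (e1.clm_apply hX.hasFDerivAt).fderiv
  simp only [covD, nablaEnd_apply, e2, map_add]
  simp
  abel

theorem covD_vec_comp {ξ : E → E} (hξ : DifferentiableAt ℝ ξ (x q))
    (hx : DifferentiableAt ℝ x q) (d : F) :
    covD Γ x (fun q ↦ ξ (x q)) d q = nablaVec Γ ξ (x q) (fderiv ℝ x q d) := by
  have e1 : HasFDerivAt (fun q ↦ ξ (x q)) ((fderiv ℝ ξ (x q)).comp (fderiv ℝ x q)) q :=
    hξ.hasFDerivAt.comp q hx.hasFDerivAt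
  simp [covD, nablaVec_apply, e1.fderiv]

/-- An `S`-structure on a coordinate domain. -/
structure IsLocalSStructure {s : ℕ} (Ω : Set E) (g : E → E →L[ℝ] E →L[ℝ] ℝ)
    (Γ : E → E →L[ℝ] E →L[ℝ] E) (φ : E → E →L[ℝ] E) (ξ : Fin s → E → E) : Prop where
  lc : IsLocalLeviCivita Ω g Γ
  smooth_φ : ∀ z ∈ Ω, ContDiffAt ℝ ∞ φ z
  smooth_ξ : ∀ α, ∀ z ∈ Ω, ContDiffAt ℝ ∞ (ξ α) z
  framed : ∀ z ∈ Ω, IsFramedMetric (g z) (φ z) (fun α ↦ ξ α z)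
  d_η : ∀ z ∈ Ω, ∀ α u v, g z v (nablaVec Γ (ξ α) z u) - g z u (nablaVec Γ (ξ α) z v)
    = 2 * g z u (φ z v)
  normal : ∀ z ∈ Ω, ∀ u v, nablaEnd Γ φ z (φ z u) v - nablaEnd Γ φ z (φ z v) u
    + φ z (nablaEnd Γ φ z v u) - φ z (nablaEnd Γ φ z u v)
      = -((2 : ℝ) • ∑ α, g z u (φ z v) • ξ α z)

namespace IsLocalSStructure

variable {s : ℕ} {Ω : Set E} {g : E → E →L[ℝ] E →L[ℝ] ℝ} {φ : E → E →L[ℝ] E} {ξ : Fin s → E → E}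
  {z : E}

theorem differentiableAt_φ (h : IsLocalSStructure Ω g Γ φ ξ) (hz : z ∈ Ω) :
    DifferentiableAt ℝ φ z := (h.smooth_φ z hz).differentiableAt (by simp)

theorem differentiableAt_ξ (h : IsLocalSStructure Ω g Γ φ ξ) (hz : z ∈ Ω) (α : Fin s) :
    DifferentiableAt ℝ (ξ α) z := (h.smooth_ξ α z hz).differentiableAt (by simp)

/-- This is the covariant derivative of `φ² = -Id + ∑ η_α ⊗ ξ_α`; the terms that differentiate the
argument cancel by the same identity. -/
theorem nablaEnd_φ_add (h : IsLocalSStructure Ω g Γ φ ξ) (hz : z ∈ Ω) (u v : E) :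
    nablaEnd Γ φ z u (φ z v) + φ z (nablaEnd Γ φ z u v)
      = ∑ α, (g z v (nablaVec Γ (ξ α) z u) • ξ α z + g z v (ξ α z) • nablaVec Γ (ξ α) z u) := by
  have dφ := h.differentiableAt_φ hz
  have dξ := h.differentiableAt_ξ hz
  have dc : DifferentiableAt ℝ (fun _ : E ↦ v) z := differentiableAt_const v
  have did : DifferentiableAt ℝ (fun y : E ↦ y) z := differentiableAt_id
  have dφv : DifferentiableAt ℝ (fun y ↦ φ y v) z := dφ.clm_apply dc
  have dg : ∀ α, DifferentiableAt ℝ (fun y ↦ g y v (ξ α y)) z := fun α ↦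
    h.lc.differentiableAt_g (x := fun y : E ↦ y) hz did dc (dξ α)
  have e1 : covD Γ (fun y : E ↦ y) (fun y ↦ φ y (φ y v)) u z
      = covD Γ (fun y : E ↦ y) (fun y ↦ -v + ∑ α, g y v (ξ α y) • ξ α y) u z := by
    refine covD_congr Filter.EventuallyEq.rfl ?_ u
    filter_upwards [h.lc.isOpen.mem_nhds hz] with y hy using (h.framed y hy).φ_sq v
  rw [covD_end_apply (x := fun y : E ↦ y) dφ did dφv,
    covD_end_apply (x := fun y : E ↦ y) dφ did dc,
    covD_add (dc.fun_neg) (DifferentiableAt.fun_sum fun α _ ↦ (dg α).fun_smul (dξ α)),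
    covD_neg, covD_sum _ (fun α ↦ (dg α).fun_smul (dξ α))] at e1
  simp only [map_add, (h.framed z hz).φ_sq (covD _ _ _ _ _), fderiv_fun_id,
    ContinuousLinearMap.id_apply] at e1
  have e2 : ∀ α, covD Γ (fun y : E ↦ y) (fun y ↦ g y v (ξ α y) • ξ α y) u z
      = g z (covD Γ (fun y : E ↦ y) (fun _ ↦ v) u z) (ξ α z) • ξ α z
        + (g z v (nablaVec Γ (ξ α) z u) • ξ α z + g z v (ξ α z) • nablaVec Γ (ξ α) z u) := by
    intro α
    rw [covD_smul (dg α) (dξ α), h.lc.fderiv_g (x := fun y : E ↦ y) hz did dc (dξ α),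
      covD_vec_comp (x := fun y : E ↦ y) (dξ α) did]
    simp only [fderiv_fun_id, ContinuousLinearMap.id_apply, add_smul]
    abel
  simp only [e2] at e1
  rw [Finset.sum_add_distrib] at e1
  have e3 : ∀ a b d S S' : E, a + (b + (-d + S)) = -d + (S + S') → a + b = S' := by
    intro a b d S S' H
    have : a + b = (a + (b + (-d + S))) - (-d + S) := by abel
    rw [this, H]; abel
  exact e3 _ _ _ _ _ e1

theorem nablaEnd_ξ_add (h : IsLocalSStructure Ω g Γ φ ξ) (hz : z ∈ Ω) (α : Fin s) (u : E) :
    nablaEnd Γ φ z u (ξ α z) + φ z (nablaVec Γ (ξ α) z u) = 0 := by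
  have did : DifferentiableAt ℝ (fun y : E ↦ y) z := differentiableAt_id
  have e1 : covD Γ (fun y : E ↦ y) (fun y ↦ φ y (ξ α y)) u z
      = covD Γ (fun y : E ↦ y) (fun _ ↦ 0) u z := by
    refine covD_congr Filter.EventuallyEq.rfl ?_ u
    filter_upwards [h.lc.isOpen.mem_nhds hz] with y hy using (h.framed y hy).φ_ξ α
  rw [covD_end_apply (x := fun y : E ↦ y) (h.differentiableAt_φ hz) did
    (h.differentiableAt_ξ hz α), covD_vec_comp (x := fun y : E ↦ y)
    (h.differentiableAt_ξ hz α) did] at e1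
  simpa [covD] using e1

theorem nablaEnd_skew (h : IsLocalSStructure Ω g Γ φ ξ) (hz : z ∈ Ω) (u v w : E) :
    g z (nablaEnd Γ φ z u v) w = - g z v (nablaEnd Γ φ z u w) := by
  have dφ := h.differentiableAt_φ hz
  have did : DifferentiableAt ℝ (fun y : E ↦ y) z := differentiableAt_id
  have dc : ∀ v : E, DifferentiableAt ℝ (fun _ : E ↦ v) z := fun v ↦ differentiableAt_const v
  have dφv : ∀ v : E, DifferentiableAt ℝ (fun y ↦ φ y v) z := fun v ↦ dφ.clm_apply (dc v)
  have e1 : fderiv ℝ (fun y ↦ g y (φ y v) w) z u = fderiv ℝ (fun y ↦ - g y v (φ y w)) z u := by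
    have : (fun y ↦ g y (φ y v) w) =ᶠ[𝓝 z] fun y ↦ - g y v (φ y w) := by
      filter_upwards [h.lc.isOpen.mem_nhds hz] with y hy using (h.framed y hy).skew v w
    rw [this.fderiv_eq]
  rw [fderiv_fun_neg, neg_apply, h.lc.fderiv_g (x := fun y : E ↦ y) hz did (dφv v) (dc w),
    h.lc.fderiv_g (x := fun y : E ↦ y) hz did (dc v) (dφv w),
    covD_end_apply (x := fun y : E ↦ y) dφ did (dc v),
    covD_end_apply (x := fun y : E ↦ y) dφ did (dc w)] at e1
  simp only [fderiv_fun_id, ContinuousLinearMap.id_apply, map_add, add_apply,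
    (h.framed z hz).skew] at e1
  linarith

theorem nablaVec_ξ_add (h : IsLocalSStructure Ω g Γ φ ξ) (hz : z ∈ Ω) (α β : Fin s) (u : E) :
    g z (nablaVec Γ (ξ α) z u) (ξ β z) + g z (ξ α z) (nablaVec Γ (ξ β) z u) = 0 := by
  have did : DifferentiableAt ℝ (fun y : E ↦ y) z := differentiableAt_id
  have dξ := h.differentiableAt_ξ hz
  have e1 : fderiv ℝ (fun y ↦ g y (ξ α y) (ξ β y)) z u
      = fderiv ℝ (fun _ ↦ if β = α then (1 : ℝ) else 0) z u := by
    have : (fun y ↦ g y (ξ α y) (ξ β y)) =ᶠ[𝓝 z] fun _ ↦ if β = α then (1 : ℝ) else 0 := by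
      filter_upwards [h.lc.isOpen.mem_nhds hz] with y hy using (h.framed y hy).η_ξ β α
    rw [this.fderiv_eq]
  rw [h.lc.fderiv_g (x := fun y : E ↦ y) hz did (dξ α) (dξ β),
    covD_vec_comp (x := fun y : E ↦ y) (dξ α) did,
    covD_vec_comp (x := fun y : E ↦ y) (dξ β) did] at e1
  simpa using e1

/-- The fundamental form is closed because it is `dη_α`. Concretely, the identity for `dη_α` is
differentiated and summed cyclically: the second derivatives of `ξ_α` assemble into curvatures,
whose sum vanishes by skew symmetry and the first Bianchi identity. -/
theorem nablaEnd_cyclic (h : IsLocalSStructure Ω g Γ φ ξ) (hz : z ∈ Ω) (α : Fin s) (u v w : E) :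
    g z v (nablaEnd Γ φ z u w) + g z w (nablaEnd Γ φ z v u) + g z u (nablaEnd Γ φ z w v) = 0 := by
  have dφ := h.differentiableAt_φ hz
  have did : DifferentiableAt ℝ (fun y : E ↦ y) z := differentiableAt_id
  have dc : ∀ v : E, DifferentiableAt ℝ (fun _ : E ↦ v) z := fun v ↦ differentiableAt_const v
  have dφv : ∀ v : E, DifferentiableAt ℝ (fun y ↦ φ y v) z := fun v ↦ dφ.clm_apply (dc v)
  have hN : ∀ d, ContDiffAt ℝ ∞ (covD Γ (fun y : E ↦ y) (ξ α) d) z := fun d ↦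
    ContDiffAt.covD (x := fun y : E ↦ y) (h.lc.smooth_Γ z hz) contDiffAt_id (h.smooth_ξ α z hz) d
  have dN : ∀ d, DifferentiableAt ℝ (covD Γ (fun y : E ↦ y) (ξ α) d) z := fun d ↦
    (hN d).differentiableAt (by simp)
  have dgx : ∀ {X Y : E → E}, DifferentiableAt ℝ X z → DifferentiableAt ℝ Y z →
    DifferentiableAt ℝ (fun y ↦ g y (X y) (Y y)) z := fun hX hY ↦
      h.lc.differentiableAt_g (x := fun y : E ↦ y) hz did hX hY
  have hcomm := fun d d' ↦ covD_covD_sub (x := fun y : E ↦ y) (h.lc.smooth_Γ z hz) contDiffAt_id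
    (h.smooth_ξ α z hz) d d'
  simp only [fderiv_fun_id, ContinuousLinearMap.id_apply] at hcomm
  -- The derivative in direction `a` of the identity for `dη_α`, with `b` and `c` of constant
  -- components.
  have key : ∀ a b c : E,
      2 * (g z (Γ z b a) (φ z c) + g z b (nablaEnd Γ φ z a c) + g z b (φ z (Γ z c a)))
        = g z (Γ z c a) (nablaVec Γ (ξ α) z b)
          + g z c (covD Γ (fun y : E ↦ y) (covD Γ (fun y : E ↦ y) (ξ α) b) a z)
          - (g z (Γ z b a) (nablaVec Γ (ξ α) z c)
          + g z b (covD Γ (fun y : E ↦ y) (covD Γ (fun y : E ↦ y) (ξ α) c) a z)) := by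
    intro a b c
    have e1 : fderiv ℝ (fun y ↦ 2 * g y b (φ y c)) z a
        = fderiv ℝ (fun y ↦ g y c (covD Γ (fun y : E ↦ y) (ξ α) b y)
          - g y b (covD Γ (fun y : E ↦ y) (ξ α) c y)) z a := by
      have : (fun y ↦ 2 * g y b (φ y c)) =ᶠ[𝓝 z]
          (fun y ↦ g y c (covD Γ (fun y : E ↦ y) (ξ α) b y)
          - g y b (covD Γ (fun y : E ↦ y) (ξ α) c y)) := by
        filter_upwards [h.lc.isOpen.mem_nhds hz] with y hy
        rw [← h.d_η y hy α b c]
        simp [covD, nablaVec_apply]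
      rw [this.fderiv_eq]
    rw [fderiv_const_mul (dgx (dc b) (dφv c)), fderiv_fun_sub (dgx (dc c) (dN b))
      (dgx (dc b) (dN c)), smul_apply, sub_apply,
      h.lc.fderiv_g (x := fun y : E ↦ y) hz did (dc b) (dφv c),
      h.lc.fderiv_g (x := fun y : E ↦ y) hz did (dc c) (dN b),
      h.lc.fderiv_g (x := fun y : E ↦ y) hz did (dc b) (dN c),
      covD_end_apply (x := fun y : E ↦ y) dφ did (dc c)] at e1
    have e2 : ∀ (d e : E), covD Γ (fun y : E ↦ y) (fun _ ↦ e) d z = Γ z e d := by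
      intro d e; simp [covD]
    have e3 : ∀ d : E, covD Γ (fun y : E ↦ y) (ξ α) d z = nablaVec Γ (ξ α) z d := by
      intro d; simp [covD, nablaVec_apply]
    simp only [fderiv_fun_id, ContinuousLinearMap.id_apply, map_add, e2, e3, smul_eq_mul] at e1
    linarith
  have k1 := key u v w
  have k2 := key v w u
  have k3 := key w u v
  have c1 := congrArg (fun e ↦ g z w e) (hcomm u v)
  have c2 := congrArg (fun e ↦ g z u e) (hcomm v w)
  have c3 := congrArg (fun e ↦ g z v e) (hcomm w u)
  simp only [map_sub] at c1 c2 c3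
  have b := congrArg (fun e ↦ g z e (ξ α z)) (h.lc.curv_cyclic hz u v w)
  simp only [map_add, add_apply, map_zero, zero_apply] at b
  have s1 := h.lc.curv_skew hz u v w (ξ α z)
  have s2 := h.lc.curv_skew hz v w u (ξ α z)
  have s3 := h.lc.curv_skew hz w u v (ξ α z)
  have f1 := (h.framed z hz).skew (Γ z v u) w
  have f2 := (h.framed z hz).skew (Γ z w v) u
  have f3 := (h.framed z hz).skew (Γ z w u) v
  have f4 := (h.framed z hz).symm (φ z (Γ z v u)) w
  have f5 := (h.framed z hz).symm (φ z (Γ z w v)) u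
  have f6 := (h.framed z hz).symm (φ z (Γ z w u)) v
  rw [h.lc.Γ_symm z hz u v] at *
  rw [h.lc.Γ_symm z hz v w] at *
  rw [h.lc.Γ_symm z hz u w] at *
  linarith

variable [hs : NeZero s]

theorem nablaVec_ξ (h : IsLocalSStructure Ω g Γ φ ξ) (hz : z ∈ Ω) (α : Fin s) (u : E) :
    nablaVec Γ (ξ α) z u = - φ z u :=
  (h.framed z hz).connection_ξ (A := fun α ↦ nablaVec Γ (ξ α) z) (h.d_η z hz) (h.normal z hz)
    (h.nablaEnd_cyclic hz α) (h.nablaEnd_ξ_add hz) (h.nablaEnd_skew hz) (h.nablaVec_ξ_add hz) α u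

/-- The closedness of the fundamental form needs some index `α`; the index `0` is available because
`s ≥ 1`. -/
theorem nablaEnd_φ (h : IsLocalSStructure Ω g Γ φ ξ) (hz : z ∈ Ω) (u v : E) :
    nablaEnd Γ φ z u v = g z (φ z u) (φ z v) • ∑ α, ξ α z
      + (∑ α, g z v (ξ α z)) • φ z (φ z u) :=
  (h.framed z hz).connection_φ (A := fun α ↦ nablaVec Γ (ξ α) z) (h.nablaVec_ξ hz) (h.normal z hz)
    (h.nablaEnd_cyclic hz 0) (h.nablaEnd_φ_add hz) (h.nablaEnd_ξ_add hz) (h.nablaEnd_skew hz) u v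

/-- Ricci identity for `ξ_α`, whose derivative is `-φ`. In the antisymmetrised `∇φ` the term `g(φu,
φv) ∑ ξ_α` is symmetric and drops out. -/
theorem curv_ξ (h : IsLocalSStructure Ω g Γ φ ξ) (hz : z ∈ Ω) (u v : E) (α : Fin s) :
    curv Γ z u v (ξ α z) = (∑ β, g z u (ξ β z)) • φ z (φ z v)
      - (∑ β, g z v (ξ β z)) • φ z (φ z u) := by
  have dφ := h.differentiableAt_φ hz
  have did : DifferentiableAt ℝ (fun y : E ↦ y) z := differentiableAt_id
  have hcomm := covD_covD_sub (x := fun y : E ↦ y) (h.lc.smooth_Γ z hz) contDiffAt_id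
    (h.smooth_ξ α z hz) u v
  simp only [fderiv_fun_id, ContinuousLinearMap.id_apply] at hcomm
  have key : ∀ d d', covD Γ (fun y : E ↦ y) (covD Γ (fun y : E ↦ y) (ξ α) d') d z
      = -(nablaEnd Γ φ z d d' + φ z (Γ z d' d)) := by
    intro d d'
    have : covD Γ (fun y : E ↦ y) (ξ α) d' =ᶠ[𝓝 z] fun y ↦ - φ y d' := by
      filter_upwards [h.lc.isOpen.mem_nhds hz] with y hy
      rw [← h.nablaVec_ξ hy α d']
      simp [covD, nablaVec_apply]
    rw [covD_congr Filter.EventuallyEq.rfl this, covD_neg,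
      covD_end_apply (x := fun y : E ↦ y) dφ did (differentiableAt_const _)]
    simp [covD]
  rw [← hcomm, key, key, h.lc.Γ_symm z hz v u, h.nablaEnd_φ hz, h.nablaEnd_φ hz,
    (h.framed z hz).symm (φ z v) (φ z u)]
  abel

-- Ricci identity for `φw` with `w` of constant components, after substituting the formula for `∇φ`.
-- Horizontality is assumed only at `z`, so it is used after differentiating. The Christoffel terms
-- that appear are symmetric in the two directions and cancel; the factor `s` counts the `ξ_α`.
open IsFramedMetric in
theorem curv_φ (h : IsLocalSStructure Ω g Γ φ ξ) (hz : z ∈ Ω) {u v w : E}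
    (hu : u ∈ horizontal (g z) (fun α ↦ ξ α z)) (hv : v ∈ horizontal (g z) (fun α ↦ ξ α z))
    (hw : w ∈ horizontal (g z) (fun α ↦ ξ α z)) :
    curv Γ z u v (φ z w) - φ z (curv Γ z u v w) =
      (s : ℝ) • (g z (φ z u) w • v - g z v w • φ z u - g z (φ z v) w • u + g z u w • φ z v) := by
  have hf := h.framed z hz
  have dφ := h.differentiableAt_φ hz
  have dξ := h.differentiableAt_ξ hz
  have did : DifferentiableAt ℝ (fun y : E ↦ y) z := differentiableAt_id
  have dc : ∀ v : E, DifferentiableAt ℝ (fun _ : E ↦ v) z := fun v ↦ differentiableAt_const v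
  have dφv : ∀ v : E, DifferentiableAt ℝ (fun y ↦ φ y v) z := fun v ↦ dφ.clm_apply (dc v)
  have dgx : ∀ {X Y : E → E}, DifferentiableAt ℝ X z → DifferentiableAt ℝ Y z →
    DifferentiableAt ℝ (fun y ↦ g y (X y) (Y y)) z := fun hX hY ↦
      h.lc.differentiableAt_g (x := fun y : E ↦ y) hz did hX hY
  have hcomm1 := covD_covD_sub (x := fun y : E ↦ y) (X := fun y ↦ φ y w)
    (h.lc.smooth_Γ z hz) contDiffAt_id ((h.smooth_φ z hz).clm_apply contDiffAt_const) u v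
  have hcomm2 := covD_covD_sub (x := fun y : E ↦ y) (X := fun _ ↦ w)
    (h.lc.smooth_Γ z hz) contDiffAt_id contDiffAt_const u v
  simp only [fderiv_fun_id, ContinuousLinearMap.id_apply] at hcomm1 hcomm2
  have dN : ∀ d, DifferentiableAt ℝ (covD Γ (fun y : E ↦ y) (fun _ ↦ w) d) z := fun d ↦
    (ContDiffAt.covD (x := fun y : E ↦ y) (h.lc.smooth_Γ z hz) contDiffAt_id
      contDiffAt_const d).differentiableAt (by simp)
  have hor : ∀ a ∈ horizontal (g z) (fun α ↦ ξ α z), ∀ α, g z a (ξ α z) = 0 := fun a ha ↦ ha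
  have hconst : ∀ a d : E, covD Γ (fun y : E ↦ y) (fun _ ↦ a) d z = Γ z a d := by
    intro a d; simp [covD]
  have key : ∀ a ∈ horizontal (g z) (fun α ↦ ξ α z), ∀ b ∈ horizontal (g z) (fun α ↦ ξ α z),
      covD Γ (fun y : E ↦ y) (covD Γ (fun y : E ↦ y) (fun y ↦ φ y w) b) a z
      = (g z (φ z (Γ z b a)) (φ z w) + g z (φ z b) (φ z (Γ z w a))
          + g z (φ z a) (φ z (Γ z w b))) • ∑ α, ξ α z
        - ((s : ℝ) * g z b w) • φ z a
        - ((∑ α, g z (Γ z w a) (ξ α z)) - s * g z (φ z a) w) • b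
        - (∑ α, g z (Γ z w b) (ξ α z)) • a
        + φ z (covD Γ (fun y : E ↦ y) (covD Γ (fun y : E ↦ y) (fun _ ↦ w) b) a z) := by
    intro a ha b hb
    have e1 : covD Γ (fun y : E ↦ y) (fun y ↦ φ y w) b =ᶠ[𝓝 z] fun y ↦
        (g y (φ y b) (φ y w) • ∑ α, ξ α y + (∑ α, g y w (ξ α y)) • φ y (φ y b))
          + φ y (covD Γ (fun y : E ↦ y) (fun _ ↦ w) b y) := by
      filter_upwards [h.lc.isOpen.mem_nhds hz] with y hy
      rw [← h.nablaEnd_φ hy, covD_end_apply (x := fun y : E ↦ y) (h.differentiableAt_φ hy)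
        differentiableAt_id (differentiableAt_const _)]
      simp
    have d1 := dgx (dφv b) (dφv w)
    have d2 : DifferentiableAt ℝ (fun y ↦ ∑ α, ξ α y) z := DifferentiableAt.fun_sum fun α _ ↦ dξ α
    have d3 : DifferentiableAt ℝ (fun y ↦ ∑ α, g y w (ξ α y)) z :=
      DifferentiableAt.fun_sum fun α _ ↦ dgx (dc w) (dξ α)
    have d4 : DifferentiableAt ℝ (fun y ↦ φ y (φ y b)) z := dφ.clm_apply (dφv b)
    rw [covD_congr Filter.EventuallyEq.rfl e1,
      covD_add ((d1.fun_smul d2).fun_add (d3.fun_smul d4)) (dφ.clm_apply (dN b)),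
      covD_add (d1.fun_smul d2) (d3.fun_smul d4), covD_smul d1 d2, covD_smul d3 d4,
      covD_sum _ dξ, covD_end_apply (x := fun y : E ↦ y) dφ did (dN b),
      fderiv_fun_sum (fun α _ ↦ dgx (dc w) (dξ α)), sum_apply,
      h.lc.fderiv_g (x := fun y : E ↦ y) hz did (dφv b) (dφv w),
      covD_end_apply (x := fun y : E ↦ y) dφ did (dc w),
      covD_end_apply (x := fun y : E ↦ y) dφ did (dc b)]
    simp only [covD_vec_comp (x := fun y : E ↦ y) (dξ _) did,
      fun α ↦ h.lc.fderiv_g (x := fun y : E ↦ y) hz did (dc w) (dξ α) a, fderiv_fun_id,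
      ContinuousLinearMap.id_apply, h.nablaVec_ξ hz, hconst, h.nablaEnd_φ hz, hor w hw, hor b hb,
      Finset.sum_const_zero, zero_smul, add_zero, map_add, map_smul, add_apply, smul_apply,
      map_sum, sum_apply, hf.η_φ, smul_zero, zero_add, Finset.sum_add_distrib, map_neg,
      Finset.sum_neg_distrib, Finset.sum_const, Finset.card_univ, Fintype.card_fin,
      hf.φ_φ_of_mem hb, hf.φ_φ_of_mem ha, hf.symm (ξ _ z) (φ z _)]
    have e3 : g z (φ z b) (φ z w) = g z b w := by
      rw [hf.metric b w]; simp [hor w hw]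
    rw [e3, hf.symm w (φ z a), ← Nat.cast_smul_eq_nsmul ℝ, ← Nat.cast_smul_eq_nsmul ℝ]
    simp only [smul_eq_mul]
    module
  rw [← hcomm1, ← hcomm2, key u hu v hv, key v hv u hu, h.lc.Γ_symm z hz v u, map_sub]
  module

/-- The curvature `R(T, N)T` of an `S`-space form in coordinates. -/
theorem curv_eq (h : IsLocalSStructure Ω g Γ φ ξ) (hz : z ∈ Ω) {c : ℝ}
    (hsec : ∀ v, (∀ α, g z v (ξ α z) = 0) →
      g z (curv Γ z v (φ z v) (φ z v)) v = c * g z v v ^ 2)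
    {T N : E} (hN : ∀ α, g z N (ξ α z) = 0) (hTN : g z T N = 0) :
    curv Γ z T N T = -((((∑ α, g z T (ξ α z)) ^ 2
        + (c + 3 * s) / 4 * (g z T T - ∑ α, g z T (ξ α z) ^ 2)) • N)
        + (3 * ((c - s) / 4) * g z (φ z T) N) • φ z T) := by
  refine (h.framed z hz).curvature_eq (R := curvLin Γ z)
    (fun u v w ↦ IsLocalLeviCivita.curv_swap z u v w) ?_ (h.lc.curv_cyclic hz)
    (h.lc.curv_pair_symm hz) (h.curv_ξ hz) (fun u hu v hv w hw ↦ h.curv_φ hz hu hv hw)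
    (fun v hv ↦ hsec v hv) hN hTN
  intro u v w x
  have := h.lc.curv_skew hz u v w x
  rw [(h.framed z hz).symm w] at this
  simp only [curvLin_apply]
  linarith

end IsLocalSStructure

end LocalSStructure

/-! ### Tangent vectors and vector fields in the frame of a chart. -/

section Coordinates

variable {E : Type*} [NormedAddCommGroup E] [NormedSpace ℝ E] [FiniteDimensional ℝ E]
  {M : Type*} [TopologicalSpace M] [ChartedSpace E M] [IsManifold 𝓘(ℝ, E) ∞ M]

/-- The components of tangent vectors at `y` in the coordinate frame of the chart at `p`. -/
def toCoord (p y : M) : TangentSpace 𝓘(ℝ, E) y →L[ℝ] E :=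
  (trivializationAt E (fun z : M ↦ TangentSpace 𝓘(ℝ, E) z) p).continuousLinearMapAt ℝ y

/-- The tangent vector at `y` with given components in the coordinate frame of the chart at `p`. -/
def ofCoord (p y : M) : E →L[ℝ] TangentSpace 𝓘(ℝ, E) y :=
  (trivializationAt E (fun z : M ↦ TangentSpace 𝓘(ℝ, E) z) p).symmL ℝ y

/-- The vector field with constant components in the coordinate frame of the chart at `p`. -/
def coordField (p : M) (w : E) (y : M) : TangentSpace 𝓘(ℝ, E) y :=
  (trivializationAt E (fun z : M ↦ TangentSpace 𝓘(ℝ, E) z) p).symm y w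

variable {p y : M}

theorem ofCoord_apply (hy : y ∈ (chartAt E p).source) (w : E) :
    ofCoord p y w = coordField p w y := by
  rw [ofCoord, Trivialization.symmL_apply _ (by simpa using hy)]; rfl

theorem toCoord_ofCoord (hy : y ∈ (chartAt E p).source) (w : E) :
    toCoord p y (ofCoord p y w) = w :=
  Trivialization.continuousLinearMapAt_symmL _ (by simpa using hy) w

theorem ofCoord_toCoord (hy : y ∈ (chartAt E p).source) (v : TangentSpace 𝓘(ℝ, E) y) :
    ofCoord p y (toCoord p y v) = v :=
  Trivialization.symmL_continuousLinearMapAt _ (by simpa using hy) v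

theorem toCoord_coordField (hy : y ∈ (chartAt E p).source) (w : E) :
    toCoord p y (coordField p w y) = w := by
  rw [← ofCoord_apply hy, toCoord_ofCoord hy]

theorem coordField_toCoord (hy : y ∈ (chartAt E p).source) (v : TangentSpace 𝓘(ℝ, E) y) :
    coordField p (toCoord p y v) y = v := by
  rw [← ofCoord_apply hy, ofCoord_toCoord hy]

theorem toCoord_injective (hy : y ∈ (chartAt E p).source) :
    Function.Injective (toCoord (E := E) p y) := fun v w h ↦ by
  rw [← ofCoord_toCoord hy v, h, ofCoord_toCoord hy]

theorem trivializationAt_snd (hy : y ∈ (chartAt E p).source) (v : TangentSpace 𝓘(ℝ, E) y) :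
    (trivializationAt E (fun z : M ↦ TangentSpace 𝓘(ℝ, E) z) p ⟨y, v⟩).2 = toCoord p y v :=
  (Trivialization.continuousLinearMapAt_apply_of_mem ℝ _ (by simpa using hy) v).symm

theorem constField_eq (v : TangentSpace 𝓘(ℝ, E) p) :
    constField v = coordField p (toCoord p p v) := by
  funext y
  rw [constField, trivializationAt_snd (mem_chart_source E p)]; rfl

theorem toCoord_eq_mfderiv (hy : y ∈ (chartAt E p).source) :
    toCoord p y = mfderiv 𝓘(ℝ, E) 𝓘(ℝ, E) (extChartAt 𝓘(ℝ, E) p) y :=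
  TangentBundle.continuousLinearMapAt_trivializationAt hy

theorem chart_source_mem_nhds (hy : y ∈ (chartAt E p).source) : (chartAt E p).source ∈ 𝓝 y :=
  (chartAt E p).open_source.mem_nhds hy

theorem extChartAt_symm_apply (hy : y ∈ (chartAt E p).source) :
    (extChartAt 𝓘(ℝ, E) p).symm (extChartAt 𝓘(ℝ, E) p y) = y :=
  (extChartAt 𝓘(ℝ, E) p).left_inv (by simpa using hy)

theorem extChartAt_mem_target (hy : y ∈ (chartAt E p).source) :
    extChartAt 𝓘(ℝ, E) p y ∈ (extChartAt 𝓘(ℝ, E) p).target :=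
  (extChartAt 𝓘(ℝ, E) p).map_source (by simpa using hy)

theorem extChartAt_symm_mem {z : E} (hz : z ∈ (extChartAt 𝓘(ℝ, E) p).target) :
    (extChartAt 𝓘(ℝ, E) p).symm z ∈ (chartAt E p).source := by
  simpa using (extChartAt 𝓘(ℝ, E) p).map_target hz

theorem contMDiffAt_extChartAt_of_mem (hy : y ∈ (chartAt E p).source) :
    ContMDiffAt 𝓘(ℝ, E) 𝓘(ℝ, E) ∞ (extChartAt 𝓘(ℝ, E) p) y :=
  contMDiffAt_extChartAt' hy

theorem contMDiffAt_extChartAt_symm {z : E} (hz : z ∈ (extChartAt 𝓘(ℝ, E) p).target) :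
    ContMDiffAt 𝓘(ℝ, E) 𝓘(ℝ, E) ∞ (extChartAt 𝓘(ℝ, E) p).symm z :=
  (contMDiffOn_extChartAt_symm p).contMDiffAt ((isOpen_extChartAt_target p).mem_nhds hz)

variable {G : Type*} [NormedAddCommGroup G] [NormedSpace ℝ G]

theorem contDiffAt_comp_extChartAt_symm {h : M → G} {z : E}
    (hz : z ∈ (extChartAt 𝓘(ℝ, E) p).target)
    (hh : ContMDiffAt 𝓘(ℝ, E) 𝓘(ℝ, G) ∞ h ((extChartAt 𝓘(ℝ, E) p).symm z)) :
    ContDiffAt ℝ ∞ (fun z ↦ h ((extChartAt 𝓘(ℝ, E) p).symm z)) z :=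
  (hh.comp z (contMDiffAt_extChartAt_symm hz)).contDiffAt

theorem differentiableAt_comp_extChartAt_symm {h : M → G}
    (hy : y ∈ (chartAt E p).source) (hh : MDifferentiableAt 𝓘(ℝ, E) 𝓘(ℝ, G) h y) :
    DifferentiableAt ℝ (fun z ↦ h ((extChartAt 𝓘(ℝ, E) p).symm z)) (extChartAt 𝓘(ℝ, E) p y) := by
  rw [← extChartAt_symm_apply hy] at hh
  exact (hh.comp _ ((contMDiffAt_extChartAt_symm (extChartAt_mem_target hy)).mdifferentiableAt
    (by simp))).differentiableAt

theorem mvfderiv_eq_fderiv {h : M → G} (hy : y ∈ (chartAt E p).source)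
    (hh : MDifferentiableAt 𝓘(ℝ, E) 𝓘(ℝ, G) h y) (v : TangentSpace 𝓘(ℝ, E) y) :
    mvfderiv 𝓘(ℝ, E) h y v =
      fderiv ℝ (fun z ↦ h ((extChartAt 𝓘(ℝ, E) p).symm z)) (extChartAt 𝓘(ℝ, E) p y)
        (toCoord p y v) := by
  have h1 : h =ᶠ[𝓝 y] (fun z ↦ h ((extChartAt 𝓘(ℝ, E) p).symm z)) ∘ extChartAt 𝓘(ℝ, E) p := by
    filter_upwards [chart_source_mem_nhds hy] with w hw
    simp only [Function.comp, extChartAt_symm_apply hw]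
  have h2 : mfderiv 𝓘(ℝ, E) 𝓘(ℝ, G) h y =
      (mfderiv 𝓘(ℝ, E) 𝓘(ℝ, G) (fun z ↦ h ((extChartAt 𝓘(ℝ, E) p).symm z))
        (extChartAt 𝓘(ℝ, E) p y)).comp (mfderiv 𝓘(ℝ, E) 𝓘(ℝ, E) (extChartAt 𝓘(ℝ, E) p) y) := by
    rw [h1.mfderiv_eq]
    exact mfderiv_comp y (differentiableAt_comp_extChartAt_symm hy hh).mdifferentiableAt
      ((contMDiffAt_extChartAt_of_mem hy).mdifferentiableAt (by simp))
  rw [mvfderiv]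
  simp only [ContinuousLinearMap.comp_apply]
  erw [h2]
  rw [toCoord_eq_mfderiv hy, mfderiv_eq_fderiv]
  rfl

theorem contMDiffAt_section_iff_coord {n : WithTop ℕ∞} {X : (y : M) → TangentSpace 𝓘(ℝ, E) y}
    (hy : y ∈ (chartAt E p).source) (hn : n ≤ ∞) :
    ContMDiffAt 𝓘(ℝ, E) (𝓘(ℝ, E).tangent) n
      (fun y ↦ (⟨y, X y⟩ : TangentBundle 𝓘(ℝ, E) M)) y ↔
    ContMDiffAt 𝓘(ℝ, E) 𝓘(ℝ, E) n (fun y ↦ toCoord p y (X y)) y := by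
  have := ContMDiffVectorBundle.of_le (F := E) (E := fun z : M ↦ TangentSpace 𝓘(ℝ, E) z)
    (IB := 𝓘(ℝ, E)) hn
  rw [(trivializationAt E (fun z : M ↦ TangentSpace 𝓘(ℝ, E) z) p).contMDiffAt_section_iff (by simpa using hy)]
  refine Filter.EventuallyEq.contMDiffAt_iff ?_
  filter_upwards [chart_source_mem_nhds hy] with w hw using trivializationAt_snd hw _

end Coordinates

/-! ### Christoffel symbols of a connection on the manifold. -/

section Christoffel

variable {E : Type*} [NormedAddCommGroup E] [NormedSpace ℝ E] [FiniteDimensional ℝ E]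
  {M : Type*} [TopologicalSpace M] [ChartedSpace E M] [IsManifold 𝓘(ℝ, E) ∞ M]
  {p y : M} {X Y : (y : M) → TangentSpace 𝓘(ℝ, E) y}

theorem mdifferentiableAt_section_iff_coord (hy : y ∈ (chartAt E p).source) :
    MDifferentiableAt 𝓘(ℝ, E) (𝓘(ℝ, E).tangent)
      (fun y ↦ (⟨y, X y⟩ : TangentBundle 𝓘(ℝ, E) M)) y ↔
    MDifferentiableAt 𝓘(ℝ, E) 𝓘(ℝ, E) (fun y ↦ toCoord p y (X y)) y := by
  rw [(trivializationAt E (fun z : M ↦ TangentSpace 𝓘(ℝ, E) z) p).mdifferentiableAt_section_iff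
    𝓘(ℝ, E) _ (by simpa using hy)]
  refine Filter.EventuallyEq.mdifferentiableAt_iff ?_
  filter_upwards [chart_source_mem_nhds hy] with w hw using trivializationAt_snd hw _

theorem contMDiffAt_coordField (hy : y ∈ (chartAt E p).source) (w : E) :
    ContMDiffAt 𝓘(ℝ, E) (𝓘(ℝ, E).tangent) ∞
      (fun y ↦ (⟨y, coordField p w y⟩ : TangentBundle 𝓘(ℝ, E) M)) y := by
  rw [contMDiffAt_section_iff_coord hy le_rfl]
  refine (contMDiffAt_const (c := w)).congr_of_eventuallyEq ?_
  filter_upwards [chart_source_mem_nhds hy] with z hz using toCoord_coordField hz w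

theorem mdifferentiableAt_coordField (hy : y ∈ (chartAt E p).source) (w : E) :
    MDifferentiableAt 𝓘(ℝ, E) (𝓘(ℝ, E).tangent)
      (fun y ↦ (⟨y, coordField p w y⟩ : TangentBundle 𝓘(ℝ, E) M)) y :=
  (contMDiffAt_coordField hy w).mdifferentiableAt (by simp)

theorem coordField_add (hy : y ∈ (chartAt E p).source) (w w' : E) :
    coordField p (w + w') y = coordField p w y + coordField p w' y := by
  simp only [← ofCoord_apply hy, map_add]

theorem coordField_smul (hy : y ∈ (chartAt E p).source) (a : ℝ) (w : E) :
    coordField p (a • w) y = a • coordField p w y := by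
  simp only [← ofCoord_apply hy, map_smul]

variable (cov : AffineConnection E M)

theorem cov_congr (hX : MDifferentiableAt 𝓘(ℝ, E) (𝓘(ℝ, E).tangent)
      (fun y ↦ (⟨y, X y⟩ : TangentBundle 𝓘(ℝ, E) M)) y)
    (hXY : ∀ᶠ z in 𝓝 y, X z = Y z) : cov X y = cov Y y := by
  refine cov.isCovariantDerivativeOnUniv.congr_of_eventuallyEq hX ?_ Filter.univ_mem hXY
  refine hX.congr_of_eventuallyEq ?_
  filter_upwards [hXY] with z hz
  rw [hz]

theorem cov_add (hX : MDifferentiableAt 𝓘(ℝ, E) (𝓘(ℝ, E).tangent)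
      (fun y ↦ (⟨y, X y⟩ : TangentBundle 𝓘(ℝ, E) M)) y)
    (hY : MDifferentiableAt 𝓘(ℝ, E) (𝓘(ℝ, E).tangent)
      (fun y ↦ (⟨y, Y y⟩ : TangentBundle 𝓘(ℝ, E) M)) y) :
    cov (X + Y) y = cov X y + cov Y y :=
  cov.isCovariantDerivativeOnUniv.add hX hY

theorem cov_smul {f : M → ℝ} (hX : MDifferentiableAt 𝓘(ℝ, E) (𝓘(ℝ, E).tangent)
      (fun y ↦ (⟨y, X y⟩ : TangentBundle 𝓘(ℝ, E) M)) y)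
    (hf : MDifferentiableAt 𝓘(ℝ, E) 𝓘(ℝ, ℝ) f y) (v : TangentSpace 𝓘(ℝ, E) y) :
    cov (f • X) y v = f y • cov X y v + mvfderiv 𝓘(ℝ, E) f y v • X y := by
  rw [cov.isCovariantDerivativeOnUniv.leibniz hX hf]
  rfl

theorem cov_coordField_add (hy : y ∈ (chartAt E p).source) (w w' : E) :
    cov (coordField p (w + w')) y = cov (coordField p w) y + cov (coordField p w') y := by
  rw [← cov_add cov (mdifferentiableAt_coordField hy w) (mdifferentiableAt_coordField hy w')]
  refine cov_congr cov (mdifferentiableAt_coordField hy _) ?_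
  filter_upwards [chart_source_mem_nhds hy] with z hz using coordField_add hz w w'

theorem cov_coordField_smul (hy : y ∈ (chartAt E p).source) (a : ℝ) (w : E) :
    cov (coordField p (a • w)) y = a • cov (coordField p w) y := by
  rw [← cov.isCovariantDerivativeOnUniv.smul_const a (mdifferentiableAt_coordField hy w)]
  refine cov_congr cov (mdifferentiableAt_coordField hy _) ?_
  filter_upwards [chart_source_mem_nhds hy] with z hz using coordField_smul hz a w

/-- The Christoffel symbols at `y` in the chart at `p`; the first argument is the field. -/
def christoffel (p y : M) : E →L[ℝ] E →L[ℝ] E :=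
  (Module.finBasis ℝ E).constrL fun i ↦
    (toCoord p y).comp ((cov (coordField p (Module.finBasis ℝ E i)) y).comp (ofCoord p y))

/-- `christoffel` is prescribed on a basis. Linearity in the field argument comes from the locality
of the connection and is available only over the chart domain, whence `hy`. -/
theorem christoffel_apply (hy : y ∈ (chartAt E p).source) (w v : E) :
    christoffel cov p y w v = toCoord p y (cov (coordField p w) y (ofCoord p y v)) := by
  let L : E →ₗ[ℝ] E :=
    { toFun := fun w ↦ toCoord p y (cov (coordField p w) y (ofCoord p y v))
      map_add' := fun w w' ↦ by rw [cov_coordField_add cov hy, add_apply, map_add]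
      map_smul' := fun a w ↦ by
        rw [cov_coordField_smul cov hy, smul_apply, map_smul]; rfl }
  change _ = L w
  conv_rhs => rw [← (Module.finBasis ℝ E).sum_equivFun w, map_sum]
  rw [christoffel, Module.Basis.constrL_apply, sum_apply]
  simp only [map_smul, smul_apply]
  rfl

/-- Smoothness of the connection speaks of globally smooth fields, so a coordinate field is cut off
by a bump function. Locality of the connection makes the cut-off harmless. -/
theorem exists_eventuallyEq_contMDiff [T2Space M] (hy : y ∈ (chartAt E p).source) (w : E) :
    ∃ Z : (y : M) → TangentSpace 𝓘(ℝ, E) y, (∀ᶠ z in 𝓝 y, coordField p w z = Z z) ∧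
      ContMDiff 𝓘(ℝ, E) (𝓘(ℝ, E).tangent) ∞
        (fun y ↦ (⟨y, Z y⟩ : TangentBundle 𝓘(ℝ, E) M)) := by
  obtain ⟨ρ, -, hρ⟩ := (SmoothBumpFunction.nhds_basis_tsupport (I := 𝓘(ℝ, E)) y).mem_iff.1
    (chart_source_mem_nhds hy)
  refine ⟨fun z ↦ ρ z • coordField p w z, ?_, ?_⟩
  · filter_upwards [ρ.eventuallyEq_one] with z hz
    rw [hz]; simp
  · intro z
    by_cases hz : z ∈ tsupport ρ
    · have := contMDiffAt_coordField (hρ hz) w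
      rw [contMDiffAt_section_iff_coord (hρ hz) le_rfl] at this ⊢
      simp only [map_smul]
      exact (ρ.contMDiff z).smul this
    · have h0 : ∀ᶠ x in 𝓝 z, ρ x = 0 := by
        filter_upwards [(isClosed_tsupport ρ).isOpen_compl.mem_nhds hz] with x hx
        exact image_eq_zero_of_notMem_tsupport hx
      rw [contMDiffAt_section_iff_coord (mem_chart_source E z) le_rfl]
      refine (contMDiffAt_const (c := (0 : E))).congr_of_eventuallyEq ?_
      filter_upwards [h0] with x hx
      rw [hx, zero_smul, map_zero]

theorem contMDiffAt_cov_coordField [T2Space M]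
    (hcov : CovariantDerivative.ContMDiffCovariantDerivative cov ∞)
    (hy : y ∈ (chartAt E p).source) (w v : E) :
    ContMDiffAt 𝓘(ℝ, E) (𝓘(ℝ, E).tangent) ∞
      (fun y ↦ (⟨y, cov (coordField p w) y (coordField p v y)⟩ : TangentBundle 𝓘(ℝ, E) M)) y := by
  obtain ⟨Z, hZ, hZs⟩ := exists_eventuallyEq_contMDiff hy w
  have h1 := hcov.contMDiff.contMDiff (σ := Z) (by simpa using hZs.contMDiffOn)
  have h2 := (h1.contMDiffAt Filter.univ_mem).clm_bundle_apply (contMDiffAt_coordField hy v)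
  refine h2.congr_of_eventuallyEq ?_
  filter_upwards [hZ.eventually_nhds, chart_source_mem_nhds hy] with z hz hzs
  rw [cov_congr cov (mdifferentiableAt_coordField hzs w) hz]

-- In finite dimension an operator-valued map is a finite sum of rank-one operators built from its
-- values on a basis, so smoothness can be tested vector by vector.
variable {cov} in
theorem contMDiffAt_clm_of_apply {F G : Type*} [NormedAddCommGroup F] [NormedSpace ℝ F]
    [FiniteDimensional ℝ F] [NormedAddCommGroup G] [NormedSpace ℝ G] {L : E → F →L[ℝ] G} {z : E}
    (h : ∀ w, ContDiffAt ℝ ∞ (fun z ↦ L z w) z) : ContDiffAt ℝ ∞ L z := by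
  let b := Module.finBasis ℝ F
  have : L = fun z ↦ ∑ i, ContinuousLinearMap.smulRightL ℝ F G
      (LinearMap.toContinuousLinearMap (b.coord i)) (L z (b i)) := by
    funext z; ext w
    simp only [sum_apply]
    conv_lhs => rw [← b.sum_repr w, map_sum]
    simp
  rw [this]
  exact ContDiffAt.sum fun i _ ↦
    (ContinuousLinearMap.contDiff _).contDiffAt.comp z (h (b i))

theorem contMDiffAt_christoffel [T2Space M]
    (hcov : CovariantDerivative.ContMDiffCovariantDerivative cov ∞)
    {z : E} (hz : z ∈ (extChartAt 𝓘(ℝ, E) p).target) :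
    ContDiffAt ℝ ∞ (fun z ↦ christoffel cov p ((extChartAt 𝓘(ℝ, E) p).symm z)) z := by
  refine contMDiffAt_clm_of_apply fun w ↦ contMDiffAt_clm_of_apply fun v ↦ ?_
  have hy := extChartAt_symm_mem hz
  refine contDiffAt_comp_extChartAt_symm
    (h := fun y ↦ christoffel cov p y w v) hz ?_
  refine ((contMDiffAt_section_iff_coord hy le_rfl).1
    (contMDiffAt_cov_coordField cov hcov hy w v)).congr_of_eventuallyEq ?_
  filter_upwards [chart_source_mem_nhds hy] with x hx
  rw [christoffel_apply cov hx, ofCoord_apply hx]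

theorem cov_sum {ι : Type*} (s : Finset ι) {X : ι → (y : M) → TangentSpace 𝓘(ℝ, E) y}
    (hX : ∀ i, MDifferentiableAt 𝓘(ℝ, E) (𝓘(ℝ, E).tangent)
      (fun y ↦ (⟨y, X i y⟩ : TangentBundle 𝓘(ℝ, E) M)) y) :
    cov (∑ i ∈ s, X i) y = ∑ i ∈ s, cov (X i) y := by
  classical
  have hd : ∀ s : Finset ι, MDifferentiableAt 𝓘(ℝ, E) (𝓘(ℝ, E).tangent)
      (fun y ↦ (⟨y, (∑ i ∈ s, X i) y⟩ : TangentBundle 𝓘(ℝ, E) M)) y := fun s ↦ by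
    simpa only [Finset.sum_apply] using MDifferentiableAt.sum_section (s := s) fun i _ ↦ hX i
  induction s using Finset.induction_on with
  | empty => simp
  | insert i s hi ih => rw [Finset.sum_insert hi, Finset.sum_insert hi, cov_add cov (hX i) (hd s), ih]

/-- The covariant derivative of a vector field in the chart at `p`. -/
theorem toCoord_cov (hy : y ∈ (chartAt E p).source)
    (hX : MDifferentiableAt 𝓘(ℝ, E) (𝓘(ℝ, E).tangent)
      (fun y ↦ (⟨y, X y⟩ : TangentBundle 𝓘(ℝ, E) M)) y) (v : TangentSpace 𝓘(ℝ, E) y) :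
    toCoord p y (cov X y v) =
      fderiv ℝ (fun z ↦ toCoord p ((extChartAt 𝓘(ℝ, E) p).symm z)
        (X ((extChartAt 𝓘(ℝ, E) p).symm z))) (extChartAt 𝓘(ℝ, E) p y) (toCoord p y v)
      + christoffel cov p y (toCoord p y (X y)) (toCoord p y v) := by
  let b := Module.finBasis ℝ E
  let C : Fin (Module.finrank ℝ E) → E →L[ℝ] ℝ := fun i ↦ LinearMap.toContinuousLinearMap (b.coord i)
  have hb : ∀ w, ∑ i, C i w • b i = w := fun w ↦ b.sum_repr w
  have hXc := (mdifferentiableAt_section_iff_coord hy).1 hX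
  have hc : ∀ i, MDifferentiableAt 𝓘(ℝ, E) 𝓘(ℝ, ℝ) (fun y ↦ C i (toCoord p y (X y))) y := fun i ↦
    (C i).differentiableAt.mdifferentiableAt.comp y hXc
  have hcs : ∀ i, MDifferentiableAt 𝓘(ℝ, E) (𝓘(ℝ, E).tangent) (fun z ↦
      (⟨z, ((fun y ↦ C i (toCoord p y (X y))) • coordField p (b i)) z⟩ :
        TangentBundle 𝓘(ℝ, E) M)) y := fun i ↦ by
    rw [mdifferentiableAt_section_iff_coord hy]
    simp only [Pi.smul_apply', map_smul]
    exact (hc i).smul ((mdifferentiableAt_section_iff_coord hy).1 (mdifferentiableAt_coordField hy _))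
  -- Near `y` the field is `∑ X^i e_i`; the Leibniz rule then produces the derivative term and the
  -- Christoffel term.
  have e1 : cov X y = cov (∑ i, (fun y ↦ C i (toCoord p y (X y))) • coordField p (b i)) y := by
    refine cov_congr cov hX ?_
    filter_upwards [chart_source_mem_nhds hy] with z hz
    refine toCoord_injective hz ?_
    simp only [Finset.sum_apply, map_sum, Pi.smul_apply', map_smul, toCoord_coordField hz, hb]
  rw [e1, cov_sum cov _ hcs, sum_apply, map_sum]
  simp only [cov_smul cov (mdifferentiableAt_coordField hy _) (hc _), map_add, map_smul,
    toCoord_coordField hy, Finset.sum_add_distrib]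
  rw [add_comm]
  congr 1
  · have hd := differentiableAt_comp_extChartAt_symm hy hXc
    rw [← hb (fderiv ℝ _ _ _)]
    refine Finset.sum_congr rfl fun i _ ↦ ?_
    rw [mvfderiv_eq_fderiv hy (hc i)]
    congr 1
    exact congrArg (fun L : E →L[ℝ] ℝ ↦ L (toCoord p y v)) ((C i).hasFDerivAt.comp _ hd.hasFDerivAt).fderiv
  · conv_rhs => rw [← hb (toCoord p y (X y)), map_sum, sum_apply]
    refine Finset.sum_congr rfl fun i _ ↦ ?_
    rw [map_smul, smul_apply, christoffel_apply cov hy, ofCoord_toCoord hy]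

end Christoffel

/-! ### The Levi-Civita connection, the metric and the curvature read in a chart. -/

section LocalData

variable {E : Type*} [NormedAddCommGroup E] [NormedSpace ℝ E] [FiniteDimensional ℝ E]
  {M : Type*} [TopologicalSpace M] [ChartedSpace E M] [IsManifold 𝓘(ℝ, E) ∞ M]
  {p y : M} {X Y : (y : M) → TangentSpace 𝓘(ℝ, E) y}

theorem mlieBracket_eq_lieBracket (V W : (x : E) → TangentSpace 𝓘(ℝ, E) x) :
    VectorField.mlieBracket 𝓘(ℝ, E) V W = VectorField.lieBracket ℝ V W := by
  rw [← VectorField.mlieBracketWithin_univ, VectorField.mlieBracketWithin_eq_lieBracketWithin]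
  exact VectorField.lieBracketWithin_univ

theorem mlieBracket_const (u v : E) (z : E) :
    VectorField.mlieBracket 𝓘(ℝ, E) (fun x ↦ (u : TangentSpace 𝓘(ℝ, E) x))
      (fun x ↦ (v : TangentSpace 𝓘(ℝ, E) x)) z = 0 := by
  refine (congrFun (mlieBracket_eq_lieBracket _ _) z).trans ?_
  change VectorField.lieBracket ℝ (fun _ : E ↦ u) (fun _ ↦ v) z = 0
  simp [VectorField.lieBracket]

theorem coordField_eventuallyEq (hy : y ∈ (chartAt E p).source) (w : E) :
    coordField p w =ᶠ[𝓝 y] VectorField.mpullback 𝓘(ℝ, E) 𝓘(ℝ, E)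
      (extChartAt 𝓘(ℝ, E) p) (fun x ↦ (w : TangentSpace 𝓘(ℝ, E) x)) := by
  filter_upwards [chart_source_mem_nhds hy] with z hz
  have hi : (mfderiv 𝓘(ℝ, E) 𝓘(ℝ, E) (extChartAt 𝓘(ℝ, E) p) z).IsInvertible :=
    isInvertible_mfderiv_extChartAt (by simpa using hz)
  refine toCoord_injective hz ?_
  rw [toCoord_coordField hz, toCoord_eq_mfderiv hz]
  exact (hi.self_apply_inverse w).symm

/-- Coordinate fields are pullbacks of constant fields under the chart, and brackets commute with
pullbacks. -/
theorem mlieBracket_coordField (hy : y ∈ (chartAt E p).source) (u v : E) :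
    VectorField.mlieBracket 𝓘(ℝ, E) (coordField p u) (coordField p v) y = 0 := by
  have : IsManifold 𝓘(ℝ, E) (minSmoothness ℝ 2) M := IsManifold.of_le (n := ∞) (by
    simp only [minSmoothness_of_isRCLikeNormedField]
    simpa using WithTop.coe_le_coe.2 (le_top : (2 : ℕ∞) ≤ ⊤))
  rw [(coordField_eventuallyEq hy u).mlieBracket_vectorField_eq (coordField_eventuallyEq hy v)]
  have hd : ∀ w : E, MDifferentiableAt 𝓘(ℝ, E) (𝓘(ℝ, E).tangent)
      (fun z : E ↦ (⟨z, w⟩ : TangentBundle 𝓘(ℝ, E) E)) (extChartAt 𝓘(ℝ, E) p y) := fun w ↦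
    (contMDiffAt_vectorSpace_iff_contDiffAt (n := 1) (V := fun x ↦ (w : TangentSpace 𝓘(ℝ, E) x))|>.2
      contDiffAt_const).mdifferentiableAt (by simp)
  rw [← VectorField.mpullback_mlieBracket (n := ∞) (hd u) (hd v)
    (contMDiffAt_extChartAt_of_mem hy) (by
    simp only [minSmoothness_of_isRCLikeNormedField]
    simpa using WithTop.coe_le_coe.2 (le_top : (2 : ℕ∞) ≤ ⊤)), VectorField.mpullback_apply]
  erw [mlieBracket_const u v]
  exact map_zero _

/-- The components of a vector field in the chart at `p`. -/
def localVec (p : M) (X : (y : M) → TangentSpace 𝓘(ℝ, E) y) (z : E) : E :=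
  toCoord p ((extChartAt 𝓘(ℝ, E) p).symm z) (X ((extChartAt 𝓘(ℝ, E) p).symm z))

/-- The components of a field of endomorphisms in the chart at `p`. -/
def localEnd (p : M) (φ : (y : M) → TangentSpace 𝓘(ℝ, E) y →L[ℝ] TangentSpace 𝓘(ℝ, E) y)
    (z : E) : E →L[ℝ] E :=
  (toCoord p ((extChartAt 𝓘(ℝ, E) p).symm z)).comp
    ((φ ((extChartAt 𝓘(ℝ, E) p).symm z)).comp (ofCoord p ((extChartAt 𝓘(ℝ, E) p).symm z)))

/-- The Christoffel symbols in the chart at `p`. -/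
def localGamma (cov : AffineConnection E M) (p : M) (z : E) : E →L[ℝ] E →L[ℝ] E :=
  christoffel cov p ((extChartAt 𝓘(ℝ, E) p).symm z)

variable (cov : AffineConnection E M)

theorem toCoord_cov' (hy : y ∈ (chartAt E p).source)
    (hX : MDifferentiableAt 𝓘(ℝ, E) (𝓘(ℝ, E).tangent)
      (fun y ↦ (⟨y, X y⟩ : TangentBundle 𝓘(ℝ, E) M)) y) (v : TangentSpace 𝓘(ℝ, E) y) :
    toCoord p y (cov X y v) =
      fderiv ℝ (localVec p X) (extChartAt 𝓘(ℝ, E) p y) (toCoord p y v)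
      + localGamma cov p (extChartAt 𝓘(ℝ, E) p y) (toCoord p y (X y)) (toCoord p y v) := by
  rw [toCoord_cov cov hy hX, localGamma, extChartAt_symm_apply hy]
  rfl

theorem localGamma_apply (hy : y ∈ (chartAt E p).source) (w v : E) :
    localGamma cov p (extChartAt 𝓘(ℝ, E) p y) w v =
      toCoord p y (cov (coordField p w) y (coordField p v y)) := by
  rw [localGamma, extChartAt_symm_apply hy, christoffel_apply cov hy, ofCoord_apply hy]

theorem contDiffAt_localVec {z : E} (hz : z ∈ (extChartAt 𝓘(ℝ, E) p).target)
    (hX : ContMDiffAt 𝓘(ℝ, E) (𝓘(ℝ, E).tangent) ∞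
      (fun y ↦ (⟨y, X y⟩ : TangentBundle 𝓘(ℝ, E) M)) ((extChartAt 𝓘(ℝ, E) p).symm z)) :
    ContDiffAt ℝ ∞ (localVec p X) z :=
  contDiffAt_comp_extChartAt_symm (h := fun y ↦ toCoord p y (X y)) hz
    ((contMDiffAt_section_iff_coord (extChartAt_symm_mem hz) le_rfl).1 hX)

/-- At the centre of the chart the fields used in `curvature` are coordinate fields: the bracket
term vanishes and only `∂Γ` and `ΓΓ` remain. -/
theorem toCoord_curvature [T2Space M]
    (hcov : CovariantDerivative.ContMDiffCovariantDerivative cov ∞)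
    (u v w : TangentSpace 𝓘(ℝ, E) p) :
    toCoord p p (curvature cov p u v w) = curv (localGamma cov p) (extChartAt 𝓘(ℝ, E) p p)
      (toCoord p p u) (toCoord p p v) (toCoord p p w) := by
  have hp : p ∈ (chartAt E p).source := mem_chart_source E p
  have hΓ : DifferentiableAt ℝ (localGamma cov p) (extChartAt 𝓘(ℝ, E) p p) :=
    (contMDiffAt_christoffel cov hcov (extChartAt_mem_target hp)).differentiableAt (by simp)
  have key : ∀ a b d : TangentSpace 𝓘(ℝ, E) p,
      toCoord p p (cov (fun y ↦ cov (coordField p (toCoord p p a)) y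
        (coordField p (toCoord p p b) y)) p d) =
      fderiv ℝ (localGamma cov p) (extChartAt 𝓘(ℝ, E) p p) (toCoord p p d) (toCoord p p a)
        (toCoord p p b) + localGamma cov p (extChartAt 𝓘(ℝ, E) p p)
        (localGamma cov p (extChartAt 𝓘(ℝ, E) p p) (toCoord p p a) (toCoord p p b))
        (toCoord p p d) := fun a b d ↦ by
    rw [toCoord_cov' cov hp ((contMDiffAt_cov_coordField cov hcov hp _ _).mdifferentiableAt
      (by simp)), localGamma_apply cov hp (toCoord p p a)]
    congr 1
    have e : localVec p (fun y ↦ cov (coordField p (toCoord p p a)) y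
        (coordField p (toCoord p p b) y)) =ᶠ[𝓝 (extChartAt 𝓘(ℝ, E) p p)]
        fun z ↦ localGamma cov p z (toCoord p p a) (toCoord p p b) := by
      filter_upwards [(isOpen_extChartAt_target p).mem_nhds (extChartAt_mem_target hp)] with z hz
      have := localGamma_apply cov (extChartAt_symm_mem hz) (toCoord p p a) (toCoord p p b)
      rw [(extChartAt 𝓘(ℝ, E) p).right_inv hz] at this
      rw [this]; rfl
    rw [e.fderiv_eq]
    have h1 := ((hΓ.hasFDerivAt.clm_apply (hasFDerivAt_const (toCoord p p a) _)).clm_apply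
      (hasFDerivAt_const (toCoord p p b) _)).fderiv
    rw [h1]
    simp
  have h0 : VectorField.mlieBracket 𝓘(ℝ, E) (constField u) (constField v) p = 0 := by
    rw [constField_eq, constField_eq, mlieBracket_coordField hp]
  rw [curvature, h0, map_zero, sub_zero, map_sub]
  simp only [constField_eq]
  rw [key, key, curv]
  abel

section Metric

variable [RiemannianBundle (fun x : M ↦ TangentSpace 𝓘(ℝ, E) x)]
  [IsContMDiffRiemannianBundle 𝓘(ℝ, E) ∞ E (fun x : M ↦ TangentSpace 𝓘(ℝ, E) x)]

/-- The metric coefficients in the chart at `p`. -/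
def localMetric (p : M) (z : E) : E →L[ℝ] E →L[ℝ] ℝ :=
  (innerSL ℝ (E := TangentSpace 𝓘(ℝ, E) ((extChartAt 𝓘(ℝ, E) p).symm z))).bilinearComp
    (ofCoord p ((extChartAt 𝓘(ℝ, E) p).symm z)) (ofCoord p ((extChartAt 𝓘(ℝ, E) p).symm z))

theorem localMetric_apply (z a b : E) : localMetric p z a b =
    inner ℝ (ofCoord p ((extChartAt 𝓘(ℝ, E) p).symm z) a)
      (ofCoord p ((extChartAt 𝓘(ℝ, E) p).symm z) b) := rfl

theorem localMetric_extChartAt (hy : y ∈ (chartAt E p).source) (v w : TangentSpace 𝓘(ℝ, E) y) :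
    localMetric p (extChartAt 𝓘(ℝ, E) p y) (toCoord p y v) (toCoord p y w) = inner ℝ v w := by
  rw [localMetric_apply, extChartAt_symm_apply hy, ofCoord_toCoord hy, ofCoord_toCoord hy]

theorem contMDiffAt_inner
    (hX : ContMDiffAt 𝓘(ℝ, E) (𝓘(ℝ, E).tangent) ∞
      (fun y ↦ (⟨y, X y⟩ : TangentBundle 𝓘(ℝ, E) M)) y)
    (hY : ContMDiffAt 𝓘(ℝ, E) (𝓘(ℝ, E).tangent) ∞
      (fun y ↦ (⟨y, Y y⟩ : TangentBundle 𝓘(ℝ, E) M)) y) :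
    ContMDiffAt 𝓘(ℝ, E) 𝓘(ℝ, ℝ) ∞ (fun y ↦ (inner ℝ (X y) (Y y) : ℝ)) y :=
  ContMDiffAt.inner_bundle (E := fun x : M ↦ TangentSpace 𝓘(ℝ, E) x) hX hY

theorem contDiffAt_localMetric {z : E} (hz : z ∈ (extChartAt 𝓘(ℝ, E) p).target) :
    ContDiffAt ℝ ∞ (localMetric (E := E) p) z := by
  have hy := extChartAt_symm_mem hz
  refine contMDiffAt_clm_of_apply fun w ↦ contMDiffAt_clm_of_apply fun v ↦ ?_
  refine (contDiffAt_comp_extChartAt_symm (h := fun y ↦ inner ℝ (coordField p w y)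
    (coordField p v y)) hz (contMDiffAt_inner (contMDiffAt_coordField hy w)
      (contMDiffAt_coordField hy v))).congr_of_eventuallyEq ?_
  filter_upwards [(isOpen_extChartAt_target p).mem_nhds hz] with x hx
  rw [localMetric_apply, ofCoord_apply (extChartAt_symm_mem hx),
    ofCoord_apply (extChartAt_symm_mem hx)]

variable {cov}

theorem IsLeviCivita.mlieBracket_eq (h : IsLeviCivita cov)
    (hX : MDifferentiableAt 𝓘(ℝ, E) (𝓘(ℝ, E).tangent)
      (fun y ↦ (⟨y, X y⟩ : TangentBundle 𝓘(ℝ, E) M)) y)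
    (hY : MDifferentiableAt 𝓘(ℝ, E) (𝓘(ℝ, E).tangent)
      (fun y ↦ (⟨y, Y y⟩ : TangentBundle 𝓘(ℝ, E) M)) y) :
    VectorField.mlieBracket 𝓘(ℝ, E) X Y y = cov Y y (X y) - cov X y (Y y) :=
  (CovariantDerivative.torsion_eq_zero_iff cov |>.1 h.torsion_free hX hY).symm

/-- The Levi-Civita connection in the chart at `p`. -/
theorem IsLeviCivita.isLocalLeviCivita [T2Space M] (h : IsLeviCivita cov) (p : M) :
    IsLocalLeviCivita (extChartAt 𝓘(ℝ, E) p).target (localMetric p) (localGamma cov p) where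
  isOpen := isOpen_extChartAt_target p
  smooth_g z hz := contDiffAt_localMetric hz
  smooth_Γ z hz := contMDiffAt_christoffel cov h.smooth hz
  g_symm z hz a b := by rw [localMetric_apply, localMetric_apply, real_inner_comm]
  Γ_symm z hz a b := by
    have hy := extChartAt_symm_mem hz
    have e := h.mlieBracket_eq (mdifferentiableAt_coordField hy a) (mdifferentiableAt_coordField hy b)
    rw [mlieBracket_coordField hy, eq_comm, sub_eq_zero] at e
    have h1 := localGamma_apply cov hy a b
    have h2 := localGamma_apply cov hy b a
    rw [(extChartAt 𝓘(ℝ, E) p).right_inv hz] at h1 h2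
    rw [h1, h2, e]
  compat z hz v a b := by
    have hy := extChartAt_symm_mem hz
    have h1 := h.metric _ (coordField p a) (coordField p b)
      (coordField p v ((extChartAt 𝓘(ℝ, E) p).symm z))
      (mdifferentiableAt_coordField hy a) (mdifferentiableAt_coordField hy b)
    rw [mvfderiv_eq_fderiv hy ((contMDiffAt_inner (contMDiffAt_coordField hy a)
      (contMDiffAt_coordField hy b)).mdifferentiableAt (by simp)), toCoord_coordField hy,
      ← localMetric_extChartAt hy, ← localMetric_extChartAt hy, ← localGamma_apply cov hy,
      ← localGamma_apply cov hy, toCoord_coordField hy, toCoord_coordField hy,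
      (extChartAt 𝓘(ℝ, E) p).right_inv hz] at h1
    rw [← h1]
    have e : (fun z ↦ inner ℝ (coordField p a ((extChartAt 𝓘(ℝ, E) p).symm z))
        (coordField p b ((extChartAt 𝓘(ℝ, E) p).symm z))) =ᶠ[𝓝 z]
        fun z ↦ localMetric p z a b := by
      filter_upwards [(isOpen_extChartAt_target p).mem_nhds hz] with x hx
      rw [localMetric_apply, ofCoord_apply (extChartAt_symm_mem hx),
        ofCoord_apply (extChartAt_symm_mem hx)]
    rw [e.fderiv_eq]
    have h2 := (((contDiffAt_localMetric hz).differentiableAt (by simp)).hasFDerivAt.clm_apply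
      (hasFDerivAt_const a z)).clm_apply (hasFDerivAt_const b z)
    rw [h2.fderiv]
    simp

end Metric

end LocalData

/-! ### The `S`-structure read in a chart. -/

section LocalSData

variable {E : Type*} [NormedAddCommGroup E] [NormedSpace ℝ E] [FiniteDimensional ℝ E]
  {M : Type*} [TopologicalSpace M] [ChartedSpace E M] [IsManifold 𝓘(ℝ, E) ∞ M]
  [RiemannianBundle (fun x : M ↦ TangentSpace 𝓘(ℝ, E) x)]
  [IsContMDiffRiemannianBundle 𝓘(ℝ, E) ∞ E (fun x : M ↦ TangentSpace 𝓘(ℝ, E) x)]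
  {p y : M} {X Y : (y : M) → TangentSpace 𝓘(ℝ, E) y} {cov : AffineConnection E M} {m s : ℕ}

theorem localMetric_coord {z : E} (hz : z ∈ (extChartAt 𝓘(ℝ, E) p).target)
    (v w : TangentSpace 𝓘(ℝ, E) ((extChartAt 𝓘(ℝ, E) p).symm z)) :
    localMetric p z (toCoord p _ v) (toCoord p _ w) = inner ℝ v w := by
  rw [localMetric_apply, ofCoord_toCoord (extChartAt_symm_mem hz),
    ofCoord_toCoord (extChartAt_symm_mem hz)]

theorem localEnd_coord {φ : (y : M) → TangentSpace 𝓘(ℝ, E) y →L[ℝ] TangentSpace 𝓘(ℝ, E) y}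
    {z : E} (hz : z ∈ (extChartAt 𝓘(ℝ, E) p).target)
    (v : TangentSpace 𝓘(ℝ, E) ((extChartAt 𝓘(ℝ, E) p).symm z)) :
    localEnd p φ z (toCoord p _ v) = toCoord p _ (φ _ v) := by
  simp only [localEnd, ContinuousLinearMap.comp_apply, ofCoord_toCoord (extChartAt_symm_mem hz)]

theorem localEnd_apply {φ : (y : M) → TangentSpace 𝓘(ℝ, E) y →L[ℝ] TangentSpace 𝓘(ℝ, E) y}
    {z : E} (hz : z ∈ (extChartAt 𝓘(ℝ, E) p).target) (v : E) :
    localEnd p φ z v = toCoord p _ (φ _ (coordField p v ((extChartAt 𝓘(ℝ, E) p).symm z))) := by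
  simp only [localEnd, ContinuousLinearMap.comp_apply, ofCoord_apply (extChartAt_symm_mem hz)]

theorem exists_toCoord_eq {z : E} (hz : z ∈ (extChartAt 𝓘(ℝ, E) p).target) (v : E) :
    ∃ w : TangentSpace 𝓘(ℝ, E) ((extChartAt 𝓘(ℝ, E) p).symm z), toCoord p _ w = v :=
  ⟨_, toCoord_ofCoord (extChartAt_symm_mem hz) v⟩

theorem toCoord_cov_target (cov : AffineConnection E M) {z : E}
    (hz : z ∈ (extChartAt 𝓘(ℝ, E) p).target)
    (hX : MDifferentiableAt 𝓘(ℝ, E) (𝓘(ℝ, E).tangent)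
      (fun y ↦ (⟨y, X y⟩ : TangentBundle 𝓘(ℝ, E) M)) ((extChartAt 𝓘(ℝ, E) p).symm z))
    (v : TangentSpace 𝓘(ℝ, E) ((extChartAt 𝓘(ℝ, E) p).symm z)) :
    toCoord p _ (cov X ((extChartAt 𝓘(ℝ, E) p).symm z) v) =
      fderiv ℝ (localVec p X) z (toCoord p _ v)
      + localGamma cov p z (localVec p X z) (toCoord p _ v) := by
  have := toCoord_cov' cov (extChartAt_symm_mem hz) hX v
  rwa [(extChartAt 𝓘(ℝ, E) p).right_inv hz] at this

namespace SStructure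

variable (S : SStructure E M m s)

theorem contMDiffAt_φ_apply (hX : ContMDiffAt 𝓘(ℝ, E) (𝓘(ℝ, E).tangent) ∞
      (fun y ↦ (⟨y, X y⟩ : TangentBundle 𝓘(ℝ, E) M)) y) :
    ContMDiffAt 𝓘(ℝ, E) (𝓘(ℝ, E).tangent) ∞
      (fun y ↦ (⟨y, S.φ y (X y)⟩ : TangentBundle 𝓘(ℝ, E) M)) y :=
  S.smooth_φ.contMDiffAt.clm_bundle_apply hX

theorem contDiffAt_localEnd {z : E} (hz : z ∈ (extChartAt 𝓘(ℝ, E) p).target) :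
    ContDiffAt ℝ ∞ (localEnd p S.φ) z := by
  have hy := extChartAt_symm_mem hz
  refine contMDiffAt_clm_of_apply fun w ↦ ?_
  refine (contDiffAt_localVec (p := p) hz
    (S.contMDiffAt_φ_apply (contMDiffAt_coordField hy w))).congr_of_eventuallyEq ?_
  filter_upwards [(isOpen_extChartAt_target p).mem_nhds hz] with x hx
  rw [localEnd_apply hx]; rfl

theorem isFramedMetric {z : E} (hz : z ∈ (extChartAt 𝓘(ℝ, E) p).target) :
    IsFramedMetric (localMetric p z) (localEnd p S.φ z) (fun α ↦ localVec p (S.ξ α) z) where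
  symm a b := by rw [localMetric_apply, localMetric_apply, real_inner_comm]
  pos a ha := by
    rw [localMetric_apply]
    refine real_inner_self_pos.2 fun h0 ↦ ha ?_
    rw [← toCoord_ofCoord (extChartAt_symm_mem hz) a, h0, map_zero]
  φ_sq v := by
    obtain ⟨v, rfl⟩ := exists_toCoord_eq hz v
    simp only [localEnd_coord hz, S.φ_sq, localVec, localMetric_coord hz, map_add, map_neg, map_sum,
      map_smul, S.η_eq]
  η_φ α v := by
    obtain ⟨v, rfl⟩ := exists_toCoord_eq hz v
    rw [localEnd_coord hz, localVec, localMetric_coord hz, ← S.η_eq, S.η_φ]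
  φ_ξ α := by rw [localVec, localEnd_coord hz, S.φ_ξ, map_zero]
  η_ξ α β := by rw [localVec, localVec, localMetric_coord hz, ← S.η_eq, S.η_ξ]
  metric v w := by
    obtain ⟨v, rfl⟩ := exists_toCoord_eq hz v
    obtain ⟨w, rfl⟩ := exists_toCoord_eq hz w
    simp only [localEnd_coord hz, localVec, localMetric_coord hz, ← S.η_eq]
    exact S.metric_eq _ v w

variable {S}

/-- By torsion-freeness the derivatives of `X` and `Y` cancel against the bracket, so that only
`∇ξ_α` survives. -/
theorem two_mul_extDerivForm (hcov : IsLeviCivita cov)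
    (hX : ContMDiffAt 𝓘(ℝ, E) (𝓘(ℝ, E).tangent) ∞
      (fun y ↦ (⟨y, X y⟩ : TangentBundle 𝓘(ℝ, E) M)) y)
    (hY : ContMDiffAt 𝓘(ℝ, E) (𝓘(ℝ, E).tangent) ∞
      (fun y ↦ (⟨y, Y y⟩ : TangentBundle 𝓘(ℝ, E) M)) y) (α : Fin s) :
    2 * extDerivForm (S.η α) X Y y = inner ℝ (Y y) (cov (S.ξ α) y (X y))
      - inner ℝ (X y) (cov (S.ξ α) y (Y y)) := by
  have hξ := ((S.smooth_ξ α).contMDiffAt (x := y)).mdifferentiableAt (by simp)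
  have dX := hX.mdifferentiableAt (by simp)
  have dY := hY.mdifferentiableAt (by simp)
  have e1 := hcov.metric y Y (S.ξ α) (X y) dY hξ
  have e2 := hcov.metric y X (S.ξ α) (Y y) dX hξ
  simp only [extDerivForm, S.η_eq]
  rw [e1, e2, hcov.mlieBracket_eq dX dY, inner_sub_left]
  ring

theorem fderiv_localVec_φ {z : E} (hz : z ∈ (extChartAt 𝓘(ℝ, E) p).target) (v w : E) :
    fderiv ℝ (localVec p fun y ↦ S.φ y (coordField p v y)) z w =
      fderiv ℝ (localEnd p S.φ) z w v := by
  have e : (localVec p fun y ↦ S.φ y (coordField p v y)) =ᶠ[𝓝 z] fun z ↦ localEnd p S.φ z v := by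
    filter_upwards [(isOpen_extChartAt_target p).mem_nhds hz] with x hx
    rw [localEnd_apply hx]; rfl
  rw [e.fderiv_eq, (((S.contDiffAt_localEnd hz).differentiableAt (by simp)).hasFDerivAt.clm_apply
      (hasFDerivAt_const v z)).fderiv]
  simp

/-- An `S`-structure in the chart at `p`. -/
theorem isLocalSStructure [T2Space M] (hcov : IsLeviCivita cov) (p : M) :
    IsLocalSStructure (extChartAt 𝓘(ℝ, E) p).target (localMetric p) (localGamma cov p)
      (localEnd p S.φ) (fun α ↦ localVec p (S.ξ α)) where
  lc := hcov.isLocalLeviCivita p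
  smooth_φ z hz := S.contDiffAt_localEnd hz
  smooth_ξ α z hz := contDiffAt_localVec hz (S.smooth_ξ α).contMDiffAt
  framed z hz := S.isFramedMetric hz
  d_η z hz α u v := by
    have hy := extChartAt_symm_mem hz
    have h1 := two_mul_extDerivForm (S := S) hcov (contMDiffAt_coordField hy u)
      (contMDiffAt_coordField hy v) α
    have hξ := ((S.smooth_ξ α).contMDiffAt (x := (extChartAt 𝓘(ℝ, E) p).symm z)).mdifferentiableAt
      (by simp)
    rw [S.d_η α _ _ _ (contMDiffAt_coordField hy u) (contMDiffAt_coordField hy v)] at h1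
    simp only [← localMetric_coord hz, toCoord_cov_target cov hz hξ, toCoord_coordField hy,
      ← localEnd_coord hz] at h1
    rw [h1]
    rfl
  normal z hz u v := by
    have hy := extChartAt_symm_mem hz
    have cu := contMDiffAt_coordField hy u
    have cv := contMDiffAt_coordField hy v
    have cφu := S.contMDiffAt_φ_apply cu
    have cφv := S.contMDiffAt_φ_apply cv
    have du := cu.mdifferentiableAt (by simp)
    have dv := cv.mdifferentiableAt (by simp)
    have dφu := cφu.mdifferentiableAt (by simp)
    have dφv := cφv.mdifferentiableAt (by simp)
    have h1 := congrArg (toCoord p _) (S.normal _ _ _ cu cv)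
    have hΓ := (hcov.isLocalLeviCivita p).Γ_symm z hz
    have ec : ∀ w : E, fderiv ℝ (localVec p (coordField p w)) z = 0 := fun w ↦ by
      have e : localVec p (coordField p w) =ᶠ[𝓝 z] fun _ ↦ w := by
        filter_upwards [(isOpen_extChartAt_target p).mem_nhds hz] with x hx
        exact toCoord_coordField (extChartAt_symm_mem hx) w
      rw [e.fderiv_eq, fderiv_fun_const]; rfl
    have el : ∀ w : E, localVec p (coordField p w) z = w := fun w ↦ toCoord_coordField hy w
    have el' : ∀ w : E, localVec p (fun y ↦ S.φ y (coordField p w y)) z = localEnd p S.φ z w :=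
      fun w ↦ by rw [localEnd_apply hz]; rfl
    simp only [nijenhuis, S.d_η _ _ _ _ cu cv, hcov.mlieBracket_eq dφu dφv,
      hcov.mlieBracket_eq du dφv, hcov.mlieBracket_eq dφu dv, mlieBracket_coordField hy,
      map_zero, map_add, map_sub, map_neg, map_smul, map_sum,
      ← localEnd_coord (φ := S.φ) hz, toCoord_cov_target cov hz dφu, toCoord_cov_target cov hz dφv, toCoord_cov_target cov hz du,
      toCoord_cov_target cov hz dv, toCoord_coordField hy, ← localMetric_coord hz,
      fderiv_localVec_φ hz, ec, el, el', zero_apply] at h1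
    simp only [nablaEnd_apply]
    have e2 : ∀ α, toCoord p ((extChartAt 𝓘(ℝ, E) p).symm z) (S.ξ α _) = localVec p (S.ξ α) z :=
      fun α ↦ rfl
    simp only [e2] at h1
    rw [← h1, hΓ v (localEnd p S.φ z u), hΓ u (localEnd p S.φ z v), hΓ u v]
    simp only [map_sub, map_add]
    abel

/-- The curvature `R(T, N)T` of an `S`-space form. -/
theorem curvature_eq [T2Space M] (hs : 1 ≤ s) (hcov : IsLeviCivita cov) {c : ℝ}
    (hc : S.IsSpaceForm cov c) {x : M} {T N : TangentSpace 𝓘(ℝ, E) x}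
    (hN : ∀ α, inner ℝ N (S.ξ α x) = (0 : ℝ)) (hTN : inner ℝ T N = (0 : ℝ)) :
    curvature cov x T N T = -((((∑ α, inner ℝ T (S.ξ α x)) ^ 2
        + (c + 3 * s) / 4 * (inner ℝ T T - ∑ α, inner ℝ T (S.ξ α x) ^ 2)) • N)
        + (3 * ((c - s) / 4) * inner ℝ (S.φ x T) N) • S.φ x T) := by
  have : NeZero s := ⟨by omega⟩
  have hx : x ∈ (chartAt E x).source := mem_chart_source E x
  have hz := extChartAt_mem_target hx
  have h := isLocalSStructure (S := S) hcov x
  have hg := fun v w ↦ localMetric_extChartAt (y := x) hx v w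
  have hξ : ∀ α, localVec x (S.ξ α) (extChartAt 𝓘(ℝ, E) x x) = toCoord x x (S.ξ α x) := fun α ↦ by
    rw [localVec, extChartAt_symm_apply hx]
  have hφ : ∀ v, localEnd x S.φ (extChartAt 𝓘(ℝ, E) x x) (toCoord x x v) =
      toCoord x x (S.φ x v) := fun v ↦ by
    rw [localEnd, extChartAt_symm_apply hx]
    simp only [ContinuousLinearMap.comp_apply, ofCoord_toCoord hx]
  refine toCoord_injective hx ?_
  rw [toCoord_curvature cov hcov.smooth, h.curv_eq hz (c := c)]
  · simp only [hξ, hg, hφ, map_neg, map_add, map_smul]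
  · intro v hv
    obtain ⟨v, rfl⟩ : ∃ w, toCoord x x w = v := ⟨_, toCoord_ofCoord hx v⟩
    simp only [hξ, hg] at hv
    rw [hφ, ← toCoord_curvature cov hcov.smooth, hg, hg]
    by_cases h0 : v = 0
    · subst h0; simp
    have h1 := hc x v h0 hv
    have hvv : inner ℝ v (S.φ x v) = (0 : ℝ) := by
      have := (h.framed _ hz).self_φ (toCoord x x v)
      rwa [hφ, hg] at this
    have hnn : inner ℝ (S.φ x v) (S.φ x v) = (inner ℝ v v : ℝ) := by
      have := S.metric_eq x v v
      simp only [S.η_eq, hv, mul_zero, Finset.sum_const_zero, add_zero] at this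
      exact this.symm
    have hpos : (inner ℝ v v : ℝ) ≠ 0 := (real_inner_self_pos.2 h0).ne'
    rw [sectionalCurvature, hvv, hnn, div_eq_iff (by simpa using hpos)] at h1
    rw [h1]; ring
  · simpa only [hξ, hg] using hN
  · simpa only [hg] using hTN

end SStructure

end LocalSData

/-! ### Vector fields along curves; chart independence of the covariant derivative. -/

section Along

variable {E : Type*} [NormedAddCommGroup E] [NormedSpace ℝ E] [FiniteDimensional ℝ E]
  {M : Type*} [TopologicalSpace M] [ChartedSpace E M] [IsManifold 𝓘(ℝ, E) ∞ M]
  {p q : M} {γ : ℝ → M} {V W : (t : ℝ) → TangentSpace 𝓘(ℝ, E) (γ t)} {t : ℝ} {J : Set ℝ}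

/-- A curve in the chart at `p`. -/
def coordCurve (E : Type*) [NormedAddCommGroup E] [NormedSpace ℝ E] {M : Type*} [TopologicalSpace M]
    [ChartedSpace E M] (p : M) (γ : ℝ → M) (t : ℝ) : E :=
  extChartAt 𝓘(ℝ, E) p (γ t)

/-- The components of a vector field along a curve in the chart at `p`. -/
def coordAlong (p : M) (γ : ℝ → M) (V : (t : ℝ) → TangentSpace 𝓘(ℝ, E) (γ t)) (t : ℝ) : E :=
  toCoord p (γ t) (V t)

theorem contDiffAt_coordCurve (ht : γ t ∈ (chartAt E p).source)
    (hγ : ContMDiffAt 𝓘(ℝ, ℝ) 𝓘(ℝ, E) ∞ γ t) : ContDiffAt ℝ ∞ (coordCurve E p γ) t :=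
  ((contMDiffAt_extChartAt_of_mem ht).comp t hγ).contDiffAt

theorem eventually_mem_source (ht : γ t ∈ (chartAt E p).source) (hγ : ContinuousAt γ t) :
    ∀ᶠ τ in 𝓝 t, γ τ ∈ (chartAt E p).source :=
  hγ.eventually (chart_source_mem_nhds ht)

theorem toCoord_velocity (ht : γ t ∈ (chartAt E p).source)
    (hγ : MDifferentiableAt 𝓘(ℝ, ℝ) 𝓘(ℝ, E) γ t) :
    toCoord p (γ t) (velocity γ t) = fderiv ℝ (coordCurve E p γ) t 1 := by
  have h1 : mfderiv 𝓘(ℝ, ℝ) 𝓘(ℝ, E) (coordCurve E p γ) t =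
      (mfderiv 𝓘(ℝ, E) 𝓘(ℝ, E) (extChartAt 𝓘(ℝ, E) p) (γ t)).comp
        (mfderiv 𝓘(ℝ, ℝ) 𝓘(ℝ, E) γ t) :=
    mfderiv_comp t ((contMDiffAt_extChartAt_of_mem ht).mdifferentiableAt (by simp)) hγ
  rw [mfderiv_eq_fderiv] at h1
  rw [toCoord_eq_mfderiv ht, velocity]
  exact (congrArg (fun L : ℝ →L[ℝ] E ↦ L 1) h1).symm

theorem contMDiffAt_along_iff (ht : γ t ∈ (chartAt E p).source) :
    ContMDiffAt 𝓘(ℝ, ℝ) (𝓘(ℝ, E).tangent) ∞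
      (fun t ↦ (⟨γ t, V t⟩ : TangentBundle 𝓘(ℝ, E) M)) t ↔
    ContMDiffAt 𝓘(ℝ, ℝ) 𝓘(ℝ, E) ∞ γ t ∧ ContDiffAt ℝ ∞ (coordAlong p γ V) t := by
  rw [Trivialization.contMDiffAt_iff
    (e := trivializationAt E (fun z : M ↦ TangentSpace 𝓘(ℝ, E) z) p)
    (by rw [Trivialization.mem_source]; simpa using ht)]
  refine and_congr_right fun hγ ↦ ?_
  rw [← contMDiffAt_iff_contDiffAt]
  refine Filter.EventuallyEq.contMDiffAt_iff ?_
  filter_upwards [eventually_mem_source ht hγ.continuousAt] with τ hτ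
    using trivializationAt_snd hτ _

theorem SmoothAlong.contMDiffAt (hJ : IsOpen J) (hV : SmoothAlong γ J V) (ht : t ∈ J) :
    ContMDiffAt 𝓘(ℝ, ℝ) 𝓘(ℝ, E) ∞ γ t :=
  ((contMDiffAt_along_iff (mem_chart_source E (γ t))).1
    (ContMDiffOn.contMDiffAt hV (hJ.mem_nhds ht))).1

theorem SmoothAlong.contDiffAt (hJ : IsOpen J) (hV : SmoothAlong γ J V) (ht : t ∈ J)
    (hp : γ t ∈ (chartAt E p).source) : ContDiffAt ℝ ∞ (coordAlong p γ V) t :=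
  ((contMDiffAt_along_iff hp).1 (ContMDiffOn.contMDiffAt hV (hJ.mem_nhds ht))).2

theorem smoothAlong_of_forall (h : ∀ t ∈ J, ContMDiffAt 𝓘(ℝ, ℝ) 𝓘(ℝ, E) ∞ γ t ∧
    ContDiffAt ℝ ∞ (coordAlong (γ t) γ V) t) : SmoothAlong γ J V := fun t ht ↦
  ((contMDiffAt_along_iff (mem_chart_source E (γ t))).2 (h t ht)).contMDiffWithinAt

variable (cov : AffineConnection E M)

/-- The covariant derivative along a curve does not depend on the chart used to define it. -/
theorem covAlong_eq (ht : γ t ∈ (chartAt E p).source) (hγ : ContMDiffAt 𝓘(ℝ, ℝ) 𝓘(ℝ, E) ∞ γ t)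
    (hV : DifferentiableAt ℝ (coordAlong p γ V) t) :
    covAlong cov γ V t = ofCoord p (γ t) (deriv (coordAlong p γ V) t)
      + cov (coordField p (coordAlong p γ V t)) (γ t) (velocity γ t) := by
  set q := γ t with hq
  have hqq : γ t ∈ (chartAt E q).source := mem_chart_source E q
  have htarget := extChartAt_mem_target hqq
  -- The transition matrix from the frame of the chart at `p` to that of the chart at `q = γ t`. Its
  -- derivative along the curve compensates the change of the Christoffel term (`h6`).
  let C : E → E →L[ℝ] E := fun z ↦ (toCoord q ((extChartAt 𝓘(ℝ, E) q).symm z)).comp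
    (ofCoord p ((extChartAt 𝓘(ℝ, E) q).symm z))
  have hsrc : ∀ᶠ z in 𝓝 (extChartAt 𝓘(ℝ, E) q (γ t)),
      (extChartAt 𝓘(ℝ, E) q).symm z ∈ (chartAt E p).source := by
    refine (contMDiffAt_extChartAt_symm htarget).continuousAt.eventually ?_
    rw [extChartAt_symm_apply hqq]
    exact chart_source_mem_nhds ht
  have hCv : ∀ w, (fun z ↦ C z w) =ᶠ[𝓝 (extChartAt 𝓘(ℝ, E) q (γ t))]
      localVec q (coordField p w) := fun w ↦ by
    filter_upwards [hsrc] with z hz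
    simp only [C, ContinuousLinearMap.comp_apply, localVec, ofCoord_apply hz]
  have hC : ContDiffAt ℝ ∞ C (extChartAt 𝓘(ℝ, E) q (γ t)) := by
    refine contMDiffAt_clm_of_apply fun w ↦ ?_
    refine (contDiffAt_localVec htarget ?_).congr_of_eventuallyEq (hCv w)
    rw [extChartAt_symm_apply hqq]
    exact contMDiffAt_coordField ht w
  have hCd := hC.differentiableAt (by simp)
  have hx := (contDiffAt_coordCurve hqq hγ).differentiableAt (by simp)
  have e1 : coordAlong q γ V =ᶠ[𝓝 t]
      fun τ ↦ C (coordCurve E q γ τ) (coordAlong p γ V τ) := by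
    filter_upwards [eventually_mem_source ht hγ.continuousAt,
      eventually_mem_source hqq hγ.continuousAt] with τ h1 h2
    simp only [C, ContinuousLinearMap.comp_apply, coordCurve, coordAlong]
    rw [extChartAt_symm_apply h2, ofCoord_toCoord h1]
  have hd : HasDerivAt (coordAlong q γ V)
      (fderiv ℝ C (coordCurve E q γ t) (fderiv ℝ (coordCurve E q γ) t 1) (coordAlong p γ V t)
        + C (coordCurve E q γ t) (deriv (coordAlong p γ V) t)) t := by
    refine HasDerivAt.congr_of_eventuallyEq ?_ e1
    exact (HasFDerivAt.comp_hasDerivAt t (l := C) hCd.hasFDerivAt hx.hasFDerivAt.hasDerivAt).clm_apply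
      hV.hasDerivAt
  have e2 : (fun τ ↦ (trivializationAt E (fun z : M ↦ TangentSpace 𝓘(ℝ, E) z) q
      ⟨γ τ, V τ⟩).2) =ᶠ[𝓝 t] coordAlong q γ V := by
    filter_upwards [eventually_mem_source hqq hγ.continuousAt] with τ hτ
      using trivializationAt_snd hτ _
  have hmd := mdifferentiableAt_coordField (E := E) ht (coordAlong p γ V t)
  refine toCoord_injective hqq ?_
  rw [covAlong, e2.deriv_eq, hd.deriv, map_add, map_add]
  have h3 := toCoord_cov' cov hqq (X := coordField p (coordAlong p γ V t)) hmd (velocity γ t)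
  have h4 := toCoord_cov' cov hqq (X := constField (V t))
    (by rw [constField_eq]; exact mdifferentiableAt_coordField hqq _) (velocity γ t)
  rw [h3, h4]
  have h5 : fderiv ℝ (localVec q (constField (V t))) (extChartAt 𝓘(ℝ, E) q (γ t)) = 0 := by
    have e : localVec q (constField (V t)) =ᶠ[𝓝 (extChartAt 𝓘(ℝ, E) q (γ t))]
        fun _ ↦ toCoord q q (V t) := by
      filter_upwards [(isOpen_extChartAt_target q).mem_nhds htarget] with x hx
      rw [constField_eq]
      exact toCoord_coordField (extChartAt_symm_mem hx) _
    rw [e.fderiv_eq, fderiv_fun_const]; rfl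
  have h6 : fderiv ℝ (localVec q (coordField p (coordAlong p γ V t)))
      (extChartAt 𝓘(ℝ, E) q (γ t)) (fderiv ℝ (coordCurve E q γ) t 1) =
      fderiv ℝ C (coordCurve E q γ t) (fderiv ℝ (coordCurve E q γ) t 1) (coordAlong p γ V t) := by
    rw [← (hCv _).fderiv_eq, (hCd.hasFDerivAt.clm_apply
      (hasFDerivAt_const (coordAlong p γ V t) _)).fderiv]
    simp [coordCurve]
  have h7 : toCoord q (γ t) (velocity γ t) = fderiv ℝ (coordCurve E q γ) t 1 :=
    toCoord_velocity hqq (hγ.mdifferentiableAt (by simp))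
  have h8 : coordField p (coordAlong p γ V t) (γ t) = V t := coordField_toCoord ht _
  have h9 : constField (V t) (γ t) = V t := by rw [constField_eq]; exact coordField_toCoord hqq _
  have h10 : toCoord q (γ t) ((trivializationAt E (fun z : M ↦ TangentSpace 𝓘(ℝ, E) z) q).symm (γ t)
      (fderiv ℝ C (coordCurve E q γ t) (fderiv ℝ (coordCurve E q γ) t 1) (coordAlong p γ V t)
        + C (coordCurve E q γ t) (deriv (coordAlong p γ V) t))) =
      (fderiv ℝ C (coordCurve E q γ t) (fderiv ℝ (coordCurve E q γ) t 1) (coordAlong p γ V t)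
        + C (coordCurve E q γ t) (deriv (coordAlong p γ V) t)) := toCoord_coordField hqq _
  have h11 : C (coordCurve E q γ t) (deriv (coordAlong p γ V) t) =
      toCoord q (γ t) (ofCoord p (γ t) (deriv (coordAlong p γ V) t)) := by
    simp only [C, ContinuousLinearMap.comp_apply, coordCurve]
    rw [extChartAt_symm_apply hqq]
  rw [h10, h7, h6, h8, h9, h5, ← h11]
  simp only [zero_apply, zero_add]
  abel

end Along

/-! ### Calculus rules for the covariant derivative along a curve. -/

section AlongRules

variable {E : Type*} [NormedAddCommGroup E] [NormedSpace ℝ E] [FiniteDimensional ℝ E]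
  {M : Type*} [TopologicalSpace M] [ChartedSpace E M] [IsManifold 𝓘(ℝ, E) ∞ M]
  {p q : M} {γ : ℝ → M} {V W : (t : ℝ) → TangentSpace 𝓘(ℝ, E) (γ t)} {t : ℝ} {J : Set ℝ}
  {f : ℝ → ℝ} {X : (y : M) → TangentSpace 𝓘(ℝ, E) y} {cov : AffineConnection E M}

/-- `covAlong` is defined in the chart at `γ t`, which moves with `t`. A formula in one fixed chart
is what allows it to be differentiated again. -/
theorem toCoord_covAlong (ht : γ t ∈ (chartAt E p).source)
    (hγ : ContMDiffAt 𝓘(ℝ, ℝ) 𝓘(ℝ, E) ∞ γ t)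
    (hV : DifferentiableAt ℝ (coordAlong p γ V) t) :
    toCoord p (γ t) (covAlong cov γ V t) =
      covD (localGamma cov p) (coordCurve E p γ) (coordAlong p γ V) 1 t := by
  rw [covAlong_eq cov ht hγ hV, map_add, toCoord_ofCoord ht, covD, coordCurve,
    ← toCoord_velocity ht (hγ.mdifferentiableAt (by simp)), localGamma_apply cov ht,
    coordField_toCoord ht]
  simp

theorem coordAlong_covAlong (hJ : IsOpen J) (hV : SmoothAlong γ J V) (htJ : t ∈ J)
    (ht : γ t ∈ (chartAt E p).source) :
    coordAlong p γ (covAlong cov γ V) t =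
      covD (localGamma cov p) (coordCurve E p γ) (coordAlong p γ V) 1 t :=
  toCoord_covAlong ht (hV.contMDiffAt hJ htJ) ((hV.contDiffAt hJ htJ ht).differentiableAt (by simp))

theorem eventually_mem_source_and (hJ : IsOpen J) (hγ : ContMDiffAt 𝓘(ℝ, ℝ) 𝓘(ℝ, E) ∞ γ t)
    (htJ : t ∈ J) (ht : γ t ∈ (chartAt E p).source) :
    ∀ᶠ τ in 𝓝 t, τ ∈ J ∧ γ τ ∈ (chartAt E p).source :=
  (Filter.eventually_of_mem (hJ.mem_nhds htJ) fun _ h ↦ h).and (eventually_mem_source ht hγ.continuousAt)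

theorem coordAlong_covAlong_eventuallyEq (hJ : IsOpen J) (hV : SmoothAlong γ J V) (htJ : t ∈ J)
    (ht : γ t ∈ (chartAt E p).source) :
    coordAlong p γ (covAlong cov γ V) =ᶠ[𝓝 t]
      covD (localGamma cov p) (coordCurve E p γ) (coordAlong p γ V) 1 := by
  filter_upwards [eventually_mem_source_and hJ (hV.contMDiffAt hJ htJ) htJ ht] with τ hτ
    using coordAlong_covAlong hJ hV hτ.1 hτ.2

theorem SmoothAlong.covAlong [T2Space M]
    (hcov : CovariantDerivative.ContMDiffCovariantDerivative cov ∞) (hJ : IsOpen J)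
    (hV : SmoothAlong γ J V) : SmoothAlong γ J (covAlong cov γ V) := by
  refine smoothAlong_of_forall fun t ht ↦ ⟨hV.contMDiffAt hJ ht, ?_⟩
  have hs := mem_chart_source E (γ t)
  refine ContDiffAt.congr_of_eventuallyEq ?_ (coordAlong_covAlong_eventuallyEq hJ hV ht hs)
  exact ContDiffAt.covD (x := coordCurve E (γ t) γ) (contMDiffAt_christoffel cov hcov (extChartAt_mem_target hs))
    (contDiffAt_coordCurve hs (hV.contMDiffAt hJ ht)) (hV.contDiffAt hJ ht hs) 1

theorem coordAlong_velocity_eventuallyEq (hJ : IsOpen J)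
    (hγ : ContMDiffOn 𝓘(ℝ, ℝ) 𝓘(ℝ, E) ∞ γ J) (htJ : t ∈ J) (ht : γ t ∈ (chartAt E p).source) :
    coordAlong p γ (velocity γ) =ᶠ[𝓝 t] fun τ ↦ fderiv ℝ (coordCurve E p γ) τ 1 := by
  filter_upwards [eventually_mem_source_and (E := E) hJ (hγ.contMDiffAt (hJ.mem_nhds htJ)) htJ ht] with τ hτ
    using toCoord_velocity hτ.2 ((hγ.contMDiffAt (hJ.mem_nhds hτ.1)).mdifferentiableAt (by simp))

theorem smoothAlong_velocity (hJ : IsOpen J) (hγ : ContMDiffOn 𝓘(ℝ, ℝ) 𝓘(ℝ, E) ∞ γ J) :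
    SmoothAlong γ J (velocity (E := E) γ) := by
  refine smoothAlong_of_forall fun t ht ↦ ⟨hγ.contMDiffAt (hJ.mem_nhds ht), ?_⟩
  have hs : γ t ∈ (chartAt E (γ t)).source := mem_chart_source E (γ t)
  exact (ContDiffAt.fderiv_apply_const (contDiffAt_coordCurve hs (hγ.contMDiffAt (hJ.mem_nhds ht)))
    1).congr_of_eventuallyEq (coordAlong_velocity_eventuallyEq hJ hγ ht hs)

theorem SmoothAlong.congr (hV : SmoothAlong γ J V) (h : ∀ t ∈ J, W t = V t) :
    SmoothAlong γ J W :=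
  ContMDiffOn.congr hV fun t ht ↦ by rw [h t ht]

theorem covAlong_congr_of_eventuallyEq (h : ∀ᶠ τ in 𝓝 t, V τ = W τ) :
    covAlong cov γ V t = covAlong cov γ W t := by
  rw [covAlong, covAlong, h.self_of_nhds]
  congr 2
  refine Filter.EventuallyEq.deriv_eq ?_
  filter_upwards [h] with τ hτ
  rw [hτ]

theorem covAlong_congr (hJ : IsOpen J) (h : ∀ t ∈ J, V t = W t) (ht : t ∈ J) :
    covAlong cov γ V t = covAlong cov γ W t :=
  covAlong_congr_of_eventuallyEq (Filter.mem_of_superset (hJ.mem_nhds ht) h)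

theorem SmoothAlong.add (hJ : IsOpen J) (hV : SmoothAlong γ J V) (hW : SmoothAlong γ J W) :
    SmoothAlong γ J (fun t ↦ V t + W t) := by
  refine smoothAlong_of_forall fun t ht ↦ ⟨hV.contMDiffAt hJ ht, ?_⟩
  have hs := mem_chart_source E (γ t)
  have e : coordAlong (γ t) γ (fun t ↦ V t + W t) =
      fun τ ↦ coordAlong (γ t) γ V τ + coordAlong (γ t) γ W τ := funext fun τ ↦ map_add _ _ _
  rw [e]
  exact (hV.contDiffAt hJ ht hs).add (hW.contDiffAt hJ ht hs)

theorem SmoothAlong.smul (hJ : IsOpen J) (hf : ContDiffOn ℝ ∞ f J) (hV : SmoothAlong γ J V) :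
    SmoothAlong γ J (fun t ↦ f t • V t) := by
  refine smoothAlong_of_forall fun t ht ↦ ⟨hV.contMDiffAt hJ ht, ?_⟩
  have hs := mem_chart_source E (γ t)
  have e : coordAlong (γ t) γ (fun t ↦ f t • V t) = fun τ ↦ f τ • coordAlong (γ t) γ V τ :=
    funext fun τ ↦ map_smul _ _ _
  rw [e]
  exact (hf.contDiffAt (hJ.mem_nhds ht)).smul (hV.contDiffAt hJ ht hs)

theorem covAlong_add (hJ : IsOpen J) (hV : SmoothAlong γ J V) (hW : SmoothAlong γ J W)
    (ht : t ∈ J) :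
    covAlong cov γ (fun t ↦ V t + W t) t = covAlong cov γ V t + covAlong cov γ W t := by
  have hs := mem_chart_source E (γ t)
  have hγ := hV.contMDiffAt hJ ht
  have dV := (hV.contDiffAt hJ ht hs).differentiableAt (by simp)
  have dW := (hW.contDiffAt hJ ht hs).differentiableAt (by simp)
  have e : coordAlong (γ t) γ (fun t ↦ V t + W t) =
      fun τ ↦ coordAlong (γ t) γ V τ + coordAlong (γ t) γ W τ := funext fun τ ↦ map_add _ _ _
  refine toCoord_injective hs ?_
  rw [map_add, toCoord_covAlong hs hγ dV, toCoord_covAlong hs hγ dW,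
    toCoord_covAlong hs hγ (by rw [e]; exact dV.add dW), e, covD_add dV dW]

theorem covAlong_smul (hJ : IsOpen J) (hf : ContDiffOn ℝ ∞ f J) (hV : SmoothAlong γ J V)
    (ht : t ∈ J) :
    covAlong cov γ (fun t ↦ f t • V t) t = deriv f t • V t + f t • covAlong cov γ V t := by
  have hs := mem_chart_source E (γ t)
  have hγ := hV.contMDiffAt hJ ht
  have dV := (hV.contDiffAt hJ ht hs).differentiableAt (by simp)
  have df := (hf.contDiffAt (hJ.mem_nhds ht)).differentiableAt (by simp)
  have e : coordAlong (γ t) γ (fun t ↦ f t • V t) = fun τ ↦ f τ • coordAlong (γ t) γ V τ :=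
    funext fun τ ↦ map_smul _ _ _
  refine toCoord_injective hs ?_
  rw [map_add, map_smul, map_smul, toCoord_covAlong hs hγ dV,
    toCoord_covAlong hs hγ (by rw [e]; exact df.smul dV), e, covD_smul df dV]
  simp [coordAlong]

theorem covAlong_zero_of_eventually (h : ∀ᶠ τ in 𝓝 t, V τ = 0)
    (hγ : ContMDiffAt 𝓘(ℝ, ℝ) 𝓘(ℝ, E) ∞ γ t) : covAlong cov γ V t = 0 := by
  have hs := mem_chart_source E (γ t)
  have e : coordAlong (γ t) γ V =ᶠ[𝓝 t] fun _ ↦ 0 := by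
    filter_upwards [h] with τ hτ
    rw [coordAlong, hτ, map_zero]
  refine toCoord_injective hs ?_
  rw [toCoord_covAlong hs hγ (e.differentiableAt_iff.2 (differentiableAt_const _)), covD,
    e.fderiv_eq, e.self_of_nhds]
  simp

theorem smoothAlong_comp (hγ : ContMDiffOn 𝓘(ℝ, ℝ) 𝓘(ℝ, E) ∞ γ J)
    (hX : ContMDiff 𝓘(ℝ, E) (𝓘(ℝ, E).tangent) ∞
      (fun y ↦ (⟨y, X y⟩ : TangentBundle 𝓘(ℝ, E) M))) : SmoothAlong γ J (fun t ↦ X (γ t)) :=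
  hX.comp_contMDiffOn hγ

theorem covAlong_comp (hJ : IsOpen J) (hγ : ContMDiffOn 𝓘(ℝ, ℝ) 𝓘(ℝ, E) ∞ γ J)
    (hX : ContMDiff 𝓘(ℝ, E) (𝓘(ℝ, E).tangent) ∞
      (fun y ↦ (⟨y, X y⟩ : TangentBundle 𝓘(ℝ, E) M))) (ht : t ∈ J) :
    covAlong cov γ (fun t ↦ X (γ t)) t = cov X (γ t) (velocity γ t) := by
  have hs := mem_chart_source E (γ t)
  have h1 := smoothAlong_comp hγ hX
  have hγt := h1.contMDiffAt hJ ht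
  refine toCoord_injective hs ?_
  rw [toCoord_covAlong hs hγt ((h1.contDiffAt hJ ht hs).differentiableAt (by simp)),
    toCoord_cov' cov hs (hX.contMDiffAt.mdifferentiableAt (by simp))]
  have hXd : DifferentiableAt ℝ (localVec (γ t) X) (coordCurve E (γ t) γ t) := by
    refine (contDiffAt_localVec (extChartAt_mem_target hs) ?_).differentiableAt (by simp)
    exact hX.contMDiffAt
  have e : coordAlong (γ t) γ (fun t ↦ X (γ t)) =ᶠ[𝓝 t]
      fun τ ↦ localVec (γ t) X (coordCurve E (γ t) γ τ) := by
    filter_upwards [eventually_mem_source hs hγt.continuousAt] with τ hτ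
    rw [coordAlong, localVec, coordCurve, extChartAt_symm_apply hτ]
  rw [covD_congr (Filter.EventuallyEq.refl _ _) e, covD_vec_comp hXd
    ((contDiffAt_coordCurve hs hγt).differentiableAt (by simp)), nablaVec_apply,
    toCoord_velocity hs (hγt.mdifferentiableAt (by simp)), localVec, coordCurve,
    extChartAt_symm_apply hs]

section Metric

variable [RiemannianBundle (fun x : M ↦ TangentSpace 𝓘(ℝ, E) x)]
  [IsContMDiffRiemannianBundle 𝓘(ℝ, E) ∞ E (fun x : M ↦ TangentSpace 𝓘(ℝ, E) x)]

theorem inner_eventuallyEq (hJ : IsOpen J) (hV : SmoothAlong γ J V) (htJ : t ∈ J)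
    (ht : γ t ∈ (chartAt E p).source) :
    (fun τ ↦ (inner ℝ (V τ) (W τ) : ℝ)) =ᶠ[𝓝 t] fun τ ↦
      localMetric p (coordCurve E p γ τ) (coordAlong p γ V τ) (coordAlong p γ W τ) := by
  filter_upwards [eventually_mem_source ht (hV.contMDiffAt hJ htJ).continuousAt] with τ hτ
  rw [coordCurve, coordAlong, coordAlong, localMetric_extChartAt hτ]

theorem SmoothAlong.inner [T2Space M] (hcov : IsLeviCivita cov) (hJ : IsOpen J)
    (hV : SmoothAlong γ J V) (hW : SmoothAlong γ J W) :
    ContDiffOn ℝ ∞ (fun τ ↦ (inner ℝ (V τ) (W τ) : ℝ)) J := fun t ht ↦ by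
  have hs := mem_chart_source E (γ t)
  refine (ContDiffAt.congr_of_eventuallyEq ?_ (inner_eventuallyEq hJ hV ht hs)).contDiffWithinAt
  exact (hcov.isLocalLeviCivita (γ t)).contDiffAt_g (extChartAt_mem_target hs)
    (contDiffAt_coordCurve hs (hV.contMDiffAt hJ ht)) (hV.contDiffAt hJ ht hs)
    (hW.contDiffAt hJ ht hs)

theorem hasDerivAt_inner [T2Space M] (hcov : IsLeviCivita cov) (hJ : IsOpen J)
    (hV : SmoothAlong γ J V) (hW : SmoothAlong γ J W) (ht : t ∈ J) :
    HasDerivAt (fun τ ↦ (inner ℝ (V τ) (W τ) : ℝ))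
      (inner ℝ (covAlong cov γ V t) (W t) + inner ℝ (V t) (covAlong cov γ W t)) t := by
  have hs := mem_chart_source E (γ t)
  have h := hcov.isLocalLeviCivita (γ t)
  have hγt := hV.contMDiffAt hJ ht
  have dV := (hV.contDiffAt hJ ht hs).differentiableAt (by simp)
  have dW := (hW.contDiffAt hJ ht hs).differentiableAt (by simp)
  have dx := (contDiffAt_coordCurve hs hγt).differentiableAt (by simp)
  have h1 := h.fderiv_g (q := t) (x := coordCurve E (γ t) γ) (extChartAt_mem_target hs) dx dV dW 1
  have h2 := h.differentiableAt_g (q := t) (x := coordCurve E (γ t) γ) (extChartAt_mem_target hs)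
    dx dV dW
  refine HasDerivAt.congr_of_eventuallyEq ?_ (inner_eventuallyEq hJ hV ht hs)
  have h3 := h2.hasFDerivAt.hasDerivAt
  rw [h1, ← toCoord_covAlong hs hγt dV, ← toCoord_covAlong hs hγt dW] at h3
  simp only [coordAlong, coordCurve, localMetric_extChartAt hs] at h3
  exact h3

theorem SStructure.cov_ξ [T2Space M] {m s : ℕ} {S : SStructure E M m s} (hs : 1 ≤ s)
    (hcov : IsLeviCivita cov) (α : Fin s) (x : M) (v : TangentSpace 𝓘(ℝ, E) x) :
    cov (S.ξ α) x v = - S.φ x v := by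
  have : NeZero s := ⟨by omega⟩
  have hx : x ∈ (chartAt E x).source := mem_chart_source E x
  have h := (SStructure.isLocalSStructure (S := S) hcov x).nablaVec_ξ (extChartAt_mem_target hx) α
    (toCoord x x v)
  refine toCoord_injective hx ?_
  rw [toCoord_cov' cov hx ((S.smooth_ξ α).contMDiffAt.mdifferentiableAt (by simp)), map_neg]
  rw [nablaVec_apply] at h
  have e : localVec x (S.ξ α) (extChartAt 𝓘(ℝ, E) x x) = toCoord x x (S.ξ α x) := by
    rw [localVec, extChartAt_symm_apply hx]
  rw [← e, h, localEnd, extChartAt_symm_apply hx]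
  simp only [ContinuousLinearMap.comp_apply, ofCoord_toCoord hx]

end Metric

end AlongRules

/-! ### Two-parameter variations and the derivative of the bienergy density. -/

section Variation

variable {E : Type*} [NormedAddCommGroup E] [NormedSpace ℝ E] [FiniteDimensional ℝ E]
  {M : Type*} [TopologicalSpace M] [ChartedSpace E M] [IsManifold 𝓘(ℝ, E) ∞ M]
  {p q : M} {Γ : ℝ → ℝ → M} {U : Set (ℝ × ℝ)} {s t : ℝ} {z : ℝ × ℝ} {cov : AffineConnection E M}

/-- A two-parameter map in the chart at `p`. -/
def coordMap (E : Type*) [NormedAddCommGroup E] [NormedSpace ℝ E] {M : Type*} [TopologicalSpace M]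
    [ChartedSpace E M] (p : M) (Γ : ℝ → ℝ → M) (z : ℝ × ℝ) : E :=
  extChartAt 𝓘(ℝ, E) p (Γ z.1 z.2)

/-- The tension of the curves `Γ s` in the chart at `p`. -/
def coordTension (cov : AffineConnection E M) (p : M) (Γ : ℝ → ℝ → M) : ℝ × ℝ → E :=
  covD (localGamma cov p) (coordMap E p Γ) (fun z ↦ fderiv ℝ (coordMap E p Γ) z (0, 1)) (0, 1)

theorem contDiffAt_coordMap
    (hΓ : ContMDiffAt 𝓘(ℝ, ℝ × ℝ) 𝓘(ℝ, E) ∞ (fun z : ℝ × ℝ ↦ Γ z.1 z.2) z)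
    (hz : Γ z.1 z.2 ∈ (chartAt E p).source) : ContDiffAt ℝ ∞ (coordMap E p Γ) z :=
  ((contMDiffAt_extChartAt_of_mem hz).comp z hΓ).contDiffAt

theorem contMDiffAt_slice_right
    (hΓ : ContMDiffAt 𝓘(ℝ, ℝ × ℝ) 𝓘(ℝ, E) ∞ (fun z : ℝ × ℝ ↦ Γ z.1 z.2) (s, t)) :
    ContMDiffAt 𝓘(ℝ, ℝ) 𝓘(ℝ, E) ∞ (Γ s) t :=
  hΓ.comp t (f := fun t ↦ (s, t)) (contDiffAt_const.prodMk contDiffAt_id).contMDiffAt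

theorem contMDiffAt_slice_left
    (hΓ : ContMDiffAt 𝓘(ℝ, ℝ × ℝ) 𝓘(ℝ, E) ∞ (fun z : ℝ × ℝ ↦ Γ z.1 z.2) (s, t)) :
    ContMDiffAt 𝓘(ℝ, ℝ) 𝓘(ℝ, E) ∞ (fun s ↦ Γ s t) s :=
  hΓ.comp s (f := fun s ↦ (s, t)) (contDiffAt_id.prodMk contDiffAt_const).contMDiffAt

theorem fderiv_prodMk_right (s t : ℝ) : fderiv ℝ (fun t ↦ (s, t)) t 1 = ((0 : ℝ), (1 : ℝ)) := by
  have h : HasFDerivAt (𝕜 := ℝ) (fun t ↦ (s, t)) _ t :=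
    (hasFDerivAt_const s t).prodMk (hasFDerivAt_id t)
  rw [h.fderiv]
  simp

theorem fderiv_prodMk_left (s t : ℝ) : fderiv ℝ (fun s ↦ (s, t)) s 1 = ((1 : ℝ), (0 : ℝ)) := by
  have h : HasFDerivAt (𝕜 := ℝ) (fun s ↦ (s, t)) _ s :=
    (hasFDerivAt_id s).prodMk (hasFDerivAt_const t s)
  rw [h.fderiv]
  simp

theorem differentiableAt_prodMk_right (s t : ℝ) :
    DifferentiableAt ℝ (fun t : ℝ ↦ (s, t)) t :=
  (differentiableAt_const s).prodMk differentiableAt_id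

theorem fderiv_slice_right {X : ℝ × ℝ → E} (hX : DifferentiableAt ℝ X (s, t)) :
    fderiv ℝ (fun t ↦ X (s, t)) t 1 = fderiv ℝ X (s, t) (0, 1) := by
  rw [← fderiv_prodMk_right s t]
  exact congrArg (fun L : ℝ →L[ℝ] E ↦ L 1)
    (fderiv_comp t (g := X) (f := fun t ↦ (s, t)) hX (differentiableAt_prodMk_right s t))

theorem covD_slice_right {Γ : E → E →L[ℝ] E →L[ℝ] E} {x X : ℝ × ℝ → E}
    (hx : DifferentiableAt ℝ x (s, t)) (hX : DifferentiableAt ℝ X (s, t)) :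
    covD Γ (fun t ↦ x (s, t)) (fun t ↦ X (s, t)) 1 t = covD Γ x X (0, 1) (s, t) := by
  rw [← fderiv_prodMk_right s t]
  exact covD_comp (ι := fun t ↦ (s, t)) (differentiableAt_prodMk_right s t) hx hX 1

theorem eventually_mem_source_map (hU : IsOpen U) (hz : z ∈ U)
    (hΓ : ContMDiffAt 𝓘(ℝ, ℝ × ℝ) 𝓘(ℝ, E) ∞ (fun z : ℝ × ℝ ↦ Γ z.1 z.2) z)
    (hp : Γ z.1 z.2 ∈ (chartAt E p).source) :
    ∀ᶠ w : ℝ × ℝ in 𝓝 z, w ∈ U ∧ Γ w.1 w.2 ∈ (chartAt E p).source :=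
  (Filter.eventually_of_mem (hU.mem_nhds hz) fun _ h ↦ h).and
    (hΓ.continuousAt.eventually (chart_source_mem_nhds hp))

theorem eventually_slice_right {P : ℝ × ℝ → Prop} (h : ∀ᶠ w in 𝓝 (s, t), P w) :
    ∀ᶠ τ in 𝓝 t, P (s, τ) :=
  (Continuous.prodMk_right s).continuousAt.eventually h

theorem coordAlong_velocity_slice
    (hΓ : ContMDiffAt 𝓘(ℝ, ℝ × ℝ) 𝓘(ℝ, E) ∞ (fun z : ℝ × ℝ ↦ Γ z.1 z.2) (s, t))
    (hp : Γ s t ∈ (chartAt E p).source) :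
    coordAlong p (Γ s) (velocity (Γ s)) t = fderiv ℝ (coordMap E p Γ) (s, t) (0, 1) := by
  rw [coordAlong, toCoord_velocity hp ((contMDiffAt_slice_right hΓ).mdifferentiableAt (by simp)),
    ← fderiv_slice_right ((contDiffAt_coordMap hΓ hp).differentiableAt (by simp))]
  rfl

theorem toCoord_velocity_slice_left
    (hΓ : ContMDiffAt 𝓘(ℝ, ℝ × ℝ) 𝓘(ℝ, E) ∞ (fun z : ℝ × ℝ ↦ Γ z.1 z.2) (s, t))
    (hp : Γ s t ∈ (chartAt E p).source) :
    toCoord p (Γ s t) (velocity (fun s ↦ Γ s t) s) = fderiv ℝ (coordMap E p Γ) (s, t) (1, 0) := by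
  refine (toCoord_velocity (γ := fun s ↦ Γ s t) hp
    ((contMDiffAt_slice_left hΓ).mdifferentiableAt (by simp))).trans ?_
  rw [← fderiv_prodMk_left s t]
  exact congrArg (fun L : ℝ →L[ℝ] E ↦ L 1)
    (fderiv_comp s (g := coordMap E p Γ) (f := fun s ↦ (s, t))
      ((contDiffAt_coordMap hΓ hp).differentiableAt (by simp))
      (differentiableAt_id.prodMk (differentiableAt_const t)))

theorem toCoord_tension_slice (hU : IsOpen U)
    (hΓ : ∀ z ∈ U, ContMDiffAt 𝓘(ℝ, ℝ × ℝ) 𝓘(ℝ, E) ∞ (fun z : ℝ × ℝ ↦ Γ z.1 z.2) z)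
    (hz : (s, t) ∈ U) (hp : Γ s t ∈ (chartAt E p).source) :
    toCoord p (Γ s t) (tension cov (Γ s) t) = coordTension cov p Γ (s, t) := by
  have hX := contDiffAt_coordMap (hΓ _ hz) hp
  have hXt := ContDiffAt.fderiv_apply_const hX (0, 1)
  have e : coordAlong p (Γ s) (velocity (Γ s)) =ᶠ[𝓝 t]
      fun t ↦ fderiv ℝ (coordMap E p Γ) (s, t) (0, 1) := by
    filter_upwards [eventually_slice_right (eventually_mem_source_map hU hz (hΓ _ hz) hp)] with τ hτ
      using coordAlong_velocity_slice (hΓ _ hτ.1) hτ.2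
  have hd : DifferentiableAt ℝ (fun t ↦ fderiv ℝ (coordMap E p Γ) (s, t) (0, 1)) t :=
    (hXt.differentiableAt (by simp)).comp t (differentiableAt_prodMk_right s t)
  rw [tension, toCoord_covAlong hp (contMDiffAt_slice_right (hΓ _ hz)) (e.differentiableAt_iff.2 hd),
    covD_congr (Filter.EventuallyEq.refl _ _) e, coordTension,
    ← covD_slice_right (hX.differentiableAt (by simp)) (hXt.differentiableAt (by simp))]
  rfl

theorem contDiffAt_coordTension [T2Space M]
    (hcov : CovariantDerivative.ContMDiffCovariantDerivative cov ∞)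
    (hΓ : ContMDiffAt 𝓘(ℝ, ℝ × ℝ) 𝓘(ℝ, E) ∞ (fun z : ℝ × ℝ ↦ Γ z.1 z.2) z)
    (hp : Γ z.1 z.2 ∈ (chartAt E p).source) : ContDiffAt ℝ ∞ (coordTension cov p Γ) z := by
  have hX := contDiffAt_coordMap hΓ hp
  exact ContDiffAt.covD (x := coordMap E p Γ)
    (contMDiffAt_christoffel cov hcov (extChartAt_mem_target hp)) hX
    (ContDiffAt.fderiv_apply_const hX _) _

/-- The variation field along `Γ 0`, in the chart at `p`, and its second covariant derivative. -/
theorem toCoord_covAlong_covAlong_variation [T2Space M]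
    (hcov : CovariantDerivative.ContMDiffCovariantDerivative cov ∞) (hU : IsOpen U)
    (hΓ : ∀ z ∈ U, ContMDiffAt 𝓘(ℝ, ℝ × ℝ) 𝓘(ℝ, E) ∞ (fun z : ℝ × ℝ ↦ Γ z.1 z.2) z)
    (hz : (s, t) ∈ U) (hp : Γ s t ∈ (chartAt E p).source) :
    toCoord p (Γ s t) (covAlong cov (Γ s) (covAlong cov (Γ s)
      (fun t ↦ velocity (fun s ↦ Γ s t) s)) t) =
    covD (localGamma cov p) (coordMap E p Γ) (covD (localGamma cov p) (coordMap E p Γ)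
      (fun z ↦ fderiv ℝ (coordMap E p Γ) z (1, 0)) (0, 1)) (0, 1) (s, t) := by
  have hev := eventually_mem_source_map hU hz (hΓ _ hz) hp
  have hd : ∀ w ∈ U, Γ w.1 w.2 ∈ (chartAt E p).source →
      DifferentiableAt ℝ (fun z ↦ fderiv ℝ (coordMap E p Γ) z (1, 0)) w := fun w hw hwp ↦
    (ContDiffAt.fderiv_apply_const (contDiffAt_coordMap (hΓ _ hw) hwp) _).differentiableAt (by simp)
  have e1 : ∀ τ, (s, τ) ∈ U → Γ s τ ∈ (chartAt E p).source →
      coordAlong p (Γ s) (fun t ↦ velocity (fun s ↦ Γ s t) s) =ᶠ[𝓝 τ]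
      fun t ↦ fderiv ℝ (coordMap E p Γ) (s, t) (1, 0) := fun τ h1 h2 ↦ by
    filter_upwards [eventually_slice_right (eventually_mem_source_map hU h1 (hΓ _ h1) h2)] with r hr
      using toCoord_velocity_slice_left (hΓ _ hr.1) hr.2
  have e2 : ∀ τ, (s, τ) ∈ U → Γ s τ ∈ (chartAt E p).source →
      coordAlong p (Γ s) (covAlong cov (Γ s) (fun t ↦ velocity (fun s ↦ Γ s t) s)) τ =
      covD (localGamma cov p) (coordMap E p Γ)
        (fun z ↦ fderiv ℝ (coordMap E p Γ) z (1, 0)) (0, 1) (s, τ) := fun τ h1 h2 ↦ by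
    have hX := contDiffAt_coordMap (hΓ _ h1) h2
    rw [coordAlong, toCoord_covAlong h2 (contMDiffAt_slice_right (hΓ _ h1))
      ((e1 τ h1 h2).differentiableAt_iff.2
        ((hd _ h1 h2).comp τ (differentiableAt_prodMk_right s τ))),
      covD_congr (Filter.EventuallyEq.refl _ _) (e1 τ h1 h2),
      ← covD_slice_right (hX.differentiableAt (by simp)) (hd _ h1 h2)]
    rfl
  have e3 : coordAlong p (Γ s) (covAlong cov (Γ s) (fun t ↦ velocity (fun s ↦ Γ s t) s)) =ᶠ[𝓝 t]
      fun τ ↦ covD (localGamma cov p) (coordMap E p Γ)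
        (fun z ↦ fderiv ℝ (coordMap E p Γ) z (1, 0)) (0, 1) (s, τ) := by
    filter_upwards [eventually_slice_right hev] with τ hτ using e2 τ hτ.1 hτ.2
  have hX := contDiffAt_coordMap (hΓ _ hz) hp
  have hdd : DifferentiableAt ℝ (covD (localGamma cov p) (coordMap E p Γ)
      (fun z ↦ fderiv ℝ (coordMap E p Γ) z (1, 0)) (0, 1)) (s, t) :=
    (ContDiffAt.covD (x := coordMap E p Γ)
      (contMDiffAt_christoffel cov hcov (extChartAt_mem_target hp)) hX
      (ContDiffAt.fderiv_apply_const hX _) _).differentiableAt (by simp)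
  rw [toCoord_covAlong hp (contMDiffAt_slice_right (hΓ _ hz)) (e3.differentiableAt_iff.2
      (hdd.comp t (differentiableAt_prodMk_right s t))),
    covD_congr (Filter.EventuallyEq.refl _ _) e3,
    ← covD_slice_right (hX.differentiableAt (by simp)) hdd]
  rfl

theorem smoothAlong_variation {J : Set ℝ} (hU : IsOpen U)
    (hΓ : ∀ z ∈ U, ContMDiffAt 𝓘(ℝ, ℝ × ℝ) 𝓘(ℝ, E) ∞ (fun z : ℝ × ℝ ↦ Γ z.1 z.2) z)
    (hs : ∀ t ∈ J, (s, t) ∈ U) :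
    SmoothAlong (E := E) (Γ s) J (fun t ↦ velocity (fun s ↦ Γ s t) s) := by
  refine smoothAlong_of_forall fun t ht ↦ ⟨contMDiffAt_slice_right (hΓ _ (hs t ht)), ?_⟩
  have hp : Γ s t ∈ (chartAt E (Γ s t)).source := mem_chart_source E _
  have e1 : coordAlong (Γ s t) (Γ s) (fun t ↦ velocity (fun s ↦ Γ s t) s) =ᶠ[𝓝 t]
      fun r ↦ fderiv ℝ (coordMap E (Γ s t) Γ) (s, r) (1, 0) := by
    filter_upwards [eventually_slice_right (eventually_mem_source_map hU (hs t ht)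
      (hΓ _ (hs t ht)) hp)] with r hr using toCoord_velocity_slice_left (hΓ _ hr.1) hr.2
  refine ContDiffAt.congr_of_eventuallyEq ?_ e1
  exact (ContDiffAt.fderiv_apply_const (contDiffAt_coordMap (hΓ _ (hs t ht)) hp) (1, 0)).comp t
    (f := fun t ↦ (s, t)) (contDiffAt_const.prodMk contDiffAt_id)

section Metric

variable [RiemannianBundle (fun x : M ↦ TangentSpace 𝓘(ℝ, E) x)]
  [IsContMDiffRiemannianBundle 𝓘(ℝ, E) ∞ E (fun x : M ↦ TangentSpace 𝓘(ℝ, E) x)]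

theorem inner_tension_eventuallyEq (hU : IsOpen U)
    (hΓ : ∀ z ∈ U, ContMDiffAt 𝓘(ℝ, ℝ × ℝ) 𝓘(ℝ, E) ∞ (fun z : ℝ × ℝ ↦ Γ z.1 z.2) z)
    (hz : z ∈ U) (hp : Γ z.1 z.2 ∈ (chartAt E p).source) :
    (fun z : ℝ × ℝ ↦ (inner ℝ (tension cov (Γ z.1) z.2) (tension cov (Γ z.1) z.2) : ℝ)) =ᶠ[𝓝 z]
      fun z ↦ localMetric p (coordMap E p Γ z) (coordTension cov p Γ z)
        (coordTension cov p Γ z) := by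
  filter_upwards [eventually_mem_source_map hU hz (hΓ _ hz) hp] with w hw
  rw [← localMetric_extChartAt hw.2, toCoord_tension_slice hU hΓ hw.1 hw.2]
  rfl

theorem contDiffAt_inner_tension [T2Space M] (hcov : IsLeviCivita cov) (hU : IsOpen U)
    (hΓ : ∀ z ∈ U, ContMDiffAt 𝓘(ℝ, ℝ × ℝ) 𝓘(ℝ, E) ∞ (fun z : ℝ × ℝ ↦ Γ z.1 z.2) z)
    (hz : z ∈ U) : ContDiffAt ℝ ∞ (fun z : ℝ × ℝ ↦
      (inner ℝ (tension cov (Γ z.1) z.2) (tension cov (Γ z.1) z.2) : ℝ)) z := by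
  have hp : Γ z.1 z.2 ∈ (chartAt E (Γ z.1 z.2)).source := mem_chart_source E _
  refine ContDiffAt.congr_of_eventuallyEq ?_ (inner_tension_eventuallyEq hU hΓ hz hp)
  exact (hcov.isLocalLeviCivita _).contDiffAt_g (x := coordMap E _ Γ) (extChartAt_mem_target hp)
    (contDiffAt_coordMap (hΓ _ hz) hp) (contDiffAt_coordTension hcov.smooth (hΓ _ hz) hp)
    (contDiffAt_coordTension hcov.smooth (hΓ _ hz) hp)

/-- The pointwise first variation of the bienergy density. -/
theorem fderiv_inner_tension [T2Space M] (hcov : IsLeviCivita cov) (hU : IsOpen U)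
    (hΓ : ∀ z ∈ U, ContMDiffAt 𝓘(ℝ, ℝ × ℝ) 𝓘(ℝ, E) ∞ (fun z : ℝ × ℝ ↦ Γ z.1 z.2) z)
    (hz : (s, t) ∈ U) :
    fderiv ℝ (fun z : ℝ × ℝ ↦ (inner ℝ (tension cov (Γ z.1) z.2) (tension cov (Γ z.1) z.2) : ℝ))
      (s, t) (1, 0) = 2 * (inner ℝ (covAlong cov (Γ s) (covAlong cov (Γ s)
        (fun t ↦ velocity (fun s ↦ Γ s t) s)) t) (tension cov (Γ s) t)
      - inner ℝ (velocity (fun s ↦ Γ s t) s : TangentSpace 𝓘(ℝ, E) (Γ s t))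
        (curvature cov (Γ s t) (velocity (Γ s) t) (tension cov (Γ s) t) (velocity (Γ s) t))) := by
  have hp : Γ s t ∈ (chartAt E (Γ s t)).source := mem_chart_source E _
  have hT : coordMap E (Γ s t) Γ (s, t) ∈ (extChartAt 𝓘(ℝ, E) (Γ s t)).target :=
    extChartAt_mem_target hp
  have h := hcov.isLocalLeviCivita (Γ s t)
  have hX := contDiffAt_coordMap (hΓ _ hz) hp
  have hτ := contDiffAt_coordTension hcov.smooth (hΓ _ hz) hp
  have hXt := ContDiffAt.fderiv_apply_const hX (0, 1)
  have hΓs : ContDiffAt ℝ ∞ (localGamma cov (Γ s t)) (coordMap E (Γ s t) Γ (s, t)) :=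
    contMDiffAt_christoffel cov hcov.smooth hT
  -- `∇_s ∂_t = ∇_t ∂_s`. With the Ricci identity `e2` this gives `∇_s τ = ∇_t ∇_t W + R(W, T)T`,
  -- where `W` is the variation field.
  have e1 : covD (localGamma cov (Γ s t)) (coordMap E (Γ s t) Γ)
      (fun z ↦ fderiv ℝ (coordMap E (Γ s t) Γ) z (0, 1)) (1, 0) =ᶠ[𝓝 (s, t)]
      covD (localGamma cov (Γ s t)) (coordMap E (Γ s t) Γ)
      (fun z ↦ fderiv ℝ (coordMap E (Γ s t) Γ) z (1, 0)) (0, 1) := by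
    filter_upwards [eventually_mem_source_map hU hz (hΓ _ hz) hp] with w hw
    exact covD_fderiv_symm (contDiffAt_coordMap (hΓ _ hw.1) hw.2)
      (h.Γ_symm _ (extChartAt_mem_target hw.2)) _ _
  have e2 := covD_covD_sub (x := coordMap E (Γ s t) Γ) hΓs hX hXt (1, 0) (0, 1)
  rw [covD_congr (Filter.EventuallyEq.refl _ _) e1, sub_eq_iff_eq_add] at e2
  rw [(inner_tension_eventuallyEq hU hΓ hz hp).fderiv_eq,
    h.fderiv_g (q := (s, t)) (x := coordMap E (Γ s t) Γ) hT (hX.differentiableAt (by simp))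
      (hτ.differentiableAt (by simp)) (hτ.differentiableAt (by simp)),
    h.g_symm _ hT (coordTension cov (Γ s t) Γ (s, t))]
  have e3 : covD (localGamma cov (Γ s t)) (coordMap E (Γ s t) Γ) (coordTension cov (Γ s t) Γ)
      (1, 0) (s, t) = _ := e2
  rw [e3, ← toCoord_covAlong_covAlong_variation hcov.smooth hU hΓ hz hp, map_add, add_apply,
    ← toCoord_tension_slice hU hΓ hz hp, ← toCoord_velocity_slice_left (hΓ _ hz) hp,
    ← coordAlong_velocity_slice (hΓ _ hz) hp]
  -- Pair symmetry and skew symmetry turn `⟨R(W, T)T, τ⟩` into `-⟨W, R(T, τ)T⟩`, which isolates `W`.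
  have e4 := h.curv_pair_symm (extChartAt_mem_target hp)
  have e5 := h.curv_skew (extChartAt_mem_target hp)
  have e6 := toCoord_curvature cov hcov.smooth (velocity (Γ s) t) (tension cov (Γ s) t)
    (velocity (Γ s) t)
  have e7 : coordMap E (Γ s t) Γ (s, t) = extChartAt 𝓘(ℝ, E) (Γ s t) (Γ s t) := rfl
  have e8 : coordAlong (Γ s t) (Γ s) (velocity (E := E) (Γ s)) t =
    toCoord (Γ s t) (Γ s t) (velocity (E := E) (Γ s) t) := rfl
  rw [e7, e8, localMetric_extChartAt hp, e4, eq_neg_of_add_eq_zero_left (e5 _ _ _ _), ← e6,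
    localMetric_extChartAt hp]
  ring

end Metric

end Variation

/-- Differentiation under the integral sign for a smooth integrand. -/
theorem hasDerivAt_integral_of_contDiffOn {e : ℝ × ℝ → ℝ} {ε p q : ℝ} {J : Set ℝ}
    (hε : 0 < ε) (he : ∀ z ∈ Ioo (-ε) ε ×ˢ J, ContDiffAt ℝ ∞ e z) (hpq : p ≤ q)
    (hsub : Icc p q ⊆ J) :
    HasDerivAt (fun s ↦ ∫ t in p..q, e (s, t)) (∫ t in p..q, fderiv ℝ e (0, t) (1, 0)) 0 := by
  -- Halving `ε` gives a compact rectangle on which the `s`-derivative is bounded; the bound serves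
  -- as dominating function.
  have hK : IsCompact (Icc (-(ε / 2)) (ε / 2) ×ˢ Icc p q) := isCompact_Icc.prod isCompact_Icc
  have hKU : Icc (-(ε / 2)) (ε / 2) ×ˢ Icc p q ⊆ Ioo (-ε) ε ×ˢ J := prod_mono
    (fun s hs ↦ ⟨by linarith [hs.1], by linarith [hs.2]⟩) hsub
  have hec : ContinuousOn e (Ioo (-ε) ε ×ˢ J) := fun z hz ↦ (he z hz).continuousAt.continuousWithinAt
  have hdc : ContinuousOn (fun z ↦ fderiv ℝ e z (1, 0)) (Ioo (-ε) ε ×ˢ J) := fun z hz ↦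
    (ContDiffAt.fderiv_apply_const (he z hz) (1, 0)).continuousAt.continuousWithinAt
  obtain ⟨C, hC⟩ := hK.exists_bound_of_continuousOn (hdc.mono hKU)
  have huIcc : uIcc p q = Icc p q := uIcc_of_le hpq
  have hslice : ∀ {h : ℝ × ℝ → ℝ}, ContinuousOn h (Ioo (-ε) ε ×ˢ J) → ∀ s ∈ Ioo (-ε) ε,
      ContinuousOn (fun t ↦ h (s, t)) (Icc p q) := fun hh s hs ↦
    hh.comp (Continuous.prodMk_right s).continuousOn fun t ht ↦ ⟨hs, hsub ht⟩
  have hmeas : ∀ {h : ℝ × ℝ → ℝ}, ContinuousOn h (Ioo (-ε) ε ×ˢ J) → ∀ s ∈ Ioo (-ε) ε,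
      IntervalIntegrable (fun t ↦ h (s, t)) MeasureTheory.volume p q := fun hh s hs ↦
    ContinuousOn.intervalIntegrable (by rw [huIcc]; exact hslice hh s hs)
  have h0 : (0 : ℝ) ∈ Ioo (-ε) ε := ⟨by linarith, hε⟩
  refine (intervalIntegral.hasDerivAt_integral_of_dominated_loc_of_deriv_le
    (s := Ioo (-(ε / 2)) (ε / 2)) (bound := fun _ ↦ C)
    (F' := fun s t ↦ fderiv ℝ e (s, t) (1, 0))
    (Ioo_mem_nhds (by linarith) (by linarith)) ?_ (hmeas hec 0 h0)
    ?_ ?_ intervalIntegrable_const ?_).2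
  · filter_upwards [Ioo_mem_nhds h0.1 h0.2] with s hs
    exact (intervalIntegrable_iff.1 (hmeas hec s hs)).aestronglyMeasurable
  · exact (intervalIntegrable_iff.1 (hmeas hdc 0 h0)).aestronglyMeasurable
  · refine Filter.Eventually.of_forall fun t ht s hs ↦ ?_
    rw [uIoc_of_le hpq] at ht
    exact hC (s, t) ⟨Ioo_subset_Icc_self hs, Ioc_subset_Icc_self ht⟩
  · refine Filter.Eventually.of_forall fun t ht s hs ↦ ?_
    rw [uIoc_of_le hpq] at ht
    have h1 := (he (s, t) (hKU ⟨Ioo_subset_Icc_self hs, Ioc_subset_Icc_self ht⟩)).differentiableAt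
      (by simp)
    have h2 : HasFDerivAt (𝕜 := ℝ) (fun s ↦ (s, t)) _ s :=
      (hasFDerivAt_id s).prodMk (hasFDerivAt_const t s)
    have h3 : HasDerivAt (fun s ↦ e (s, t)) _ s := (HasFDerivAt.comp s (g := e) (f := fun s ↦ (s, t)) h1.hasFDerivAt h2).hasDerivAt
    simpa using h3

/-! ### Integration by parts in the first variation. -/

section FirstVariation

variable {E : Type*} [NormedAddCommGroup E] [NormedSpace ℝ E] [FiniteDimensional ℝ E]
  {M : Type*} [TopologicalSpace M] [ChartedSpace E M] [IsManifold 𝓘(ℝ, E) ∞ M] [T2Space M]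
  [RiemannianBundle (fun x : M ↦ TangentSpace 𝓘(ℝ, E) x)]
  [IsContMDiffRiemannianBundle 𝓘(ℝ, E) ∞ E (fun x : M ↦ TangentSpace 𝓘(ℝ, E) x)]
  {cov : AffineConnection E M} {f : ℝ → ℝ} {γ : ℝ → M} {J : Set ℝ} {t : ℝ}

theorem curvature_smul_middle
    (hcov : CovariantDerivative.ContMDiffCovariantDerivative cov ∞) {x : M}
    (a : ℝ) (u v w : TangentSpace 𝓘(ℝ, E) x) :
    curvature cov x u (a • v) w = a • curvature cov x u v w := by
  refine toCoord_injective (mem_chart_source E x) ?_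
  rw [map_smul, toCoord_curvature cov hcov, toCoord_curvature cov hcov, map_smul,
    curv_smul_middle]

theorem covAlong_covAlong_smul (hcov : CovariantDerivative.ContMDiffCovariantDerivative cov ∞)
    (hJ : IsOpen J) (hf : ContDiffOn ℝ ∞ f J) {V : (t : ℝ) → TangentSpace 𝓘(ℝ, E) (γ t)}
    (hV : SmoothAlong γ J V) (ht : t ∈ J) :
    covAlong cov γ (covAlong cov γ fun t ↦ f t • V t) t =
      deriv (deriv f) t • V t + (2 * deriv f t) • covAlong cov γ V t
        + f t • covAlong cov γ (covAlong cov γ V) t := by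
  have hf' : ContDiffOn ℝ ∞ (deriv f) J := hf.deriv_of_isOpen hJ (by simp)
  have hV' := hV.covAlong hcov hJ
  rw [covAlong_congr hJ (fun t ht ↦ covAlong_smul hJ hf hV ht) ht,
    covAlong_add hJ (hV.smul hJ hf') (hV'.smul hJ hf) ht, covAlong_smul hJ hf' hV ht,
    covAlong_smul hJ hf hV' ht]
  module

/-- This explains the shape of `τ₃`: up to the factor `f` it is the Jacobi-type operator `A ↦ ∇∇A -
R(T, A)T` applied to `f τ`. In this form the integration by parts is immediate. -/
theorem smul_tau3 (hcov : CovariantDerivative.ContMDiffCovariantDerivative cov ∞)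
    (hJ : IsOpen J) (hf : ContDiffOn ℝ ∞ f J) (hf0 : ∀ t ∈ J, f t ≠ 0)
    (hγ : ContMDiffOn 𝓘(ℝ, ℝ) 𝓘(ℝ, E) ∞ γ J) (ht : t ∈ J) :
    f t • tau3 cov f γ t = covAlong cov γ (covAlong cov γ fun t ↦ f t • tension cov γ t) t
      - curvature cov (γ t) (velocity γ t) (f t • tension cov γ t) (velocity γ t) := by
  have hτ : SmoothAlong γ J (tension cov γ) := (smoothAlong_velocity hJ hγ).covAlong hcov hJ
  rw [covAlong_covAlong_smul hcov hJ hf hτ ht,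
    curvature_smul_middle hcov, tau3, smul_add, smul_add, smul_sub, smul_smul, smul_smul,
    mul_div_cancel₀ _ (hf0 t ht)]
  rw [show f t * (2 * (deriv f t / f t)) = 2 * deriv f t by
    field_simp [hf0 t ht]]
  simp only [tension]
  module

/-- The first variation of the `f`-bienergy. -/
theorem hasDerivAt_bienergy (hcov : IsLeviCivita cov) (hJ : IsOpen J) (hf : ContDiffOn ℝ ∞ f J)
    (hf0 : ∀ t ∈ J, f t ≠ 0) {p q ε : ℝ} {Γ : ℝ → ℝ → M} (hpq : p ≤ q) (hsub : Icc p q ⊆ J)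
    (hε : 0 < ε)
    (hΓ : ContMDiffOn 𝓘(ℝ, ℝ × ℝ) 𝓘(ℝ, E) ∞ (fun z : ℝ × ℝ ↦ Γ z.1 z.2) (Ioo (-ε) ε ×ˢ J))
    (hconst : ∀ s ∈ Ioo (-ε) ε, ∀ t ∈ J \ Icc p q, Γ s t = Γ 0 t) :
    HasDerivAt (fun s ↦ (1 / 2 : ℝ) *
      ∫ t in p..q, f t * inner ℝ (tension cov (Γ s) t) (tension cov (Γ s) t))
      (∫ t in p..q, (inner ℝ (velocity (fun s ↦ Γ s t) 0 : TangentSpace 𝓘(ℝ, E) (Γ 0 t))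
        (f t • tau3 cov f (Γ 0) t) : ℝ)) 0 := by
  have hU : IsOpen (Ioo (-ε) ε ×ˢ J) := isOpen_Ioo.prod hJ
  have hΓ' : ∀ z ∈ Ioo (-ε) ε ×ˢ J,
      ContMDiffAt 𝓘(ℝ, ℝ × ℝ) 𝓘(ℝ, E) ∞ (fun z : ℝ × ℝ ↦ Γ z.1 z.2) z := fun z hz ↦
    hΓ.contMDiffAt (hU.mem_nhds hz)
  have h0 : (0 : ℝ) ∈ Ioo (-ε) ε := ⟨by linarith, hε⟩
  have hmem : ∀ t ∈ J, ((0 : ℝ), t) ∈ Ioo (-ε) ε ×ˢ J := fun t ht ↦ ⟨h0, ht⟩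
  have hγ : ContMDiffOn 𝓘(ℝ, ℝ) 𝓘(ℝ, E) ∞ (Γ 0) J := fun t ht ↦
    (contMDiffAt_slice_right (hΓ' _ (hmem t ht))).contMDiffWithinAt
  let W : (t : ℝ) → TangentSpace 𝓘(ℝ, E) (Γ 0 t) := fun t ↦ velocity (fun s ↦ Γ s t) 0
  let A : (t : ℝ) → TangentSpace 𝓘(ℝ, E) (Γ 0 t) := fun t ↦ f t • tension cov (Γ 0) t
  have hW : SmoothAlong (Γ 0) J W := smoothAlong_variation hU hΓ' hmem
  have hτ : SmoothAlong (Γ 0) J (tension cov (Γ 0)) :=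
    (smoothAlong_velocity hJ hγ).covAlong hcov.smooth hJ
  have hA : SmoothAlong (Γ 0) J A := hτ.smul hJ hf
  have hW' := hW.covAlong hcov.smooth hJ
  have hA' := hA.covAlong hcov.smooth hJ
  -- Both integrations by parts at once: `G'` is `⟨∇∇W, A⟩ - ⟨W, ∇∇A⟩`, so the two integrals differ
  -- only by boundary values of `G`.
  let G : ℝ → ℝ := fun t ↦ inner ℝ (covAlong cov (Γ 0) W t) (A t)
    - inner ℝ (W t) (covAlong cov (Γ 0) A t)
  have hG : ∀ t ∈ J, HasDerivAt G (inner ℝ (covAlong cov (Γ 0) (covAlong cov (Γ 0) W) t) (A t)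
      - inner ℝ (W t) (covAlong cov (Γ 0) (covAlong cov (Γ 0) A) t)) t := fun t ht ↦ by
    refine ((hasDerivAt_inner hcov hJ hW' hA ht).sub
      (hasDerivAt_inner hcov hJ hW hA' ht)).congr_deriv ?_
    linarith
  have hGW : ∀ t ∈ J \ Icc p q, G t = 0 := fun t ht ↦ by
    have hWz : ∀ τ ∈ J \ Icc p q, W τ = 0 := fun τ hτ ↦ by
      have e : (fun s ↦ Γ s τ) =ᶠ[𝓝 0] fun _ ↦ Γ 0 τ := by
        filter_upwards [Ioo_mem_nhds h0.1 h0.2] with s hs using hconst s hs τ hτ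
      change mfderiv 𝓘(ℝ, ℝ) 𝓘(ℝ, E) (fun s ↦ Γ s τ) 0 (1 : ℝ) = 0
      rw [e.mfderiv_eq, mfderiv_const]
      rfl
    have hopen : IsOpen (J \ Icc p q) := hJ.sdiff isClosed_Icc
    have e1 : covAlong cov (Γ 0) W t = 0 := covAlong_zero_of_eventually
      (Filter.eventually_of_mem (hopen.mem_nhds ht) hWz) (hW.contMDiffAt hJ ht.1)
    simp only [G, e1, hWz t ht, inner_zero_left, sub_zero]
  -- The variation is fixed only strictly outside `[p, q]`. Since `J` is open, `p` and `q` are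
  -- limits of such points of `J`, so `G` vanishes there by continuity; this also covers `p = q`.
  have hGb : ∀ t ∈ J, t ∈ closure (J \ Icc p q) → G t = 0 := fun t ht htc ↦ by
    by_contra hne
    obtain ⟨τ, hτ1, hτ2⟩ := mem_closure_iff_nhds.1 htc _
      ((hG t ht).continuousAt.preimage_mem_nhds (isOpen_ne.mem_nhds hne))
    exact hτ1 (hGW τ hτ2)
  have hpJ : p ∈ J := hsub ⟨le_rfl, hpq⟩
  have hqJ : q ∈ J := hsub ⟨hpq, le_rfl⟩
  have hGp : G p = 0 := hGb p hpJ (by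
    rw [mem_closure_iff_nhds]
    intro u hu
    obtain ⟨l, hl, hlu⟩ := exists_Ioc_subset_of_mem_nhds (Filter.inter_mem hu (hJ.mem_nhds hpJ))
      ⟨p - 1, by linarith⟩
    have hm := hlu (show (l + p) / 2 ∈ Ioc l p from ⟨by linarith, by linarith⟩)
    exact ⟨(l + p) / 2, hm.1, hm.2, fun h ↦ by linarith [h.1]⟩)
  have hGq : G q = 0 := hGb q hqJ (by
    rw [mem_closure_iff_nhds]
    intro u hu
    obtain ⟨l, hl, hlu⟩ := exists_Ico_subset_of_mem_nhds (Filter.inter_mem hu (hJ.mem_nhds hqJ))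
      ⟨q + 1, by linarith⟩
    have hm := hlu (show (l + q) / 2 ∈ Ico q l from ⟨by linarith, by linarith⟩)
    exact ⟨(l + q) / 2, hm.1, hm.2, fun h ↦ by linarith [h.2]⟩)
  let e : ℝ × ℝ → ℝ := fun z ↦ f z.2 * inner ℝ (tension cov (Γ z.1) z.2) (tension cov (Γ z.1) z.2)
  have hfs : ∀ z ∈ Ioo (-ε) ε ×ˢ J, ContDiffAt ℝ ∞ (fun z : ℝ × ℝ ↦ f z.2) z := fun z hz ↦
    (hf.contDiffAt (hJ.mem_nhds hz.2)).comp z contDiffAt_snd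
  have he : ∀ z ∈ Ioo (-ε) ε ×ˢ J, ContDiffAt ℝ ∞ e z := fun z hz ↦
    (hfs z hz).mul (contDiffAt_inner_tension hcov hU hΓ' hz)
  have hd := (hasDerivAt_integral_of_contDiffOn hε he hpq hsub).const_mul (1 / 2 : ℝ)
  refine hd.congr_deriv ?_
  have hval : ∀ t ∈ J, fderiv ℝ e (0, t) (1, 0) = 2 *
      (inner ℝ (covAlong cov (Γ 0) (covAlong cov (Γ 0) W) t) (A t)
        - inner ℝ (W t) (curvature cov (Γ 0 t) (velocity (Γ 0) t) (A t) (velocity (Γ 0) t))) :=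
    fun t ht ↦ by
    have h1 := fderiv_fun_mul ((hfs _ (hmem t ht)).differentiableAt (by simp))
      ((contDiffAt_inner_tension hcov hU hΓ' (hmem t ht)).differentiableAt (by simp))
    have h2 : fderiv ℝ (fun z : ℝ × ℝ ↦ f z.2) (0, t) (1, 0) = 0 := by
      have h3 : HasFDerivAt (fun z : ℝ × ℝ ↦ f z.2) _ ((0 : ℝ), t) := HasFDerivAt.comp (0, t) (g := f)
        ((hf.contDiffAt (hJ.mem_nhds ht)).differentiableAt (by simp)).hasFDerivAt
        (hasFDerivAt_snd (𝕜 := ℝ) (E := ℝ) (F := ℝ))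
      rw [h3.fderiv]; simp
    change fderiv ℝ (fun z : ℝ × ℝ ↦ f z.2 *
      inner ℝ (tension cov (Γ z.1) z.2) (tension cov (Γ z.1) z.2)) (0, t) (1, 0) = _
    rw [h1, add_apply, smul_apply, smul_apply, h2, fderiv_inner_tension hcov hU hΓ' (hmem t ht)]
    simp only [A, curvature_smul_middle hcov.smooth, inner_smul_right, smul_eq_mul, mul_zero,
      add_zero, W]
    ring
  have htau : ∀ t ∈ J, inner ℝ (W t) (f t • tau3 cov f (Γ 0) t) =
      (inner ℝ (W t) (covAlong cov (Γ 0) (covAlong cov (Γ 0) A) t)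
        - inner ℝ (W t) (curvature cov (Γ 0 t) (velocity (Γ 0) t) (A t) (velocity (Γ 0) t)) : ℝ) :=
    fun t ht ↦ by rw [smul_tau3 hcov.smooth hJ hf hf0 hγ ht, inner_sub_right]
  have huIcc : uIcc p q = Icc p q := uIcc_of_le hpq
  have hcont : ContinuousOn (fun t ↦ (1 / 2 : ℝ) * fderiv ℝ e (0, t) (1, 0)) (uIcc p q) := by
    rw [huIcc]
    intro t ht
    have := (ContDiffAt.fderiv_apply_const (he _ (hmem t (hsub ht))) (1, 0)).continuousAt
    exact ((this.comp (f := fun t ↦ ((0 : ℝ), t))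
      (Continuous.prodMk_right 0).continuousAt).const_mul (1 / 2)).continuousWithinAt
  have hcont' : ContinuousOn (fun t ↦ (inner ℝ (W t) (f t • tau3 cov f (Γ 0) t) : ℝ))
      (uIcc p q) := by
    rw [huIcc]
    have hGd : ContinuousOn (fun t ↦ (inner ℝ (covAlong cov (Γ 0) (covAlong cov (Γ 0) W) t) (A t)
        - inner ℝ (W t) (covAlong cov (Γ 0) (covAlong cov (Γ 0) A) t) : ℝ)) (Icc p q) :=
      ((((hW'.covAlong hcov.smooth hJ).inner hcov hJ hA).sub
        (hW.inner hcov hJ (hA'.covAlong hcov.smooth hJ))).continuousOn).mono hsub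
    rw [huIcc] at hcont
    refine (hcont.sub hGd).congr fun t ht ↦ ?_
    rw [htau t (hsub ht), Pi.sub_apply, hval t (hsub ht)]
    ring
  have hdiff : ∀ t ∈ uIcc p q, HasDerivAt G ((1 / 2 : ℝ) * fderiv ℝ e (0, t) (1, 0)
      - inner ℝ (W t) (f t • tau3 cov f (Γ 0) t)) t := fun t ht ↦ by
    have htJ : t ∈ J := hsub (huIcc ▸ ht)
    convert hG t htJ using 1
    rw [hval t htJ, htau t htJ]
    ring
  have hint := intervalIntegral.integral_eq_sub_of_hasDerivAt hdiff
    (hcont.sub hcont').intervalIntegrable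
  rw [hGp, hGq, sub_zero, intervalIntegral.integral_sub hcont.intervalIntegrable
    hcont'.intervalIntegrable, sub_eq_zero, intervalIntegral.integral_const_mul] at hint
  exact hint

end FirstVariation

/-! ### Smoothness of `τ₃` and the Euler–Lagrange equation. -/

section CurvatureInCharts

variable {E : Type*} [NormedAddCommGroup E] [NormedSpace ℝ E] [FiniteDimensional ℝ E]
  {M : Type*} [TopologicalSpace M] [ChartedSpace E M] [IsManifold 𝓘(ℝ, E) ∞ M] [T2Space M]
  [RiemannianBundle (fun x : M ↦ TangentSpace 𝓘(ℝ, E) x)]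
  [IsContMDiffRiemannianBundle 𝓘(ℝ, E) ∞ E (fun x : M ↦ TangentSpace 𝓘(ℝ, E) x)]
  {cov : AffineConnection E M} {f : ℝ → ℝ} {γ : ℝ → M} {J : Set ℝ} {t : ℝ} {p y : M}

theorem fderiv_add_apply_clm {Γ : E → E →L[ℝ] E →L[ℝ] E} {V W : E → E} {z : E}
    (hΓ : ContDiffAt ℝ ∞ Γ z) (hV : ContDiffAt ℝ ∞ V z) (hW : ContDiffAt ℝ ∞ W z) (u : E) :
    fderiv ℝ (fun z ↦ fderiv ℝ W z (V z) + Γ z (W z) (V z)) z u =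
      fderiv ℝ (fderiv ℝ W) z u (V z) + fderiv ℝ W z (fderiv ℝ V z u)
        + (fderiv ℝ Γ z u (W z) (V z) + Γ z (fderiv ℝ W z u) (V z)
          + Γ z (W z) (fderiv ℝ V z u)) := by
  have dW' : DifferentiableAt ℝ (fderiv ℝ W) z :=
    (hW.fderiv_right (m := ∞) (by simp)).differentiableAt (by simp)
  have dV := (hV.differentiableAt (by simp)).hasFDerivAt
  have dW := (hW.differentiableAt (by simp)).hasFDerivAt
  have dΓ := (hΓ.differentiableAt (by simp)).hasFDerivAt
  have h : HasFDerivAt (fun z ↦ fderiv ℝ W z (V z) + Γ z (W z) (V z)) _ z :=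
    (dW'.hasFDerivAt.clm_apply dV).add ((dΓ.clm_apply dW).clm_apply dV)
  rw [h.fderiv]
  simp
  abel

/-- The curvature tensor in an arbitrary chart. -/
theorem IsLeviCivita.toCoord_curvature (hcov : IsLeviCivita cov) (hy : y ∈ (chartAt E p).source)
    (u v w : TangentSpace 𝓘(ℝ, E) y) :
    toCoord p y (curvature cov y u v w) = curv (localGamma cov p) (extChartAt 𝓘(ℝ, E) p y)
      (toCoord p y u) (toCoord p y v) (toCoord p y w) := by
  have hyy : y ∈ (chartAt E y).source := mem_chart_source E y
  set z := extChartAt 𝓘(ℝ, E) p y with hz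
  have hzt : z ∈ (extChartAt 𝓘(ℝ, E) p).target := extChartAt_mem_target hy
  have hψ : (extChartAt 𝓘(ℝ, E) p).symm z = y := extChartAt_symm_apply hy
  have h := hcov.isLocalLeviCivita p
  have hs : ∀ a : TangentSpace 𝓘(ℝ, E) y, ∀ x ∈ (chartAt E y).source,
      ContMDiffAt 𝓘(ℝ, E) (𝓘(ℝ, E).tangent) ∞
        (fun x ↦ (⟨x, constField a x⟩ : TangentBundle 𝓘(ℝ, E) M)) x := fun a x hx ↦ by
    rw [constField_eq]; exact contMDiffAt_coordField hx _
  have hloc : ∀ a : TangentSpace 𝓘(ℝ, E) y, ContDiffAt ℝ ∞ (localVec p (constField a)) z :=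
    fun a ↦ contDiffAt_localVec hzt (by rw [hψ]; exact hs a y hyy)
  have hval : ∀ a : TangentSpace 𝓘(ℝ, E) y, constField a y = a := fun a ↦ by
    rw [constField_eq]; exact coordField_toCoord hyy a
  have hlv : ∀ a : TangentSpace 𝓘(ℝ, E) y, localVec p (constField a) z = toCoord p y a :=
    fun a ↦ by rw [localVec, hψ, hval]
  have hbr : ∀ a b : TangentSpace 𝓘(ℝ, E) y,
      VectorField.mlieBracket 𝓘(ℝ, E) (constField a) (constField b) y = 0 := fun a b ↦ by
    rw [constField_eq, constField_eq]; exact mlieBracket_coordField hyy _ _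
  have hmem : ∀ᶠ x in 𝓝 z, x ∈ (extChartAt 𝓘(ℝ, E) p).target ∧
      (extChartAt 𝓘(ℝ, E) p).symm x ∈ (chartAt E y).source := by
    refine (Filter.eventually_of_mem ((isOpen_extChartAt_target p).mem_nhds hzt) fun _ h ↦ h).and
      ((contMDiffAt_extChartAt_symm hzt).continuousAt.eventually ?_)
    rw [hψ]
    exact chart_source_mem_nhds hyy
  have hfield : ∀ a b : TangentSpace 𝓘(ℝ, E) y, ContMDiffAt 𝓘(ℝ, E) (𝓘(ℝ, E).tangent) ∞
      (fun x ↦ (⟨x, cov (constField a) x (constField b x)⟩ : TangentBundle 𝓘(ℝ, E) M)) y :=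
    fun a b ↦ by
      simp only [constField_eq]
      exact contMDiffAt_cov_coordField cov hcov.smooth hyy _ _
  have key : ∀ a b d : TangentSpace 𝓘(ℝ, E) y,
      toCoord p y (cov (fun x ↦ cov (constField a) x (constField b x)) y d) =
      fderiv ℝ (fun x ↦ fderiv ℝ (localVec p (constField a)) x (localVec p (constField b) x)
        + localGamma cov p x (localVec p (constField a) x) (localVec p (constField b) x)) z
        (toCoord p y d)
      + localGamma cov p z (fderiv ℝ (localVec p (constField a)) z (toCoord p y b)
        + localGamma cov p z (toCoord p y a) (toCoord p y b)) (toCoord p y d) := fun a b d ↦ by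
    rw [toCoord_cov' cov hy ((hfield a b).mdifferentiableAt (by simp)),
      toCoord_cov' cov hy ((hs a y hyy).mdifferentiableAt (by simp)), hval, hval]
    congr 1
    refine congrArg (fun L : E →L[ℝ] E ↦ L (toCoord p y d)) (Filter.EventuallyEq.fderiv_eq ?_)
    filter_upwards [hmem] with x hx
    exact toCoord_cov_target cov hx.1 ((hs a _ hx.2).mdifferentiableAt (by simp)) _
  -- The fields used in `curvature` are constant in the chart at `y` but not in the chart at `p`.
  -- The resulting extra first-order terms cancel because the fields commute, and the second-order
  -- ones by symmetry of second derivatives (`h2`).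
  have hsymm : fderiv ℝ (localVec p (constField v)) z (toCoord p y u) =
      fderiv ℝ (localVec p (constField u)) z (toCoord p y v) := by
    have e := hcov.mlieBracket_eq ((hs u y hyy).mdifferentiableAt (by simp))
      ((hs v y hyy).mdifferentiableAt (by simp))
    rw [hbr, eq_comm, sub_eq_zero, hval, hval] at e
    have e' := congrArg (toCoord p y) e
    rw [toCoord_cov' cov hy ((hs u y hyy).mdifferentiableAt (by simp)),
      toCoord_cov' cov hy ((hs v y hyy).mdifferentiableAt (by simp)), hval, hval,
      h.Γ_symm _ hzt (toCoord p y u)] at e'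
    exact add_right_cancel e'
  have h2 : fderiv ℝ (fderiv ℝ (localVec p (constField w))) z (toCoord p y u) (toCoord p y v) =
      fderiv ℝ (fderiv ℝ (localVec p (constField w))) z (toCoord p y v) (toCoord p y u) :=
    ((hloc w).isSymmSndFDerivAt
      (by simpa using WithTop.coe_le_coe.2 (le_top : (2 : ℕ∞) ≤ ⊤))).eq _ _
  have hΓ := h.smooth_Γ z hzt
  rw [curvature, hbr, map_zero, sub_zero, map_sub, key, key,
    fderiv_add_apply_clm hΓ (hloc v) (hloc w), fderiv_add_apply_clm hΓ (hloc u) (hloc w)]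
  simp only [hlv, hsymm, h2, curv, map_add, add_apply]
  abel

theorem contDiffAt_clm_apply_apply {A : ℝ → E →L[ℝ] E →L[ℝ] E} {V W : ℝ → E}
    (hA : ContDiffAt ℝ ∞ A t) (hV : ContDiffAt ℝ ∞ V t) (hW : ContDiffAt ℝ ∞ W t) :
    ContDiffAt ℝ ∞ (fun τ ↦ A τ (V τ) (W τ)) t :=
  (hA.clm_apply hV).clm_apply hW

theorem contDiffAt_fderiv_comp_apply {F : Type*} [NormedAddCommGroup F] [NormedSpace ℝ F]
    {G : E → F} {x U : ℝ → E} (hG : ContDiffAt ℝ ∞ G (x t)) (hx : ContDiffAt ℝ ∞ x t)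
    (hU : ContDiffAt ℝ ∞ U t) : ContDiffAt ℝ ∞ (fun τ ↦ fderiv ℝ G (x τ) (U τ)) t :=
  ((hG.fderiv_right (m := ∞) (by simp)).comp t hx).clm_apply hU

theorem contDiffAt_curv_apply {Γ : E → E →L[ℝ] E →L[ℝ] E} {x U V W : ℝ → E}
    (hΓ : ContDiffAt ℝ ∞ Γ (x t)) (hx : ContDiffAt ℝ ∞ x t) (hU : ContDiffAt ℝ ∞ U t)
    (hV : ContDiffAt ℝ ∞ V t) (hW : ContDiffAt ℝ ∞ W t) :
    ContDiffAt ℝ ∞ (fun τ ↦ curv Γ (x τ) (U τ) (V τ) (W τ)) t := by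
  have h1 : ContDiffAt ℝ ∞ (fun τ ↦ Γ (x τ)) t := hΓ.comp t hx
  exact (((contDiffAt_clm_apply_apply (contDiffAt_fderiv_comp_apply hΓ hx hU) hW hV).sub
    (contDiffAt_clm_apply_apply (contDiffAt_fderiv_comp_apply hΓ hx hV) hW hU)).add
    (contDiffAt_clm_apply_apply h1 (contDiffAt_clm_apply_apply h1 hW hV) hU)).sub
    (contDiffAt_clm_apply_apply h1 (contDiffAt_clm_apply_apply h1 hW hU) hV)

/-- Smoothness is checked in one chart while the base point moves, hence the use of the curvature
formula away from the centre of the chart. -/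
theorem SmoothAlong.curvature (hcov : IsLeviCivita cov) (hJ : IsOpen J)
    {U V W : (t : ℝ) → TangentSpace 𝓘(ℝ, E) (γ t)}
    (hU : SmoothAlong γ J U) (hV : SmoothAlong γ J V) (hW : SmoothAlong γ J W) :
    SmoothAlong γ J (fun t ↦ curvature cov (γ t) (U t) (V t) (W t)) := by
  refine smoothAlong_of_forall fun t ht ↦ ⟨hU.contMDiffAt hJ ht, ?_⟩
  have hs := mem_chart_source E (γ t)
  have e : coordAlong (γ t) γ (fun t ↦ SGeom.curvature cov (γ t) (U t) (V t) (W t)) =ᶠ[𝓝 t]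
      fun τ ↦ curv (localGamma cov (γ t)) (coordCurve E (γ t) γ τ) (coordAlong (γ t) γ U τ)
        (coordAlong (γ t) γ V τ) (coordAlong (γ t) γ W τ) := by
    filter_upwards [eventually_mem_source hs (hU.contMDiffAt hJ ht).continuousAt] with τ hτ
      using hcov.toCoord_curvature hτ _ _ _
  refine ContDiffAt.congr_of_eventuallyEq ?_ e
  have hx := contDiffAt_coordCurve hs (hU.contMDiffAt hJ ht)
  have hΓ := (hcov.isLocalLeviCivita (γ t)).smooth_Γ _ (extChartAt_mem_target hs)
  have cU := hU.contDiffAt hJ ht hs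
  have cV := hV.contDiffAt hJ ht hs
  have cW := hW.contDiffAt hJ ht hs
  exact contDiffAt_curv_apply (Γ := localGamma cov (γ t)) hΓ hx cU cV cW

theorem smoothAlong_smul_tau3 (hcov : IsLeviCivita cov)
    (hJ : IsOpen J) (hf : ContDiffOn ℝ ∞ f J) (hf0 : ∀ t ∈ J, f t ≠ 0)
    (hγ : ContMDiffOn 𝓘(ℝ, ℝ) 𝓘(ℝ, E) ∞ γ J) :
    SmoothAlong γ J (fun t ↦ f t • tau3 cov f γ t) := by
  have hT := smoothAlong_velocity hJ hγ
  have hτ : SmoothAlong γ J (tension cov γ) := hT.covAlong hcov.smooth hJ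
  have hA := hτ.smul hJ hf
  have h1 := ((hA.covAlong hcov.smooth hJ).covAlong hcov.smooth hJ).add hJ
    (SmoothAlong.smul hJ (f := fun _ ↦ (-1 : ℝ)) contDiffOn_const (hT.curvature hcov hJ hA hT))
  refine h1.congr fun t ht ↦ ?_
  rw [smul_tau3 hcov.smooth hJ hf hf0 hγ ht]
  module

/-- The two tension vectors lie in fibres over points that are only propositionally equal, so their
lengths are compared, through a common chart. -/
theorem inner_tension_congr {U : Set (ℝ × ℝ)} {Γ Γ' : ℝ → ℝ → M} (hU : IsOpen U)
    (hΓ : ContMDiffOn 𝓘(ℝ, ℝ × ℝ) 𝓘(ℝ, E) ∞ (fun z : ℝ × ℝ ↦ Γ z.1 z.2) U)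
    (h : ∀ z ∈ U, Γ' z.1 z.2 = Γ z.1 z.2) {s t : ℝ} (hz : (s, t) ∈ U) :
    (inner ℝ (tension cov (Γ' s) t) (tension cov (Γ' s) t) : ℝ) =
      inner ℝ (tension cov (Γ s) t) (tension cov (Γ s) t) := by
  have hΓ1 : ∀ z ∈ U, ContMDiffAt 𝓘(ℝ, ℝ × ℝ) 𝓘(ℝ, E) ∞ (fun z : ℝ × ℝ ↦ Γ z.1 z.2) z :=
    fun z hz ↦ hΓ.contMDiffAt (hU.mem_nhds hz)
  have hΓ2 : ∀ z ∈ U, ContMDiffAt 𝓘(ℝ, ℝ × ℝ) 𝓘(ℝ, E) ∞ (fun z : ℝ × ℝ ↦ Γ' z.1 z.2) z :=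
    fun z hz ↦ (hΓ.congr h).contMDiffAt (hU.mem_nhds hz)
  have hp : Γ s t ∈ (chartAt E (Γ s t)).source := mem_chart_source E _
  have hp' : Γ' s t ∈ (chartAt E (Γ s t)).source := by rw [h _ hz]; exact hp
  have e : coordMap E (Γ s t) Γ' =ᶠ[𝓝 (s, t)] coordMap E (Γ s t) Γ := by
    filter_upwards [hU.mem_nhds hz] with z hz
    rw [coordMap, coordMap, h z hz]
  have e1 : coordTension cov (Γ s t) Γ' (s, t) = coordTension cov (Γ s t) Γ (s, t) := by
    refine covD_congr e ?_ _
    filter_upwards [e.fderiv (𝕜 := ℝ)] with z hz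
    rw [hz]
  have h1 := (inner_tension_eventuallyEq (cov := cov) hU hΓ1 hz hp).self_of_nhds
  have h2 := (inner_tension_eventuallyEq (cov := cov) hU hΓ2 hz hp').self_of_nhds
  refine h2.trans (Eq.trans ?_ h1.symm)
  beta_reduce
  rw [e1, e.self_of_nhds]

theorem isFBiharmonic_of_tau3_eq_zero (hcov : IsLeviCivita cov) (hJ : IsOpen J)
    (hf : ContDiffOn ℝ ∞ f J) (hf0 : ∀ t ∈ J, f t ≠ 0) (h : ∀ t ∈ J, tau3 cov f γ t = 0) :
    IsFBiharmonic cov f γ J := by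
  classical
  intro p q ε Γ hpq hsub hε hΓ hΓ0 hΓc
  have hU : IsOpen (Ioo (-ε) ε ×ˢ J) := isOpen_Ioo.prod hJ
  have h0 : (0 : ℝ) ∈ Ioo (-ε) ε := ⟨by linarith, hε⟩
  -- `Γ 0` agrees with `γ` only on `J`. Resetting the variation to `γ` off `J` makes `Γ' 0` and `γ`
  -- equal as functions, so the hypothesis on `τ₃` can be transported.
  let Γ' : ℝ → ℝ → M := fun s t ↦ if t ∈ J then Γ s t else γ t
  have hΓΓ' : ∀ z ∈ Ioo (-ε) ε ×ˢ J, Γ' z.1 z.2 = Γ z.1 z.2 := fun z hz ↦ if_pos hz.2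
  have hΓ'0 : Γ' 0 = γ := funext fun t ↦ by
    by_cases ht : t ∈ J
    · simp only [Γ', if_pos ht, hΓ0 t ht]
    · simp only [Γ', if_neg ht]
  have hd := hasDerivAt_bienergy hcov hJ hf hf0 hpq hsub hε (hΓ.congr hΓΓ') (fun s hs t ht ↦ by
    rw [hΓ'0]; simp only [Γ', if_pos ht.1]; exact hΓc s hs t ht)
  have hz : ∀ t ∈ J, tau3 cov f (Γ' 0) t = 0 := by rw [hΓ'0]; exact h
  have huIcc : uIcc p q = Icc p q := uIcc_of_le hpq
  refine (hd.congr_deriv ?_).congr_of_eventuallyEq ?_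
  · rw [intervalIntegral.integral_congr (g := fun _ ↦ (0 : ℝ)) fun t ht ↦ ?_,
      intervalIntegral.integral_zero]
    simp only [hz t (hsub (huIcc ▸ ht)), smul_zero, inner_zero_right]
  · filter_upwards [Ioo_mem_nhds h0.1 h0.2] with s hs
    congr 1
    refine intervalIntegral.integral_congr fun t ht ↦ ?_
    simp only [inner_tension_congr (cov := cov) hU hΓ hΓΓ'
      (show (s, t) ∈ Ioo (-ε) ε ×ˢ J from ⟨hs, hsub (huIcc ▸ ht)⟩)]

/-- Fundamental lemma of the calculus of variations: where `f τ₃` is non-zero, the curve is pushed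
in that direction inside a chart, with a bump function as cut-off. -/
theorem tau3_eq_zero_of_isFBiharmonic (hcov : IsLeviCivita cov) (hJ : IsOpen J)
    (hf : ContDiffOn ℝ ∞ f J) (hfpos : ∀ t ∈ J, 0 < f t)
    (hγ : ContMDiffOn 𝓘(ℝ, ℝ) 𝓘(ℝ, E) ∞ γ J) (hB : IsFBiharmonic cov f γ J) {t₀ : ℝ}
    (ht₀ : t₀ ∈ J) : tau3 cov f γ t₀ = 0 := by
  classical
  by_contra hne
  have hf0 : ∀ t ∈ J, f t ≠ 0 := fun t ht ↦ (hfpos t ht).ne'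
  set p := γ t₀ with hp_def
  have hp : γ t₀ ∈ (chartAt E p).source := mem_chart_source E p
  have hγt := fun t (ht : t ∈ J) ↦ hγ.contMDiffAt (hJ.mem_nhds ht)
  let A : (t : ℝ) → TangentSpace 𝓘(ℝ, E) (γ t) := fun t ↦ f t • tau3 cov f γ t
  have hA : SmoothAlong γ J A := smoothAlong_smul_tau3 hcov hJ hf hf0 hγ
  -- The variation will be `x(t) + s β(t) u` in the chart. Its field has components `β u`, so the
  -- first variation is the integral of `β h`, and `h` is positive near `t₀`.
  let u : E := toCoord p (γ t₀) (A t₀)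
  let x : ℝ → E := coordCurve E p γ
  let h : ℝ → ℝ := fun t ↦ localMetric p (x t) u (coordAlong p γ A t)
  have hh : ∀ t ∈ J, γ t ∈ (chartAt E p).source → ContDiffAt ℝ ∞ h t := fun t ht hs ↦
    (hcov.isLocalLeviCivita p).contDiffAt_g (extChartAt_mem_target hs)
      (contDiffAt_coordCurve hs (hγt t ht)) contDiffAt_const (hA.contDiffAt hJ ht hs)
  have hh0 : 0 < h t₀ := by
    have : h t₀ = inner ℝ (A t₀) (A t₀) := localMetric_extChartAt hp _ _
    rw [this]
    exact real_inner_self_pos.2 (smul_ne_zero (hf0 _ ht₀) hne)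
  obtain ⟨ρ, hρ, hball⟩ := Metric.isOpen_iff.1 (isOpen_extChartAt_target (I := 𝓘(ℝ, E)) p) (x t₀)
    (extChartAt_mem_target hp)
  have hxc : ContinuousAt x t₀ := (contDiffAt_coordCurve hp (hγt t₀ ht₀)).continuousAt
  have hev : ∀ᶠ t in 𝓝 t₀, (t ∈ J ∧ γ t ∈ (chartAt E p).source) ∧ x t ∈ Metric.ball (x t₀) (ρ / 2)
      ∧ 0 < h t :=
    (eventually_mem_source_and hJ (hγt t₀ ht₀) ht₀ hp).and
      ((hxc.eventually (Metric.ball_mem_nhds _ (by linarith))).and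
        ((hh t₀ ht₀ hp).continuousAt.eventually (lt_mem_nhds hh0)))
  obtain ⟨δ, hδ, hδb⟩ := Metric.eventually_nhds_iff_ball.1 hev
  let β : ContDiffBump t₀ := ⟨δ / 4, δ / 2, by linarith, by linarith⟩
  -- This makes `‖s β u‖ < ρ/2`; as `x t` stays within `ρ/2` of `x t₀`, the varied curve does not
  -- leave the ball of radius `ρ` in the chart target.
  let ε : ℝ := ρ / (2 * (‖u‖ + 1))
  have hu1 : 0 < ‖u‖ + 1 := by positivity
  have hε : 0 < ε := by positivity
  have hεu : ε * ‖u‖ < ρ / 2 := by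
    have : ε * (‖u‖ + 1) = ρ / 2 := by simp only [ε]; field_simp
    nlinarith
  have htarget : ∀ s ∈ Ioo (-ε) ε, ∀ t ∈ Metric.ball t₀ δ,
      x t + (s * β t) • u ∈ (extChartAt 𝓘(ℝ, E) p).target := fun s hs t ht ↦ by
    refine hball ?_
    have h1 := (hδb t ht).2.1
    rw [Metric.mem_ball, dist_eq_norm] at h1 ⊢
    have h2 : ‖(s * β t) • u‖ ≤ ε * ‖u‖ := by
      rw [norm_smul, Real.norm_eq_abs, abs_mul, abs_of_nonneg (β.nonneg (x := t))]
      have h3 : |s| ≤ ε := (abs_lt.2 hs).le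
      have h4 := β.le_one (x := t)
      have h5 := β.nonneg (x := t)
      have h6 : |s| * β t ≤ ε := by nlinarith [abs_nonneg s]
      exact mul_le_mul_of_nonneg_right h6 (norm_nonneg _)
    calc ‖x t + (s * β t) • u - x t₀‖ = ‖(x t - x t₀) + (s * β t) • u‖ := by congr 1; abel
      _ ≤ ‖x t - x t₀‖ + ‖(s * β t) • u‖ := norm_add_le _ _
      _ < ρ := by linarith
  let Γ : ℝ → ℝ → M := fun s t ↦
    if t ∈ Metric.ball t₀ δ then (extChartAt 𝓘(ℝ, E) p).symm (x t + (s * β t) • u) else γ t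
  have hΓ1 : ∀ s, ∀ t ∈ Metric.ball t₀ δ,
      Γ s t = (extChartAt 𝓘(ℝ, E) p).symm (x t + (s * β t) • u) := fun s t ht ↦ if_pos ht
  have hΓ2 : ∀ s, ∀ t, t ∉ Metric.closedBall t₀ (δ / 2) → Γ s t = γ t := fun s t ht ↦ by
    by_cases htb : t ∈ Metric.ball t₀ δ
    · rw [hΓ1 s t htb, β.zero_of_le_dist (by
        rw [Metric.mem_closedBall, not_le] at ht; exact ht.le), mul_zero, zero_smul, add_zero]
      exact extChartAt_symm_apply (hδb t htb).1.2
    · exact if_neg htb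
  have hΓ0 : Γ 0 = γ := funext fun t ↦ by
    by_cases htb : t ∈ Metric.ball t₀ δ
    · rw [hΓ1 0 t htb, zero_mul, zero_smul, add_zero]
      exact extChartAt_symm_apply (hδb t htb).1.2
    · exact if_neg htb
  have hIcc : Metric.closedBall t₀ (δ / 2) = Icc (t₀ - δ / 2) (t₀ + δ / 2) := Real.closedBall_eq_Icc
  have hcb : Metric.closedBall t₀ (δ / 2) ⊆ Metric.ball t₀ δ :=
    Metric.closedBall_subset_ball (by linarith)
  have hsub : Icc (t₀ - δ / 2) (t₀ + δ / 2) ⊆ J := fun t ht ↦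
    (hδb t (hcb (hIcc ▸ ht))).1.1
  have hsmooth : ContMDiffOn 𝓘(ℝ, ℝ × ℝ) 𝓘(ℝ, E) ∞ (fun z : ℝ × ℝ ↦ Γ z.1 z.2)
      (Ioo (-ε) ε ×ˢ J) := by
    rintro ⟨s, t⟩ ⟨hs, ht⟩
    refine ContMDiffAt.contMDiffWithinAt ?_
    by_cases htb : t ∈ Metric.ball t₀ δ
    · have e : (fun z : ℝ × ℝ ↦ Γ z.1 z.2) =ᶠ[𝓝 (s, t)] fun z ↦
          (extChartAt 𝓘(ℝ, E) p).symm (x z.2 + (z.1 * β z.2) • u) := by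
        filter_upwards [(Metric.isOpen_ball.preimage continuous_snd).mem_nhds
          (show (s, t) ∈ Prod.snd ⁻¹' Metric.ball t₀ δ from htb)] with z hz using hΓ1 _ _ hz
      refine ContMDiffAt.congr_of_eventuallyEq ?_ e
      have hin : ContDiffAt ℝ ∞ (fun z : ℝ × ℝ ↦ x z.2 + (z.1 * β z.2) • u) (s, t) := by
        refine ((contDiffAt_coordCurve (hδb t htb).1.2 (hγt t (hδb t htb).1.1)).comp (s, t)
          contDiffAt_snd).add ?_
        exact (contDiffAt_fst.mul (β.contDiffAt.comp (s, t) contDiffAt_snd)).smul contDiffAt_const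
      exact (contMDiffAt_extChartAt_symm (htarget s hs t htb)).comp (s, t) hin.contMDiffAt
    · have htc : t ∉ Metric.closedBall t₀ (δ / 2) := fun hc ↦ htb (hcb hc)
      have e : (fun z : ℝ × ℝ ↦ Γ z.1 z.2) =ᶠ[𝓝 (s, t)] fun z ↦ γ z.2 := by
        filter_upwards [(Metric.isClosed_closedBall.isOpen_compl.preimage continuous_snd).mem_nhds
          (show (s, t) ∈ Prod.snd ⁻¹' (Metric.closedBall t₀ (δ / 2))ᶜ from htc)] with z hz
          using hΓ2 _ _ hz
      refine ContMDiffAt.congr_of_eventuallyEq ?_ e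
      exact (hγt t ht).comp (s, t) contDiffAt_snd.contMDiffAt
  have hout : ∀ s, ∀ t ∈ J \ Icc (t₀ - δ / 2) (t₀ + δ / 2), Γ s t = γ t := fun s t ht ↦
    hΓ2 s t (by rw [hIcc]; exact ht.2)
  have hd := hasDerivAt_bienergy hcov hJ hf hf0 (by linarith) hsub hε hsmooth
    (fun s _ t ht ↦ by rw [hΓ0, hout s t ht])
  have hd0 := hB (t₀ - δ / 2) (t₀ + δ / 2) ε Γ (by linarith) hsub hε hsmooth
    (fun t _ ↦ congrFun hΓ0 t) (fun s _ t ht ↦ hout s t ht)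
  have hzero := hd.unique hd0
  have hint : ∀ t ∈ Icc (t₀ - δ / 2) (t₀ + δ / 2),
      (inner ℝ (velocity (fun s ↦ Γ s t) 0 : TangentSpace 𝓘(ℝ, E) (Γ 0 t))
        (f t • tau3 cov f (Γ 0) t) : ℝ) = β t * h t := fun t ht ↦ by
    have htb : t ∈ Metric.ball t₀ δ := hcb (hIcc ▸ ht)
    have hst : Γ 0 t ∈ (chartAt E p).source := by rw [hΓ0]; exact (hδb t htb).1.2
    have h0 : (0 : ℝ) ∈ Ioo (-ε) ε := ⟨by linarith, hε⟩
    have hU : IsOpen (Ioo (-ε) ε ×ˢ J) := isOpen_Ioo.prod hJ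
    have hvel : toCoord p (Γ 0 t) (velocity (fun s ↦ Γ s t) 0) = β t • u := by
      refine (toCoord_velocity (γ := fun s ↦ Γ s t) hst ((contMDiffAt_slice_left
        (hsmooth.contMDiffAt (hU.mem_nhds ⟨h0, hsub ht⟩))).mdifferentiableAt (by simp))).trans ?_
      have e : coordCurve E p (fun s ↦ Γ s t) =ᶠ[𝓝 0] fun s ↦ x t + (s * β t) • u := by
        filter_upwards [Ioo_mem_nhds h0.1 h0.2] with s hs
        rw [coordCurve, hΓ1 s t htb]
        exact (extChartAt 𝓘(ℝ, E) p).right_inv (htarget s hs t htb)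
      rw [e.fderiv_eq]
      have hder : HasDerivAt (fun s : ℝ ↦ x t + (s * β t) • u) ((1 * β t) • u) 0 :=
        (((hasDerivAt_id (0 : ℝ)).mul_const (β t)).smul_const u).const_add (x t)
      rw [fderiv_apply_one_eq_deriv, hder.deriv, one_mul]
    rw [← localMetric_extChartAt hst, hvel, hΓ0, map_smul, smul_apply]
    rfl
  have hint' : ∫ t in (t₀ - δ / 2)..(t₀ + δ / 2), β t * h t = 0 := by
    rw [← hzero]
    refine intervalIntegral.integral_congr fun t ht ↦ ?_
    rw [uIcc_of_le (by linarith)] at ht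
    exact (hint t ht).symm
  have hpos : 0 < ∫ t in (t₀ - δ / 2)..(t₀ + δ / 2), β t * h t := by
    refine intervalIntegral.intervalIntegral_pos_of_pos_on ?_ (fun t ht ↦ ?_) (by linarith)
    · refine ContinuousOn.intervalIntegrable fun t ht ↦ ?_
      rw [uIcc_of_le (by linarith), ← hIcc] at ht
      have htb := hδb t (hcb ht)
      exact (β.continuous.continuousAt.mul (hh t htb.1.1 htb.1.2).continuousAt).continuousWithinAt
    · rw [← Real.ball_eq_Ioo] at ht
      exact mul_pos (β.pos_of_mem_ball ht)
        (hδb t (Metric.ball_subset_ball (by linarith) ht)).2.2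
  exact hpos.ne' hint'

/-- A curve is `f`-biharmonic if and only if `τ₃` vanishes. -/
theorem isFBiharmonic_iff (hcov : IsLeviCivita cov) (hJ : IsOpen J)
    (hf : ContDiffOn ℝ ∞ f J) (hfpos : ∀ t ∈ J, 0 < f t)
    (hγ : ContMDiffOn 𝓘(ℝ, ℝ) 𝓘(ℝ, E) ∞ γ J) :
    IsFBiharmonic cov f γ J ↔ ∀ t ∈ J, tau3 cov f γ t = 0 :=
  ⟨fun h _ ht ↦ tau3_eq_zero_of_isFBiharmonic hcov hJ hf hfpos hγ h ht,
    isFBiharmonic_of_tau3_eq_zero hcov hJ hf fun t ht ↦ (hfpos t ht).ne'⟩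

end CurvatureInCharts

/-- A vector orthogonal to a set spanning a subspace that contains it has zero norm. As `P` need be
neither orthogonal to the frame nor independent of it, pairing with `P` is a separate condition. The
alternatives for `B₁` and `B₂` cover frames too short to contain them. -/
theorem combination_eq_zero_iff {F : Type*} [NormedAddCommGroup F] [InnerProductSpace ℝ F]
    {τ T N B₁ B₂ P : F} {x y z w u : ℝ} (hτ : τ = x • T + y • N + z • B₁ + w • B₂ + u • P)
    (hT : inner ℝ T T = (1 : ℝ)) (hN : inner ℝ N N = (1 : ℝ))
    (hB₁ : inner ℝ B₁ B₁ = (1 : ℝ) ∨ B₁ = 0 ∧ z = 0)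
    (hB₂ : inner ℝ B₂ B₂ = (1 : ℝ) ∨ B₂ = 0 ∧ w = 0)
    (hTN : inner ℝ T N = (0 : ℝ)) (hTB₁ : inner ℝ T B₁ = (0 : ℝ)) (hTB₂ : inner ℝ T B₂ = (0 : ℝ))
    (hNB₁ : inner ℝ N B₁ = (0 : ℝ)) (hNB₂ : inner ℝ N B₂ = (0 : ℝ))
    (hBB : inner ℝ B₁ B₂ = (0 : ℝ)) (hPT : inner ℝ P T = (0 : ℝ)) :
    τ = 0 ↔ x = 0 ∧ y + u * inner ℝ P N = 0 ∧ z + u * inner ℝ P B₁ = 0 ∧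
      w + u * inner ℝ P B₂ = 0 ∧ inner ℝ τ P = (0 : ℝ) := by
  have eT : inner ℝ τ T = x := by
    simp only [hτ, inner_add_left, real_inner_smul_left, hT, real_inner_comm T N,
      real_inner_comm T B₁, real_inner_comm T B₂, hTN, hTB₁, hTB₂, hPT]
    ring
  have eN : inner ℝ τ N = y + u * inner ℝ P N := by
    simp only [hτ, inner_add_left, real_inner_smul_left, hN, real_inner_comm N B₁,
      real_inner_comm N B₂, hTN, hNB₁, hNB₂]
    ring
  have e₁ : inner ℝ τ B₁ = z + u * inner ℝ P B₁ := by
    simp only [hτ, inner_add_left, real_inner_smul_left, real_inner_comm B₁ B₂, hTB₁, hNB₁, hBB]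
    rcases hB₁ with h | ⟨h, h'⟩
    · rw [h]; ring
    · rw [h, h']; simp
  have e₂ : inner ℝ τ B₂ = w + u * inner ℝ P B₂ := by
    simp only [hτ, inner_add_left, real_inner_smul_left, hTB₂, hNB₂, hBB]
    rcases hB₂ with h | ⟨h, h'⟩
    · rw [h]; ring
    · rw [h, h']; simp
  constructor
  · intro h
    rw [← eT, ← eN, ← e₁, ← e₂, h]
    simp only [inner_zero_left, and_self]
  · rintro ⟨h1, h2, h3, h4, h5⟩
    rw [← inner_self_eq_zero (𝕜 := ℝ)]
    nth_rewrite 2 [hτ]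
    simp only [inner_add_right, real_inner_smul_right, eT, eN, e₁, e₂, h1, h2, h3, h4, h5,
      mul_zero, add_zero]

theorem eq_zero_iff_of_eq_mul {x y u : ℝ} (hu : u ≠ 0) (h : x = u * y) : x = 0 ↔ y = 0 := by
  rw [h, mul_eq_zero, or_iff_right hu]

/-! ### Frenet curves: components of `τ₃` and the five conditions. -/

section Frenet

variable {E : Type*} [NormedAddCommGroup E] [NormedSpace ℝ E] [FiniteDimensional ℝ E]
  {M : Type*} [TopologicalSpace M] [ChartedSpace E M] [IsManifold 𝓘(ℝ, E) ∞ M] [T2Space M]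
  [RiemannianBundle (fun x : M ↦ TangentSpace 𝓘(ℝ, E) x)]
  [IsContMDiffRiemannianBundle 𝓘(ℝ, E) ∞ E (fun x : M ↦ TangentSpace 𝓘(ℝ, E) x)]
  {cov : AffineConnection E M} {f : ℝ → ℝ} {γ : ℝ → M} {J : Set ℝ} {t : ℝ} {r : ℕ}
  {V : ℕ → (t : ℝ) → TangentSpace 𝓘(ℝ, E) (γ t)} {k : ℕ → ℝ → ℝ}

namespace IsFrenetCurve

theorem contDiffOn_curvature (h : IsFrenetCurve cov γ J r V k) {j : ℕ} (hj : 1 ≤ j) :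
    ContDiffOn ℝ ∞ (k j) J := by
  rcases lt_or_ge j r with hjr | hjr
  · exact h.smooth_curvature j hj hjr
  · exact (contDiffOn_const (c := (0 : ℝ))).congr (h.curvature_of_le j hjr)

theorem smoothAlong_frame (h : IsFrenetCurve cov γ J r V k) (hJ : IsOpen J) {j : ℕ}
    (hj : 1 ≤ j) : SmoothAlong γ J (V j) := by
  rcases le_or_gt j r with hjr | hjr
  · exact h.smooth_frame j hj hjr
  · refine (SmoothAlong.smul hJ (f := fun _ ↦ (0 : ℝ)) contDiffOn_const
      (h.smooth_frame 1 le_rfl h.one_le)).congr fun t ht ↦ ?_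
    rw [zero_smul, h.frame_of_lt j hjr t ht]

/-- The conventions `k_j = 0` for `j ≥ r` and `V_j = 0` for `j > r` extend the Frenet equations
beyond the osculating order, so `τ₃` is computed without distinguishing small `r`. -/
theorem covAlong_frame (h : IsFrenetCurve cov γ J r V k) (hJ : IsOpen J) {j : ℕ}
    (hj : 1 ≤ j) (ht : t ∈ J) :
    covAlong cov γ (V j) t = -(k (j - 1) t • V (j - 1) t) + k j t • V (j + 1) t := by
  rcases le_or_gt j r with hjr | hjr
  · exact h.frenet j hj hjr t ht
  · rw [h.curvature_of_le (j - 1) (by omega) t ht, h.curvature_of_le j (by omega) t ht,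
      zero_smul, zero_smul, neg_zero, add_zero]
    exact covAlong_zero_of_eventually
      (Filter.mem_of_superset (hJ.mem_nhds ht) fun τ hτ ↦ h.frame_of_lt j hjr τ hτ)
      (h.smooth.contMDiffAt (hJ.mem_nhds ht))

theorem tension_eq (h : IsFrenetCurve cov γ J r V k) (hJ : IsOpen J) (ht : t ∈ J) :
    tension cov γ t = k 1 t • V 2 t := by
  have e := covAlong_congr (cov := cov) hJ (fun t ht ↦ (h.tangent t ht).symm) ht
  rw [tension, e, h.covAlong_frame hJ le_rfl ht, h.curvature_zero t ht, zero_smul, neg_zero,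
    zero_add]

theorem covAlong_tension (h : IsFrenetCurve cov γ J r V k) (hJ : IsOpen J) (ht : t ∈ J) :
    covAlong cov γ (tension cov γ) t =
      (-(k 1 t * k 1 t)) • V 1 t + (deriv (k 1) t • V 2 t + (k 1 t * k 2 t) • V 3 t) := by
  rw [covAlong_congr (cov := cov) hJ (fun t ht ↦ h.tension_eq hJ ht) ht,
    covAlong_smul hJ (h.contDiffOn_curvature le_rfl) (h.smoothAlong_frame hJ one_le_two) ht,
    h.covAlong_frame hJ one_le_two ht]
  module

theorem covAlong_covAlong_tension (h : IsFrenetCurve cov γ J r V k) (hJ : IsOpen J)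
    (ht : t ∈ J) :
    covAlong cov γ (covAlong cov γ (tension cov γ)) t =
      (-(3 * k 1 t * deriv (k 1) t)) • V 1 t
        + (deriv (deriv (k 1)) t - k 1 t ^ 3 - k 1 t * k 2 t ^ 2) • V 2 t
        + (2 * deriv (k 1) t * k 2 t + k 1 t * deriv (k 2) t) • V 3 t
        + (k 1 t * k 2 t * k 3 t) • V 4 t := by
  have k1 := h.contDiffOn_curvature (j := 1) le_rfl
  have k2 := h.contDiffOn_curvature (j := 2) one_le_two
  have k1' : ContDiffOn ℝ ∞ (deriv (k 1)) J := k1.deriv_of_isOpen hJ (by simp)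
  have V1 := h.smoothAlong_frame hJ (j := 1) le_rfl
  have V2 := h.smoothAlong_frame hJ (j := 2) one_le_two
  have V3 := h.smoothAlong_frame hJ (j := 3) (by norm_num)
  have k11 := (k1.mul k1).neg
  have k12 := k1.mul k2
  have d1 := ((k1.contDiffAt (hJ.mem_nhds ht)).differentiableAt (by simp)).hasDerivAt
  have d2 := ((k2.contDiffAt (hJ.mem_nhds ht)).differentiableAt (by simp)).hasDerivAt
  have e11 : deriv (fun t ↦ -(k 1 t * k 1 t)) t = -(deriv (k 1) t * k 1 t + k 1 t * deriv (k 1) t) :=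
    (d1.mul d1).neg.deriv
  have e12 : deriv (fun t ↦ k 1 t * k 2 t) t = deriv (k 1) t * k 2 t + k 1 t * deriv (k 2) t :=
    (d1.mul d2).deriv
  rw [covAlong_congr (cov := cov) hJ (fun t ht ↦ h.covAlong_tension hJ ht) ht,
    covAlong_add hJ (V1.smul hJ k11) ((V2.smul hJ k1').add hJ (V3.smul hJ k12)) ht,
    covAlong_add hJ (V2.smul hJ k1') (V3.smul hJ k12) ht,
    covAlong_smul hJ k11 V1 ht, covAlong_smul hJ k1' V2 ht, covAlong_smul hJ k12 V3 ht,
    h.covAlong_frame hJ le_rfl ht, h.covAlong_frame hJ one_le_two ht,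
    h.covAlong_frame hJ (j := 3) (by norm_num) ht, h.curvature_zero t ht, e11, e12]
  module

theorem tau3_eq (h : IsFrenetCurve cov γ J r V k) (hJ : IsOpen J) (ht : t ∈ J) :
    tau3 cov f γ t =
      (-(3 * k 1 t * deriv (k 1) t) - 2 * (deriv f t / f t) * k 1 t ^ 2) • V 1 t
        + (deriv (deriv (k 1)) t - k 1 t ^ 3 - k 1 t * k 2 t ^ 2
            + 2 * (deriv f t / f t) * deriv (k 1) t + deriv (deriv f) t / f t * k 1 t) • V 2 t
        + (2 * deriv (k 1) t * k 2 t + k 1 t * deriv (k 2) t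
            + 2 * (deriv f t / f t) * (k 1 t * k 2 t)) • V 3 t
        + (k 1 t * k 2 t * k 3 t) • V 4 t
        - curvature cov (γ t) (V 1 t) (k 1 t • V 2 t) (V 1 t) := by
  rw [tau3, h.covAlong_covAlong_tension hJ ht, h.covAlong_tension hJ ht, h.tension_eq hJ ht,
    h.tangent t ht]
  module

end IsFrenetCurve

variable {m s : ℕ} {S : SStructure E M m s} {θ : Fin s → ℝ} {c : ℝ}

theorem SStructure.inner_φ_self (S : SStructure E M m s) (x : M) (v : TangentSpace 𝓘(ℝ, E) x) :
    (inner ℝ (S.φ x v) v : ℝ) = 0 := by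
  have h := S.metric_eq x (S.φ x v) v
  simp only [S.η_φ, zero_mul, Finset.sum_const_zero, add_zero, S.φ_sq, inner_add_left,
    inner_neg_left, sum_inner, real_inner_smul_left] at h
  have h2 : ∀ α, (inner ℝ (S.ξ α x) (S.φ x v) : ℝ) = 0 := fun α ↦ by
    rw [real_inner_comm, ← S.η_eq, S.η_φ]
  simp only [h2, mul_zero, Finset.sum_const_zero, add_zero] at h
  have h3 := real_inner_comm v (S.φ x v)
  linarith

/-- Differentiating `g(T, ξ_α) = cos θ_α` gives `k₁ g(V₂, ξ_α) - g(T, φT) = 0`; the second term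
vanishes and `k₁ > 0`. -/
theorem IsFrenetCurve.inner_normal_ξ (h : IsFrenetCurve cov γ J r V k) (hcov : IsLeviCivita cov)
    (hs : 1 ≤ s) (hJ : IsOpen J) (hr : 2 ≤ r) (hθ : S.IsSlant γ J θ) (α : Fin s) (ht : t ∈ J) :
    (inner ℝ (V 2 t) (S.ξ α (γ t)) : ℝ) = 0 := by
  have hV := smoothAlong_velocity hJ h.smooth
  have hX := smoothAlong_comp h.smooth (S.smooth_ξ α)
  have h1 := hasDerivAt_inner hcov hJ hV hX ht
  have h2 : HasDerivAt (fun τ ↦ (inner ℝ (velocity γ τ) (S.ξ α (γ τ)) : ℝ)) 0 t := by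
    refine (hasDerivAt_const t (Real.cos (θ α))).congr_of_eventuallyEq ?_
    filter_upwards [hJ.mem_nhds ht] with τ hτ
    rw [← S.η_eq, hθ α τ hτ]
  have h3 := h1.unique h2
  rw [covAlong_comp hJ h.smooth (S.smooth_ξ α) ht, SStructure.cov_ξ hs hcov, inner_neg_right,
    real_inner_comm _ (velocity γ t), S.inner_φ_self, neg_zero, add_zero] at h3
  have h4 := h.tension_eq hJ ht
  rw [tension] at h4
  rw [h4, real_inner_smul_left] at h3
  exact (mul_eq_zero.1 h3).resolve_left (h.curvature_pos 1 le_rfl (by omega) t ht).ne'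

theorem IsFrenetCurve.tau3_eq_of_isSpaceForm (h : IsFrenetCurve cov γ J r V k)
    (hcov : IsLeviCivita cov) (hs : 1 ≤ s) (hc : S.IsSpaceForm cov c) (hJ : IsOpen J)
    (hr : 2 ≤ r) (hθ : S.IsSlant γ J θ) (ht : t ∈ J) :
    tau3 cov f γ t =
      (-(3 * k 1 t * deriv (k 1) t) - 2 * (deriv f t / f t) * k 1 t ^ 2) • V 1 t
        + (deriv (deriv (k 1)) t - k 1 t ^ 3 - k 1 t * k 2 t ^ 2
            + 2 * (deriv f t / f t) * deriv (k 1) t + deriv (deriv f) t / f t * k 1 t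
            + k 1 t * ((∑ α, Real.cos (θ α)) ^ 2
              + (c + 3 * s) / 4 * (1 - ∑ α, Real.cos (θ α) ^ 2))) • V 2 t
        + (2 * deriv (k 1) t * k 2 t + k 1 t * deriv (k 2) t
            + 2 * (deriv f t / f t) * (k 1 t * k 2 t)) • V 3 t
        + (k 1 t * k 2 t * k 3 t) • V 4 t
        + (k 1 t * (3 * ((c - s) / 4) * inner ℝ (S.φ (γ t) (V 1 t)) (V 2 t))) •
          S.φ (γ t) (V 1 t) := by
  have hTT := h.orthonormal 1 1 le_rfl (by omega) le_rfl (by omega) t ht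
  have hTN := h.orthonormal 1 2 le_rfl (by omega) one_le_two (by omega) t ht
  have hTξ : ∀ α, (inner ℝ (V 1 t) (S.ξ α (γ t)) : ℝ) = Real.cos (θ α) := fun α ↦ by
    rw [h.tangent t ht, ← S.η_eq, hθ α t ht]
  rw [if_pos rfl] at hTT
  rw [if_neg (by norm_num)] at hTN
  rw [h.tau3_eq hJ ht, curvature_smul_middle hcov.smooth, SStructure.curvature_eq hs hcov hc
    (fun α ↦ h.inner_normal_ξ hcov hs hJ hr hθ α ht) hTN, hTT]
  simp only [hTξ]
  module

theorem IsFrenetCurve.inner_frame_of_ne (h : IsFrenetCurve cov γ J r V k) {i j : ℕ} (hi : 1 ≤ i)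
    (hj : 1 ≤ j) (hij : i ≠ j) (ht : t ∈ J) : (inner ℝ (V i t) (V j t) : ℝ) = 0 := by
  rcases le_or_gt i r with hir | hir
  · rcases le_or_gt j r with hjr | hjr
    · rw [h.orthonormal i j hi hir hj hjr t ht, if_neg hij]
    · rw [h.frame_of_lt j hjr t ht, inner_zero_right]
  · rw [h.frame_of_lt i hir t ht, inner_zero_left]

theorem IsFrenetCurve.inner_frame_self (h : IsFrenetCurve cov γ J r V k) {j : ℕ} (hj : 1 ≤ j)
    (hjr : j ≤ r) (ht : t ∈ J) : (inner ℝ (V j t) (V j t) : ℝ) = 1 := by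
  rw [h.orthonormal j j hj hjr hj hjr t ht, if_pos rfl]

theorem IsFrenetCurve.tau3_eq_zero_iff (h : IsFrenetCurve cov γ J r V k)
    (hcov : IsLeviCivita cov) (hs : 1 ≤ s) (hc : S.IsSpaceForm cov c) (hJ : IsOpen J)
    (hr : 2 ≤ r) (hθ : S.IsSlant γ J θ) (ht : t ∈ J) :
    tau3 cov f γ t = 0 ↔
      3 * (deriv (k 1) t / k 1 t) + 2 * (deriv f t / f t) = 0 ∧
      k 1 t ^ 2 + k 2 t ^ 2 =
        deriv (deriv (k 1)) t / k 1 t + deriv (deriv f) t / f t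
          + 2 * (deriv f t / f t) * (deriv (k 1) t / k 1 t)
          + (∑ α, Real.cos (θ α)) ^ 2 + (c + 3 * s) / 4 * (1 - ∑ α, Real.cos (θ α) ^ 2)
          + 3 * ((c - s) / 4) * inner ℝ (S.φ (γ t) (velocity γ t)) (V 2 t) ^ 2 ∧
      deriv (k 2) t + 2 * k 2 t * (deriv (k 1) t / k 1 t)
          + 2 * k 2 t * (deriv f t / f t)
          + 3 * ((c - s) / 4) * inner ℝ (S.φ (γ t) (velocity γ t)) (V 2 t)
            * inner ℝ (S.φ (γ t) (velocity γ t)) (V 3 t) = 0 ∧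
      k 2 t * k 3 t
          + 3 * ((c - s) / 4) * inner ℝ (S.φ (γ t) (velocity γ t)) (V 2 t)
            * inner ℝ (S.φ (γ t) (velocity γ t)) (V 4 t) = 0 ∧
      inner ℝ (tau3 cov f γ t) (S.φ (γ t) (velocity γ t)) = (0 : ℝ) := by
  have hk : k 1 t ≠ 0 := (h.curvature_pos 1 le_rfl (by omega) t ht).ne'
  have hτ := h.tau3_eq_of_isSpaceForm (f := f) hcov hs hc hJ hr hθ ht
  have h3 : (inner ℝ (V 3 t) (V 3 t) : ℝ) = 1 ∨ V 3 t = 0 ∧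
      2 * deriv (k 1) t * k 2 t + k 1 t * deriv (k 2) t
        + 2 * (deriv f t / f t) * (k 1 t * k 2 t) = 0 := by
    rcases le_or_gt 3 r with hr3 | hr3
    · exact Or.inl (h.inner_frame_self (by norm_num) hr3 ht)
    -- For `r = 2` the function `k₂` vanishes on all of `J`, not just at `t`, so its derivative
    -- vanishes too.
    · have e : k 2 =ᶠ[𝓝 t] fun _ ↦ 0 :=
        Filter.mem_of_superset (hJ.mem_nhds ht) (h.curvature_of_le 2 (by omega))
      refine Or.inr ⟨h.frame_of_lt 3 hr3 t ht, ?_⟩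
      rw [e.deriv_eq, e.self_of_nhds, deriv_const]
      ring
  have h4 : (inner ℝ (V 4 t) (V 4 t) : ℝ) = 1 ∨ V 4 t = 0 ∧ k 1 t * k 2 t * k 3 t = 0 := by
    rcases le_or_gt 4 r with hr4 | hr4
    · exact Or.inl (h.inner_frame_self (by norm_num) hr4 ht)
    · exact Or.inr ⟨h.frame_of_lt 4 hr4 t ht, by
        rw [h.curvature_of_le 3 (by omega) t ht, mul_zero]⟩
  have key := combination_eq_zero_iff hτ (h.inner_frame_self le_rfl (by omega) ht)
    (h.inner_frame_self one_le_two hr ht) h3 h4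
    (h.inner_frame_of_ne (by norm_num) (by norm_num) (by norm_num) ht)
    (h.inner_frame_of_ne (by norm_num) (by norm_num) (by norm_num) ht)
    (h.inner_frame_of_ne (by norm_num) (by norm_num) (by norm_num) ht)
    (h.inner_frame_of_ne (by norm_num) (by norm_num) (by norm_num) ht)
    (h.inner_frame_of_ne (by norm_num) (by norm_num) (by norm_num) ht)
    (h.inner_frame_of_ne (by norm_num) (by norm_num) (by norm_num) ht)
    (S.inner_φ_self _ _)
  rw [key, h.tangent t ht]
  -- The quotients by `f` become opaque, so that only `k₁ ≠ 0` is needed to clear denominators.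
  generalize deriv f t / f t = F
  generalize deriv (deriv f) t / f t = G
  refine and_congr ?_ (and_congr ?_ (and_congr ?_ (and_congr ?_ Iff.rfl)))
  -- The tangential component carries the factor `-k₁²`; each of the next three carries `k₁`.
  · refine eq_zero_iff_of_eq_mul (neg_ne_zero.2 (pow_ne_zero 2 hk)) ?_
    field_simp
    ring
  · rw [eq_comm (a := k 1 t ^ 2 + k 2 t ^ 2), ← sub_eq_zero (b := k 1 t ^ 2 + k 2 t ^ 2)]
    refine eq_zero_iff_of_eq_mul hk ?_
    field_simp
    ring
  · refine eq_zero_iff_of_eq_mul hk ?_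
    field_simp
    ring
  · refine eq_zero_iff_of_eq_mul hk ?_
    ring

/-- Biharmonicity is the case of weight `1`, where the tangential equation loses its `f'/f` term. -/
theorem IsFrenetCurve.deriv_eq_zero_of_isBiharmonic (h : IsFrenetCurve cov γ J r V k)
    (hcov : IsLeviCivita cov) (hs : 1 ≤ s) (hc : S.IsSpaceForm cov c) (hJ : IsOpen J)
    (hr : 2 ≤ r) (hθ : S.IsSlant γ J θ) (hb : IsBiharmonic cov γ J) (ht : t ∈ J) :
    deriv (k 1) t = 0 := by
  have hτ := (isFBiharmonic_iff hcov hJ contDiffOn_const (fun _ _ ↦ one_pos) h.smooth).1 hb t ht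
  have h1 := ((h.tau3_eq_zero_iff hcov hs hc hJ hr hθ ht).1 hτ).1
  rw [deriv_const] at h1
  have hk := (h.curvature_pos 1 le_rfl (by omega) t ht).ne'
  have h2 : deriv (k 1) t / k 1 t = 0 := by linarith
  exact (div_eq_zero_iff.1 h2).resolve_right hk

end Frenet

end SGeom

end

theorem theorem4p1
    {E : Type*} [NormedAddCommGroup E] [NormedSpace ℝ E] [FiniteDimensional ℝ E]
    {M : Type*} [TopologicalSpace M] [T2Space M] [ChartedSpace E M] [IsManifold 𝓘(ℝ, E) ∞ M]
    [RiemannianBundle (fun x : M ↦ TangentSpace 𝓘(ℝ, E) x)]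
    [IsContMDiffRiemannianBundle 𝓘(ℝ, E) ∞ E (fun x : M ↦ TangentSpace 𝓘(ℝ, E) x)]
    (cov : SGeom.AffineConnection E M) (hcov : SGeom.IsLeviCivita cov)
    {m s : ℕ} (hs : 1 ≤ s) (S : SGeom.SStructure E M m s)
    (c : ℝ) (hc : S.IsSpaceForm cov c)
    (J : Set ℝ) (hJ : IsOpen J) (hJ' : J.OrdConnected)
    (γ : ℝ → M) (r : ℕ) (hr : 2 ≤ r)
    (V : ℕ → (t : ℝ) → TangentSpace 𝓘(ℝ, E) (γ t)) (k : ℕ → ℝ → ℝ)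
    (hγ : SGeom.IsFrenetCurve cov γ J r V k)
    (θ : Fin s → ℝ) (hθ : S.IsSlant γ J θ)
    (a b : ℝ) (ha : a = ∑ α, Real.cos (θ α) ^ 2) (hb : b = ∑ α, Real.cos (θ α))
    (f : ℝ → ℝ) (hf : ContDiffOn ℝ ∞ f J) (hf_pos : ∀ t ∈ J, 0 < f t)
    (hf_nonconst : ¬ ∃ C : ℝ, ∀ t ∈ J, f t = C) :
    SGeom.IsProperFBiharmonic cov f γ J ↔
      (∀ t ∈ J, 3 * (deriv (k 1) t / k 1 t) + 2 * (deriv f t / f t) = 0) ∧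
      (∀ t ∈ J, k 1 t ^ 2 + k 2 t ^ 2 =
        deriv (deriv (k 1)) t / k 1 t + deriv (deriv f) t / f t
          + 2 * (deriv f t / f t) * (deriv (k 1) t / k 1 t)
          + b ^ 2 + (c + 3 * s) / 4 * (1 - a)
          + 3 * ((c - s) / 4) * inner ℝ (S.φ (γ t) (SGeom.velocity γ t)) (V 2 t) ^ 2) ∧
      (∀ t ∈ J, deriv (k 2) t + 2 * k 2 t * (deriv (k 1) t / k 1 t)
          + 2 * k 2 t * (deriv f t / f t)
          + 3 * ((c - s) / 4) * inner ℝ (S.φ (γ t) (SGeom.velocity γ t)) (V 2 t)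
            * inner ℝ (S.φ (γ t) (SGeom.velocity γ t)) (V 3 t) = 0) ∧
      (∀ t ∈ J, k 2 t * k 3 t
          + 3 * ((c - s) / 4) * inner ℝ (S.φ (γ t) (SGeom.velocity γ t)) (V 2 t)
            * inner ℝ (S.φ (γ t) (SGeom.velocity γ t)) (V 4 t) = 0) ∧
      (∀ t ∈ J, inner ℝ (SGeom.tau3 cov f γ t) (S.φ (γ t) (SGeom.velocity γ t)) = 0) := by
  have hiff := SGeom.isFBiharmonic_iff hcov hJ hf hf_pos hγ.smooth
  have key := fun t (ht : t ∈ J) ↦ hγ.tau3_eq_zero_iff (f := f) hcov hs hc hJ hr hθ ht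
  subst ha hb
  constructor
  · rintro ⟨h, -⟩
    have h' := fun t ht ↦ (key t ht).1 (hiff.1 h t ht)
    exact ⟨fun t ht ↦ (h' t ht).1, fun t ht ↦ (h' t ht).2.1, fun t ht ↦ (h' t ht).2.2.1,
      fun t ht ↦ (h' t ht).2.2.2.1, fun t ht ↦ (h' t ht).2.2.2.2⟩
  · rintro ⟨h1, h2, h3, h4, h5⟩
    refine ⟨hiff.2 fun t ht ↦ (key t ht).2 ⟨h1 t ht, h2 t ht, h3 t ht, h4 t ht, h5 t ht⟩,
      fun hbi ↦ hf_nonconst ?_⟩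
    -- If the curve were also biharmonic, `k₁` would be constant, and the tangential equation for
    -- `f` would leave `f' = 0` on the connected set `J`.
    have hd : EqOn (deriv f) 0 J := fun t ht ↦ by
      have e := h1 t ht
      rw [hγ.deriv_eq_zero_of_isBiharmonic hcov hs hc hJ hr hθ hbi ht, zero_div, mul_zero,
        zero_add] at e
      have e' : deriv f t / f t = 0 := by linarith
      exact (div_eq_zero_iff.1 e').resolve_right (hf_pos t ht).ne'
    exact hJ.exists_is_const_of_deriv_eq_zero hJ'.isPreconnected
      (hf.differentiableOn (by simp)) hd
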